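/- **Conventions.** For $X\in\mathbb C^n$ (indices modulo $n$) let $\widehat X_f=\frac1n\sum_t X_t e^{-2\pi i ft/n}$ and $\|X\|_2=(\sum_t|X_t|^2)^{1/2}$. For an integer $m$, $[m]=(-\frac m2,\frac m2]\cap\mathbb Z$, and $|t|$ of a residue $t$ modulo $m$ is the absolute value of its representative in $[m]$. Throughout, $n$ and $k_1\ge 2$ are powers of two with $2k_1\le n$, and $1\le k_0\le n/k_1$. The $j$-th block, $j\in[n/k_1]$, is $I_j=((j-\frac12)k_1,(j+\frac12)k_1]\cap\mathbb Z$ (modulo $n$), and $\widehat X$ is $(k_0,k_1)$-block sparse if it is non-zero on at most $k_0$ of the blocks. Put $X^r_j=X_{j+nr/(2k_1)}$ for $r\in[2k_1]$ (indices $r$ are read modulo $2k_1$). *Filters.* For powers of two $w,N$ with $2w\le N$ and $0<\zeta<1$, a filter $\mathrm{Filter}(N,w,\zeta)$ is the spectrum $\widehat G$ of some $G\in\mathbb R^N$ for which there is $G'\in[0,1]^N$ with $G'_t=1$ for $|t|\le w/2$, $G'_t=0$ for $|t|\ge w$ and $\|G-G'\|_2\le\zeta$, and such that $\widehat G_f=0$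 unless $|f|\le C\frac Nw\log\frac N\zeta$. *Procedure* $\mathrm{SemiEquiInverseFFT}(\widehat Y,N,k,\zeta)$, for $\widehat Y\in\mathbb C^N$: with $\widehat G=\mathrm{Filter}(N,k,\zeta)$ return $$Y_j=\sum_{0\le i<2k}\tfrac{N}{2k}\,(\widehat Y\star\widehat G)_{iN/(2k)}\,e^{2\pi i\cdot ij/(2k)} .$$ *Procedure* $\mathrm{SemiEquiInverseBlockFFT}(\widehat X,n,k_0,k_1,c)$: with $\widehat G=\mathrm{Filter}(n,\frac n{k_1},n^{-c})$ form, for $0\le j<\frac{2n}{k_1}$ and $0\le b<2k_1$, $$\widetilde Y^b_j=\tfrac{k_1}{2}\sum_{0\le l<n/(2k_1)}\widehat X_{b+2k_1l}\,\widehat G_{\frac{k_1}2j-(b+2k_1l)},\qquad \widehat Y^r_j=\sum_{0\le b<2k_1}\widetilde Y^b_j\,e^{2\pi i\, rb/(2k_1)},$$ and return, for all $r\in[2k_1]$ and $|j|\le k_0/2$, the values $Y^r_j$ of $\mathrm{SemiEquiInverseFFT}(\widehat Y^r,\frac{2n}{k_1},k,n^{-(c+1)})$, where $k$ is the least power of two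 with $k\ge k_0$. (In the exponents, an $i$ next to $\pi$ is the imaginary unit.) *Time* is the number of steps of a fixed program on a random access machine with a memory of integer words and a memory of exact complex numbers, where each integer operation $+,-,\cdot,\mathrm{div},\mathrm{mod}$, each complex operation $+,-,\cdot,/,\exp$, each memory access, and each comparison of words or of real parts costs one step, the constants $i$ and $\pi$ are available, and words must stay at most $(n\lceil c\rceil)^{A}$. The input is $n,k_0,k_1,c$, the list (in any order, without repetition) of the indices of the non-zero blocks, and random access to the entries of $\widehat X$. The output is the table of the values $Y^r_j$. **Lemma.** There are filters as above, absolute constants $C$ and $A$, and two programs such that the following holds for all $n,k_0,k_1$ as above, every real $c\ge1$, and every $X\in\mathbb C^n$ with $(k_0,k_1)$-block sparse $\widehat X$. (i) The first program halts within $C\,c^2k_0k_1\log^2n$ steps and returns the values $Y^r_j$, $r\in[2k_1]$, $|j|\le\frac{k_0}2$, of $\mathrm{SemiEquiInverseBlockFFT}(\widehat X,n,k_0,k_1,c)$, and these satisfy $$|Y^r_j-X^r_j|\le 2n^{-c}\|X\|_2 .$$ (ii) For all $\sigma,\Delta$ modulo $n/k_1$ with $\sigma$ odd, the second program, given $\sigma$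 and $\Delta$ as additional input, halts within $C\,c^2k_0k_1\log^2n$ steps and returns values $Y^r_{(j')}$ for all $r\in[2k_1]$ and $|j'|\le\frac{k_0}2$ with $$|Y^r_{(j')}-X^r_{j}|\le 2n^{-c}\|X\|_2,$$ where $j\in[n/k_1]$ is the representative of $\sigma j'+\Delta$ modulo $n/k_1$. -/

import Mathlib

open scoped BigOperators

namespace BlockFFT

noncomputable section

/-! ### Signals, spectra, block sparsity -/

/-- The discrete Fourier transform in the normalization
`Xhat f = (1/n) ∑ t, X t * exp (-2 π i f t / n)`, so that `X t = ∑ f, Xhat f * exp (2 π i f t / n)`. -/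
def normDFT {n : ℕ} [NeZero n] (X : ZMod n → ℂ) : ZMod n → ℂ :=
  fun f => (n : ℂ)⁻¹ * ZMod.dft X f

/-- The (unnormalized) Euclidean norm of a signal. -/
def l2Norm {n : ℕ} [NeZero n] (X : ZMod n → ℂ) : ℝ :=
  Real.sqrt (∑ t, ‖X t‖ ^ 2)

/-- The `j`-th interval `((j - 1/2) k₁, (j + 1/2) k₁] ∩ ℤ`, read modulo `n`. -/
def blockInterval (n k₁ : ℕ) (j : ℤ) : Set (ZMod n) :=
  {f | ∃ x : ℤ, (2 * j - 1) * k₁ < 2 * x ∧ 2 * x ≤ (2 * j + 1) * k₁ ∧ (x : ZMod n) = f}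

/-- The indices of the intervals on which `Xhat` has a non-zero value.  The representative
`ZMod.valMinAbs` of a class modulo `m` lies in `(-m/2, m/2]`. -/
def activeBlocks {n : ℕ} (k₁ : ℕ) (Xhat : ZMod n → ℂ) : Set (ZMod (n / k₁)) :=
  {j | ∃ f ∈ blockInterval n k₁ j.valMinAbs, Xhat f ≠ 0}

/-- `(k₀, k₁)`-block sparsity. -/
def IsBlockSparse {n : ℕ} (k₀ k₁ : ℕ) (Xhat : ZMod n → ℂ) : Prop :=
  (activeBlocks k₁ Xhat).ncard ≤ k₀

/-- The entry `X^r_j = X_{j + n r / (2 k₁)}` of the `r`-th shifted signal. -/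
def shifted {n : ℕ} (k₁ : ℕ) (X : ZMod n → ℂ) (r : ℕ) (j : ℤ) : ℂ :=
  X ((j : ZMod n) + ((n / (2 * k₁) * r : ℕ) : ZMod n))

/-! ### The procedure -/

/-- `Ghat` is (the spectrum of) a semi-equispaced filter of length `N`, width `w` and accuracy `ζ`:
in time domain it is `ζ`-close to an ideal filter `G₀` with values in `[0, 1]`, equal to `1` for
`|t| ≤ w / 2` and to `0` for `|t| ≥ w`; in frequency domain it is supported on a window centered
at zero of length `O((N / w) log (N / ζ))`, with implied constant `C`. -/
def IsSemiEquiFilter (C : ℝ) (N w : ℕ) [NeZero N] (ζ : ℝ) (Ghat : ZMod N → ℂ) : Prop :=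
  (∃ G G₀ : ZMod N → ℝ,
    Ghat = normDFT (fun t => (G t : ℂ)) ∧
    (∀ t, 0 ≤ G₀ t ∧ G₀ t ≤ 1) ∧
    (∀ t : ZMod N, 2 * |t.valMinAbs| ≤ (w : ℤ) → G₀ t = 1) ∧
    (∀ t : ZMod N, (w : ℤ) ≤ |t.valMinAbs| → G₀ t = 0) ∧
    l2Norm (fun t => ((G t - G₀ t : ℝ) : ℂ)) ≤ ζ) ∧
  ∀ f : ZMod N, Ghat f ≠ 0 → ((|f.valMinAbs| : ℤ) : ℝ) ≤ C * ((N : ℝ) / w) * Real.log (N / ζ)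

/-- A choice of a filter for every length `N`, width `w` and accuracy `ζ`. -/
abbrev FilterFamily : Type := (N : ℕ) → (w : ℕ) → (ζ : ℝ) → ZMod N → ℂ

/-- `exp (2 π i x / m)`. -/
def rootPow (m : ℕ) (x : ℤ) : ℂ := Complex.exp (2 * Real.pi * Complex.I * x / m)

/-- The convolution `(Yhat ⋆ Ghat)_x` over `ZMod N`. -/
def conv {N : ℕ} (Yhat Ghat : ZMod N → ℂ) (x : ZMod N) : ℂ :=
  ∑ f ∈ Finset.range N, Yhat (f : ZMod N) * Ghat (x - (f : ZMod N))

/-- Semi-equispaced inverse FFT of a signal of length `N` with parameter `k`: convolve with the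
filter, keep the `2 k` frequencies that are multiples of `N / (2 k)`, and take the inverse
transform of length `2 k`.  The factor `N / (2 k)` belongs to the normalization of the transform. -/
def semiEquiInverseFFT (filt : FilterFamily) {N : ℕ} (Yhat : ZMod N → ℂ) (k : ℕ) (ζ : ℝ)
    (j : ℤ) : ℂ :=
  ∑ i ∈ Finset.range (2 * k),
    ((N / (2 * k) : ℕ) : ℂ) * conv Yhat (filt N k ζ) ((N / (2 * k) * i : ℕ) : ZMod N) *
      rootPow (2 * k) (i * j)

/-- The aliased vector `b ↦ (k₁ / 2) ∑ l, Xhat_{b + 2 k₁ l} Ghat_{(k₁ / 2) j - (b + 2 k₁ l)}`. -/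
def aliased {n : ℕ} (k₁ : ℕ) (Xhat Ghat : ZMod n → ℂ) (j : ZMod (2 * n / k₁)) (b : ℕ) : ℂ :=
  ((k₁ / 2 : ℕ) : ℂ) * ∑ l ∈ Finset.range (n / (2 * k₁)),
    Xhat ((b + 2 * k₁ * l : ℕ) : ZMod n) *
      Ghat (((k₁ / 2 * j.val : ℕ) : ZMod n) - ((b + 2 * k₁ * l : ℕ) : ZMod n))

/-- The reduced spectra of length `2 n / k₁`: for each `j`, the inverse transform (in `r`) of
length `2 k₁` of the aliased vector. -/
def reducedSpectrum {n : ℕ} (k₁ : ℕ) (Xhat Ghat : ZMod n → ℂ) (r : ℕ) :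
    ZMod (2 * n / k₁) → ℂ :=
  fun j => ∑ b ∈ Finset.range (2 * k₁), aliased k₁ Xhat Ghat j b * rootPow (2 * k₁) (r * b)

/-- Semi-equispaced inverse block FFT, the two-level scheme.  Its first level uses the filter with
pass band `|t| ≤ n / (2 k₁)` and accuracy `n ^ (-c)`; its second level applies the semi-equispaced
inverse FFT with `k₀` rounded up to a power of two and accuracy `n ^ (-(c + 1))` to each
reduced spectrum. -/
def semiEquiInverseBlockFFT (filt : FilterFamily) {n : ℕ} (Xhat : ZMod n → ℂ) (k₀ k₁ : ℕ)
    (c : ℝ) (r : ℕ) (j : ℤ) : ℂ :=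
  semiEquiInverseFFT filt
    (reducedSpectrum k₁ Xhat (filt n (n / k₁) ((n : ℝ) ^ (-c))) r)
    (2 ^ Nat.clog 2 k₀) ((n : ℝ) ^ (-(c + 1))) j

/-! ### The machine: a random access machine with a word memory and a complex memory

Words are natural numbers that must not exceed a bound `W`; complex numbers are exact.
Every arithmetic operation, `exp`, memory access and test costs one step.  Complex values never
enter the word memory; they influence control only through comparison of real parts. -/

/-- Memory contents. -/
structure Mem where
  /-- The word memory. -/
  word : ℕ → ℕ
  /-- The complex memory. -/
  cpx : ℕ → ℂ

/-- Word expressions. -/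
inductive WExp : Type
  | lit (k : ℕ)
  | get (a : WExp)
  | add (a b : WExp)
  | sub (a b : WExp)
  | mul (a b : WExp)
  | div (a b : WExp)
  | mod (a b : WExp)

/-- The value of a word expression (truncated subtraction, integer division). -/
def WExp.val (s : Mem) : WExp → ℕ
  | .lit k => k
  | .get a => s.word (a.val s)
  | .add a b => a.val s + b.val s
  | .sub a b => a.val s - b.val s
  | .mul a b => a.val s * b.val s
  | .div a b => a.val s / b.val s
  | .mod a b => a.val s % b.val s

/-- No overflow: the value of every subexpression is at most `W`. -/
def WExp.Fits (W : ℕ) (s : Mem) : WExp → Prop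
  | .lit k => k ≤ W
  | .get a => a.Fits W s ∧ s.word (a.val s) ≤ W
  | .add a b => a.Fits W s ∧ b.Fits W s ∧ a.val s + b.val s ≤ W
  | .sub a b => a.Fits W s ∧ b.Fits W s
  | .mul a b => a.Fits W s ∧ b.Fits W s ∧ a.val s * b.val s ≤ W
  | .div a b => a.Fits W s ∧ b.Fits W s
  | .mod a b => a.Fits W s ∧ b.Fits W s

/-- The number of steps needed to evaluate a word expression. -/
def WExp.cost : WExp → ℕ
  | .lit _ => 1
  | .get a => a.cost + 1
  | .add a b => a.cost + b.cost + 1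
  | .sub a b => a.cost + b.cost + 1
  | .mul a b => a.cost + b.cost + 1
  | .div a b => a.cost + b.cost + 1
  | .mod a b => a.cost + b.cost + 1

/-- Complex expressions. -/
inductive CExp : Type
  | ofWord (a : WExp)
  | get (a : WExp)
  | I
  | pi
  | add (x y : CExp)
  | sub (x y : CExp)
  | mul (x y : CExp)
  | div (x y : CExp)
  | exp (x : CExp)

/-- The value of a complex expression (division by zero returns zero). -/
def CExp.val (s : Mem) : CExp → ℂ
  | .ofWord a => (a.val s : ℂ)
  | .get a => s.cpx (a.val s)
  | .I => Complex.I
  | .pi => (Real.pi : ℂ)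
  | .add x y => x.val s + y.val s
  | .sub x y => x.val s - y.val s
  | .mul x y => x.val s * y.val s
  | .div x y => x.val s / y.val s
  | .exp x => Complex.exp (x.val s)

/-- No overflow in the word expressions inside a complex expression. -/
def CExp.Fits (W : ℕ) (s : Mem) : CExp → Prop
  | .ofWord a => a.Fits W s
  | .get a => a.Fits W s
  | .I => True
  | .pi => True
  | .add x y => x.Fits W s ∧ y.Fits W s
  | .sub x y => x.Fits W s ∧ y.Fits W s
  | .mul x y => x.Fits W s ∧ y.Fits W s
  | .div x y => x.Fits W s ∧ y.Fits W s
  | .exp x => x.Fits W s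

/-- The number of steps needed to evaluate a complex expression. -/
def CExp.cost : CExp → ℕ
  | .ofWord a => a.cost + 1
  | .get a => a.cost + 1
  | .I => 1
  | .pi => 1
  | .add x y => x.cost + y.cost + 1
  | .sub x y => x.cost + y.cost + 1
  | .mul x y => x.cost + y.cost + 1
  | .div x y => x.cost + y.cost + 1
  | .exp x => x.cost + 1

/-- Tests: comparison of words, and comparison of the real parts of complex numbers. -/
inductive Test : Type
  | lt (a b : WExp)
  | le (x y : CExp)

/-- The outcome of a test. -/
def Test.Holds (s : Mem) : Test → Prop
  | .lt a b => a.val s < b.val s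
  | .le x y => (x.val s).re ≤ (y.val s).re

/-- No overflow in a test. -/
def Test.Fits (W : ℕ) (s : Mem) : Test → Prop
  | .lt a b => a.Fits W s ∧ b.Fits W s
  | .le x y => x.Fits W s ∧ y.Fits W s

/-- The number of steps of a test. -/
def Test.cost : Test → ℕ
  | .lt a b => a.cost + b.cost + 1
  | .le x y => x.cost + y.cost + 1

/-- Programs. -/
inductive Prog : Type
  | skip
  | setW (addr e : WExp)
  | setC (addr : WExp) (e : CExp)
  | seq (p q : Prog)
  | ite (b : Test) (p q : Prog)
  | loop (b : Test) (p : Prog)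

/-- `Exec W p s s₁ t`: with words bounded by `W`, the program `p`, started in memory `s`, halts
after `t` steps in memory `s₁`, without overflow.  `loop b p` repeats `p` while `b` holds. -/
inductive Exec (W : ℕ) : Prog → Mem → Mem → ℕ → Prop
  | skip (s : Mem) : Exec W .skip s s 1
  | setW (addr e : WExp) (s : Mem) (ha : addr.Fits W s) (he : e.Fits W s) :
      Exec W (.setW addr e) s ⟨Function.update s.word (addr.val s) (e.val s), s.cpx⟩
        (addr.cost + e.cost + 1)
  | setC (addr : WExp) (e : CExp) (s : Mem) (ha : addr.Fits W s) (he : e.Fits W s) :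
      Exec W (.setC addr e) s ⟨s.word, Function.update s.cpx (addr.val s) (e.val s)⟩
        (addr.cost + e.cost + 1)
  | seq (p q : Prog) (s s₁ s₂ : Mem) (t₁ t₂ : ℕ) (hp : Exec W p s s₁ t₁)
      (hq : Exec W q s₁ s₂ t₂) : Exec W (.seq p q) s s₂ (t₁ + t₂)
  | iteTrue (b : Test) (p q : Prog) (s s₁ : Mem) (t : ℕ) (hf : b.Fits W s) (hb : b.Holds s)
      (hp : Exec W p s s₁ t) : Exec W (.ite b p q) s s₁ (b.cost + t)
  | iteFalse (b : Test) (p q : Prog) (s s₁ : Mem) (t : ℕ) (hf : b.Fits W s) (hb : ¬ b.Holds s)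
      (hq : Exec W q s s₁ t) : Exec W (.ite b p q) s s₁ (b.cost + t)
  | loopDone (b : Test) (p : Prog) (s : Mem) (hf : b.Fits W s) (hb : ¬ b.Holds s) :
      Exec W (.loop b p) s s b.cost
  | loopStep (b : Test) (p : Prog) (s s₁ s₂ : Mem) (t₁ t₂ : ℕ) (hf : b.Fits W s)
      (hb : b.Holds s) (hp : Exec W p s s₁ t₁) (hq : Exec W (.loop b p) s₁ s₂ t₂) :
      Exec W (.loop b p) s s₂ (b.cost + t₁ + t₂)

/-- The initial memory: the word memory holds the list `args`, the complex memory holds the number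
`c` in cell `0` and `Xhat f` (for `0 ≤ f < n`) in cell `1 + f`; all other cells are zero. -/
def inputMem {n : ℕ} (args : List ℕ) (c : ℝ) (Xhat : ZMod n → ℂ) : Mem where
  word i := args.getD i 0
  cpx i := if i = 0 then (c : ℂ) else if i ≤ n then Xhat ((i - 1 : ℕ) : ZMod n) else 0

/-- With words bounded by `W`, the program `p` started in memory `s` halts within `T` steps and
returns the table of the values `Y r j`, `0 ≤ r < 2 k₁`, `|j| ≤ k₀ / 2`, row by row, in consecutive
complex cells that start at the address found in word cell `0`. -/
def Returns (W : ℕ) (p : Prog) (s : Mem) (T : ℝ) (k₀ k₁ : ℕ) (Y : ℕ → ℤ → ℂ) : Prop :=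
  ∃ (s₁ : Mem) (t : ℕ), Exec W p s s₁ t ∧ (t : ℝ) ≤ T ∧
    ∀ r < 2 * k₁, ∀ j : ℤ, 2 * |j| ≤ (k₀ : ℤ) →
      s₁.cpx (s₁.word 0 + r * (2 * (k₀ / 2) + 1) + (j + (k₀ / 2 : ℕ)).toNat) = Y r j

end

end BlockFFT

/-!
The proof consists of an explicit filter, an error analysis, and a verified program.

*The filter.* In time domain it is the box `|s| ≤ 3 w / 4`, smoothed by a kernel whose spectrum is
a Gaussian of width about `(N / w) √lam`, cut off at `32 (N / w) lam`, where `lam` is of the order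
of `log (N / ζ)`.  By Poisson summation (`theta_eq`) the kernel is a sum of positive Gaussians, up
to the exponentially small effect of the cut-off; hence it is almost non-negative, and it is
negligible for `|u| ≥ w / 4` (`gauss_sum_bound`, `kernel_bound`).  Smoothing therefore does not
leave `[0, 1]` by more than a negligible amount, and it affects the box only in `w / 2 < |s| < w`
(`isTimeFilter_smooth`, `filtVal_eq_normDFT`).  In frequency domain the filter is the product of a
Dirichlet kernel and the cut off Gaussian, a closed expression `filtVal` that the machine evaluates
in a constant number of steps.

*Accuracy.* Sub-sampling a convolution in frequency amounts to multiplication by the filter and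
aliasing in time (`alias_sum`).  The aliasing period `2 w` separates the indices `|j| ≤ w / 2` from
the support of the ideal filter, so that only the deviation from the ideal filter contributes an
error (`filter_error`).  The reduced spectra of the first level are sub-sampled convolutions of
this kind (`reducedSpectrum_eq`), and the second level applies the same principle to them.  The
error of the first level is at most `n ^ (-c) ‖X‖`.  The signals on the second level have norm at
most `n ‖X‖`, and its filter has accuracy `n ^ (-(c + 1))` (`two_level_error`).

*The program.* A block influences only `O(c log n)` frequencies of the reduced spectra, and each of
these influences only `O(c log n)` of the `2 k` frequencies of the second level (`exists_freq`,
`sum_idx`).  For each active block and each frequency that it influences, one fast Fourier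
transform of length `2 k₁` yields the contributions to all `2 k₁` reduced spectra, which are
immediately distributed to the second level; the reduced spectra themselves are never stored.  It
remains to transform, for each `r`, a vector of length `2 k`.  The number of steps is dominated by
`k₀ · O(c log n) · k₁ · O(c log n)` (`Inst.Params.time_le`).  That the program computes the right
values is proved with triples `Spec` for total correctness with time (`passProg_spec`,
`mainProg_spec`), which describe the output as a sum over windows and blocks; that sum is then
identified with the transform of the reduced spectra (`outVal_eq`, `sum_red`, `outVal_eq_sum`).

*Permuted indices.* Multiplication of the time index by `σ` and translation by `Δ` correspond to a
permutation and a modulation of the frequencies of the second level (`permuted_error`).  The length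
of the reduced signals is `2 n / k₁`, while the index `σ j + Δ` is given modulo `n / k₁` only, so
it has two lifts.  The second program makes one pass for each of them, and retains for each `j` the
lift whose representative lies in the pass band of the first filter (`exists_lift`).
-/

namespace BlockFFT

noncomputable section

/-! ### A program logic for the machine -/

/-- A weight that dominates both the cost of a word expression and the exponent to which a bound for
the words of the memory has to be raised in order to bound all intermediate values. -/
def WExp.wt : WExp → ℕ
  | .lit k => k + 1
  | .get a => a.wt + 1
  | .add a b => a.wt + b.wt + 1
  | .sub a b => a.wt + b.wt + 1
  | .mul a b => a.wt + b.wt + 1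
  | .div a b => a.wt + b.wt + 1
  | .mod a b => a.wt + b.wt + 1

/-- The weight of a complex expression, see `WExp.wt`. -/
def CExp.wt : CExp → ℕ
  | .ofWord a => a.wt + 1
  | .get a => a.wt + 1
  | .I => 1
  | .pi => 1
  | .add x y => x.wt + y.wt + 1
  | .sub x y => x.wt + y.wt + 1
  | .mul x y => x.wt + y.wt + 1
  | .div x y => x.wt + y.wt + 1
  | .exp x => x.wt + 1

/-- The weight of a test, see `WExp.wt`. -/
def Test.wt : Test → ℕ
  | .lt a b => a.wt + b.wt + 1
  | .le x y => x.wt + y.wt + 1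

lemma WExp.cost_le_wt (e : WExp) : e.cost ≤ e.wt := by
  induction e <;> simp only [WExp.cost, WExp.wt] <;> omega

lemma CExp.cost_le_wt (e : CExp) : e.cost ≤ e.wt := by
  induction e <;> simp only [CExp.cost, CExp.wt] <;>
    (try have := WExp.cost_le_wt ‹WExp›) <;> omega

lemma Test.cost_le_wt (b : Test) : b.cost ≤ b.wt := by
  cases b with
  | lt a b => have := a.cost_le_wt; have := b.cost_le_wt; simp only [Test.cost, Test.wt]; omega
  | le a b => have := a.cost_le_wt; have := b.cost_le_wt; simp only [Test.cost, Test.wt]; omega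

lemma WExp.val_le_pow {U : ℕ} (hU : 2 ≤ U) (s : Mem) (hs : ∀ a, s.word a ≤ U) (e : WExp) :
    e.val s ≤ U ^ e.wt := by
  have h1 : 1 ≤ U := by omega
  have hself : ∀ k, U ≤ U ^ (k + 1) := fun k => Nat.le_self_pow (by omega) U
  induction e with
  | lit k =>
    calc k ≤ 2 ^ (k + 1) := by
          have := Nat.lt_two_pow_self (n := k + 1); omega
      _ ≤ U ^ (k + 1) := Nat.pow_le_pow_left hU _
  | get a ih => exact (hs _).trans (hself _)
  | add a b iha ihb =>
    have ha : U ^ a.wt ≤ U ^ (a.wt + b.wt) := Nat.pow_le_pow_right h1 (by omega)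
    have hb : U ^ b.wt ≤ U ^ (a.wt + b.wt) := Nat.pow_le_pow_right h1 (by omega)
    simp only [WExp.val, WExp.wt, pow_succ]
    nlinarith
  | sub a b iha ihb =>
    have ha : U ^ a.wt ≤ U ^ (a.wt + b.wt + 1) := Nat.pow_le_pow_right h1 (by omega)
    simp only [WExp.val, WExp.wt]
    omega
  | mul a b iha ihb =>
    simp only [WExp.val, WExp.wt]
    calc a.val s * b.val s ≤ U ^ a.wt * U ^ b.wt := Nat.mul_le_mul iha ihb
      _ = U ^ (a.wt + b.wt) := (pow_add _ _ _).symm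
      _ ≤ _ := Nat.pow_le_pow_right h1 (by omega)
  | div a b iha ihb =>
    have ha : U ^ a.wt ≤ U ^ (a.wt + b.wt + 1) := Nat.pow_le_pow_right h1 (by omega)
    exact (Nat.div_le_self _ _).trans (iha.trans ha)
  | mod a b iha ihb =>
    have ha : U ^ a.wt ≤ U ^ (a.wt + b.wt + 1) := Nat.pow_le_pow_right h1 (by omega)
    exact (Nat.mod_le _ _).trans (iha.trans ha)

/-- If the words of the memory are at most `U`, the evaluation of `e` does not overflow a machine
whose words may reach `U ^ e.wt`.  This reduces overflow checks to bounds for the stored words. -/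
lemma WExp.fits {U W : ℕ} (hU : 2 ≤ U) (s : Mem) (hs : ∀ a, s.word a ≤ U) (e : WExp)
    (hW : U ^ e.wt ≤ W) : e.Fits W s := by
  have h1 : 1 ≤ U := by omega
  have key : ∀ {i j : ℕ}, i ≤ j → U ^ j ≤ W → U ^ i ≤ W := fun hij h =>
    (Nat.pow_le_pow_right h1 hij).trans h
  induction e with
  | lit k => exact (WExp.val_le_pow hU s hs (.lit k)).trans hW
  | get a ih =>
    simp only [WExp.wt] at hW
    exact ⟨ih (key (by omega) hW), (hs _).trans ((Nat.le_self_pow (by omega) U).trans hW)⟩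
  | add a b iha ihb =>
    have := WExp.val_le_pow hU s hs (.add a b)
    simp only [WExp.wt] at hW
    exact ⟨iha (key (by omega) hW), ihb (key (by omega) hW), this.trans hW⟩
  | mul a b iha ihb =>
    have := WExp.val_le_pow hU s hs (.mul a b)
    simp only [WExp.wt] at hW
    exact ⟨iha (key (by omega) hW), ihb (key (by omega) hW), this.trans hW⟩
  | sub a b iha ihb =>
    simp only [WExp.wt] at hW
    exact ⟨iha (key (by omega) hW), ihb (key (by omega) hW)⟩
  | div a b iha ihb =>
    simp only [WExp.wt] at hW
    exact ⟨iha (key (by omega) hW), ihb (key (by omega) hW)⟩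
  | mod a b iha ihb =>
    simp only [WExp.wt] at hW
    exact ⟨iha (key (by omega) hW), ihb (key (by omega) hW)⟩

lemma CExp.fits {U W : ℕ} (hU : 2 ≤ U) (s : Mem) (hs : ∀ a, s.word a ≤ U) (e : CExp)
    (hW : U ^ e.wt ≤ W) : e.Fits W s := by
  have key : ∀ {i j : ℕ}, i ≤ j → U ^ j ≤ W → U ^ i ≤ W := fun hij h =>
    (Nat.pow_le_pow_right (by omega) hij).trans h
  induction e with
  | ofWord a => exact WExp.fits hU s hs a (key (by simp only [CExp.wt]; omega) hW)
  | get a => exact WExp.fits hU s hs a (key (by simp only [CExp.wt]; omega) hW)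
  | I => trivial
  | pi => trivial
  | exp a ih => exact ih (key (by simp only [CExp.wt]; omega) hW)
  | add a b iha ihb | sub a b iha ihb | mul a b iha ihb | div a b iha ihb =>
    simp only [CExp.wt] at hW
    exact ⟨iha (key (by omega) hW), ihb (key (by omega) hW)⟩

lemma Test.fits {U W : ℕ} (hU : 2 ≤ U) (s : Mem) (hs : ∀ a, s.word a ≤ U) (b : Test)
    (hW : U ^ b.wt ≤ W) : b.Fits W s := by
  have key : ∀ {i j : ℕ}, i ≤ j → U ^ j ≤ W → U ^ i ≤ W := fun hij h =>
    (Nat.pow_le_pow_right (by omega) hij).trans h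
  cases b with
  | lt a b =>
    simp only [Test.wt] at hW
    exact ⟨WExp.fits hU s hs a (key (by omega) hW), WExp.fits hU s hs b (key (by omega) hW)⟩
  | le a b =>
    simp only [Test.wt] at hW
    exact ⟨CExp.fits hU s hs a (key (by omega) hW), CExp.fits hU s hs b (key (by omega) hW)⟩

/-- The memory in which the words below `ini 0 + 10` are those of `ini`, the word registers
`reg 0, reg 1, …` are stored from address `ini 0 + 10` on, and `cpx` is the complex memory. -/
def memOf (ini reg : ℕ → ℕ) (cpx : ℕ → ℂ) : Mem where
  word a := if a < ini 0 + 10 then ini a else reg (a - (ini 0 + 10))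
  cpx := cpx

/-- The address of the `i`-th register. -/
def regAddr (i : ℕ) : WExp := .add (.get (.lit 0)) (.lit (10 + i))

/-- The content of the `i`-th register. -/
def rg (i : ℕ) : WExp := .get (regAddr i)

/-- Assignment to the `i`-th register. -/
def setR (i : ℕ) (e : WExp) : Prog := .setW (regAddr i) e

@[simp] lemma regAddr_val (ini reg : ℕ → ℕ) (cpx : ℕ → ℂ) (i : ℕ) :
    (regAddr i).val (memOf ini reg cpx) = ini 0 + (10 + i) := by
  simp [regAddr, WExp.val, memOf]

@[simp] lemma rg_val (ini reg : ℕ → ℕ) (cpx : ℕ → ℂ) (i : ℕ) :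
    (rg i).val (memOf ini reg cpx) = reg i := by
  have h : ini 0 + (10 + i) - (ini 0 + 10) = i := by omega
  simp only [rg, WExp.val, regAddr_val]
  simp [memOf, h]

@[simp] lemma memOf_cpx (ini reg : ℕ → ℕ) (cpx : ℕ → ℂ) : (memOf ini reg cpx).cpx = cpx := rfl

lemma memOf_word_lt {ini : ℕ → ℕ} (reg : ℕ → ℕ) (cpx : ℕ → ℂ) {a : ℕ} (h : a < ini 0 + 10) :
    (memOf ini reg cpx).word a = ini a := by
  simp [memOf, h]

lemma memOf_update (ini reg : ℕ → ℕ) (cpx : ℕ → ℂ) (i v : ℕ) :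
    (⟨Function.update (memOf ini reg cpx).word (ini 0 + (10 + i)) v, cpx⟩ : Mem) =
      memOf ini (Function.update reg i v) cpx := by
  simp only [memOf, Mem.mk.injEq, and_true]
  funext a
  by_cases ha : a = ini 0 + (10 + i)
  · subst ha
    have h : ini 0 + (10 + i) - (ini 0 + 10) = i := by omega
    simp [h]
  · rw [Function.update_of_ne ha]
    by_cases h : a < ini 0 + 10
    · simp [h]
    · rw [if_neg h, if_neg h, Function.update_of_ne]
      omega

/-- An upper bound for the weight of every expression of the programs below, hence for the cost of
one of their elementary steps. -/
def wtBound : ℕ := 50000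

/-- The fixed data of a run: the initial words, a bound `U` for all words that are stored, and the
bound `W` of the machine, which leaves room for all intermediate values. -/
structure Env where
  /-- The initial contents of the word memory; the words below `ini 0 + 10` are never changed. -/
  ini : ℕ → ℕ
  /-- A bound for all stored words. -/
  U : ℕ
  /-- The bound for the words of the machine. -/
  W : ℕ
  two_le : 2 ≤ U
  pow_le : U ^ wtBound ≤ W
  ini_le : ∀ a, ini a ≤ U

/-- An assertion about the registers and the complex memory. -/
abbrev Assertion : Type := (ℕ → ℕ) → (ℕ → ℂ) → Prop

/-- The registers below `l` have the values `P`, and the complex memory satisfies `Φ`. -/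
def At (l : ℕ) (P : ℕ → ℕ) (Φ : (ℕ → ℂ) → Prop) : Assertion :=
  fun reg cpx => (∀ r < l, reg r = P r) ∧ Φ cpx

/-- Total correctness with time: from any state with `pre`, the program halts in a state with
`post` after at most `T` elementary steps, each of cost at most `wtBound`; all words that
are stored stay at most `E.U`. -/
def Spec (E : Env) (pre : Assertion) (p : Prog) (T : ℕ) (post : Assertion) : Prop :=
  ∀ reg cpx, (∀ r, reg r ≤ E.U) → pre reg cpx → ∃ reg' cpx' t,
    Exec E.W p (memOf E.ini reg cpx) (memOf E.ini reg' cpx') t ∧ t ≤ wtBound * T ∧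
      (∀ r, reg' r ≤ E.U) ∧ post reg' cpx'

namespace Env
variable (E : Env)

lemma memOf_word_le {reg : ℕ → ℕ} (cpx : ℕ → ℂ) (h : ∀ r, reg r ≤ E.U) (a : ℕ) :
    (memOf E.ini reg cpx).word a ≤ E.U := by
  simp only [memOf]
  split
  · exact E.ini_le a
  · exact h _

lemma pow_wt_le {k : ℕ} (h : k ≤ wtBound) : E.U ^ k ≤ E.W :=
  (Nat.pow_le_pow_right (by have := E.two_le; omega) h).trans E.pow_le

end Env

section rules
variable {E : Env} {l l' T T' T₁ T₂ : ℕ} {P P' : ℕ → ℕ} {Φ Ψ : (ℕ → ℂ) → Prop}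
  {pre mid post : Assertion}

lemma Spec.seq {p q : Prog} (hp : Spec E pre p T₁ mid) (hq : Spec E mid q T₂ post) :
    Spec E pre (.seq p q) (T₁ + T₂) post := by
  intro reg cpx hb h
  obtain ⟨reg', cpx', t, he, ht, hb', h'⟩ := hp reg cpx hb h
  obtain ⟨reg'', cpx'', t', he', ht', hb'', h''⟩ := hq reg' cpx' hb' h'
  exact ⟨reg'', cpx'', t + t', .seq _ _ _ _ _ _ _ he he', by rw [mul_add]; omega, hb'', h''⟩

lemma Spec.mono {pre' post' : Assertion} {p : Prog} (h : Spec E pre p T post)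
    (hpre : ∀ reg cpx, pre' reg cpx → pre reg cpx)
    (hpost : ∀ reg cpx, post reg cpx → post' reg cpx) (hT : T ≤ T') :
    Spec E pre' p T' post' := by
  intro reg cpx hb h0
  obtain ⟨reg', cpx', t, he, ht, hb', h'⟩ := h reg cpx hb (hpre _ _ h0)
  exact ⟨reg', cpx', t, he, ht.trans (Nat.mul_le_mul_left _ hT), hb', hpost _ _ h'⟩

lemma Spec.conseq {Φ' Ψ' : (ℕ → ℂ) → Prop} {p : Prog}
    (h : Spec E (At l P Φ) p T (At l' P' Ψ)) (hpre : ∀ cpx, Φ' cpx → Φ cpx)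
    (hpost : ∀ cpx, Ψ cpx → Ψ' cpx) :
    Spec E (At l P Φ') p T (At l' P' Ψ') :=
  h.mono (fun _ _ h => ⟨h.1, hpre _ h.2⟩) (fun _ _ h => ⟨h.1, hpost _ h.2⟩) le_rfl

/-- Registers from `l` on may be forgotten. -/
lemma Spec.forget {Ψ : (ℕ → ℂ) → Prop} {p : Prog} (h : Spec E pre p T (At l' P' Ψ))
    (hl : l ≤ l') (hP : ∀ r < l, P' r = P r) : Spec E pre p T (At l P Ψ) :=
  h.mono (fun _ _ h => h)
    (fun _ _ h => ⟨fun r hr => (h.1 r (by omega)).trans (hP r hr), h.2⟩) le_rfl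

lemma at_succ_iff {reg : ℕ → ℕ} {cpx : ℕ → ℂ} {v : ℕ} :
    At (l + 1) (Function.update P l v) Φ reg cpx ↔
      (∀ r < l, reg r = P r) ∧ reg l = v ∧ Φ cpx := by
  constructor
  · rintro ⟨h, h'⟩
    refine ⟨fun r hr => ?_, by simpa using h l (by omega), h'⟩
    have := h r (by omega)
    rwa [Function.update_of_ne (by omega)] at this
  · rintro ⟨h, h', h''⟩
    refine ⟨fun r hr => ?_, h''⟩
    by_cases hrl : r = l
    · subst hrl; simpa using h'
    · rw [Function.update_of_ne hrl]; exact h r (by omega)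

/-- Assignment to the first register about which nothing is known yet: afterwards the registers
below `l + 1` are known. -/
lemma Spec.setR_at {e : WExp} {v : ℕ} (hw : e.wt + l + 20 ≤ wtBound) (hv : v ≤ E.U)
    (hpre : ∀ reg cpx, pre reg cpx → At l P Φ reg cpx)
    (he : ∀ reg cpx, pre reg cpx → e.val (memOf E.ini reg cpx) = v) :
    Spec E pre (setR l e) 1 (At (l + 1) (Function.update P l v) Φ) := by
  intro reg cpx hb h
  have hs := E.memOf_word_le cpx hb
  have hwa : (regAddr l).wt = l + 14 := by simp only [regAddr, WExp.wt]; omega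
  have hex := Exec.setW (W := E.W) (regAddr l) e (memOf E.ini reg cpx)
    (WExp.fits E.two_le _ hs _ (E.pow_wt_le (by omega)))
    (WExp.fits E.two_le _ hs _ (E.pow_wt_le (by omega)))
  rw [regAddr_val, memOf_cpx, memOf_update, he reg cpx h] at hex
  refine ⟨_, _, _, hex, ?_, ?_, ?_⟩
  · have := (regAddr l).cost_le_wt; have := e.cost_le_wt; omega
  · intro r
    by_cases hr : r = l
    · subst hr; simpa using hv
    · rw [Function.update_of_ne hr]; exact hb r
  · rw [at_succ_iff]
    refine ⟨fun r hr => ?_, by simp, (hpre _ _ h).2⟩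
    rw [Function.update_of_ne (by omega)]; exact (hpre _ _ h).1 r hr

/-- Assignment to a complex cell; the word registers are not affected. -/
lemma Spec.setC_at {a : WExp} {e : CExp} (hw : a.wt + e.wt + 1 ≤ wtBound)
    (h : ∀ reg cpx, At l P Φ reg cpx → Ψ (Function.update cpx (a.val (memOf E.ini reg cpx))
      (e.val (memOf E.ini reg cpx)))) :
    Spec E (At l P Φ) (.setC a e) 1 (At l P Ψ) := by
  intro reg cpx hb h0
  have hs := E.memOf_word_le cpx hb
  have hex := Exec.setC (W := E.W) a e (memOf E.ini reg cpx)
    (WExp.fits E.two_le _ hs _ (E.pow_wt_le (by omega)))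
    (CExp.fits E.two_le _ hs _ (E.pow_wt_le (by omega)))
  refine ⟨reg, _, _, hex, ?_, hb, h0.1, h reg cpx h0⟩
  have := a.cost_le_wt; have := e.cost_le_wt; omega

/-- The loop with control register `l`, which starts with the value of `init`, and is updated to
the value of `step` after each pass through the body. -/
def whileR (l : ℕ) (init : WExp) (b : Test) (step : WExp) (body : Prog) : Prog :=
  .seq (setR l init) (.loop b (.seq body (setR l step)))

/-- The rule for `whileR`: the control register runs through `x 0, …, x M`. -/
lemma Spec.whileR {init step : WExp} {b : Test} {body : Prog} (x : ℕ → ℕ) (M : ℕ)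
    (I : ℕ → (ℕ → ℂ) → Prop) (hwi : init.wt + l + 20 ≤ wtBound)
    (hws : step.wt + l + 20 ≤ wtBound) (hwb : b.wt ≤ wtBound)
    (hinit : ∀ reg cpx, At l P (I 0) reg cpx → init.val (memOf E.ini reg cpx) = x 0)
    (hx : ∀ m ≤ M, x m ≤ E.U)
    (htest : ∀ m ≤ M, ∀ reg cpx, At (l + 1) (Function.update P l (x m)) (I m) reg cpx →
      (b.Holds (memOf E.ini reg cpx) ↔ m < M))
    (hstep : ∀ m < M, ∀ reg cpx, At (l + 1) (Function.update P l (x m)) (I (m + 1)) reg cpx →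
      step.val (memOf E.ini reg cpx) = x (m + 1))
    (hbody : ∀ m < M, Spec E (At (l + 1) (Function.update P l (x m)) (I m)) body T
      (At (l + 1) (Function.update P l (x m)) (I (m + 1)))) :
    Spec E (At l P (I 0)) (whileR l init b step body) (M * (T + 2) + 2)
      (At (l + 1) (Function.update P l (x M)) (I M)) := by
  have hbc : b.cost ≤ wtBound := b.cost_le_wt.trans hwb
  have main : ∀ d m, m + d = M → Spec E (At (l + 1) (Function.update P l (x m)) (I m))
      (.loop b (.seq body (setR l step))) (d * (T + 2) + 1)
      (At (l + 1) (Function.update P l (x M)) (I M)) := by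
    intro d
    induction d with
    | zero =>
      intro m hm reg cpx hb h
      obtain rfl : m = M := by omega
      have hs := E.memOf_word_le cpx hb
      refine ⟨reg, cpx, _, Exec.loopDone b _ _ (Test.fits E.two_le _ hs _ (E.pow_wt_le hwb))
        (by rw [htest m le_rfl reg cpx h]; omega), by omega, hb, h⟩
    | succ d ih =>
      intro m hm reg cpx hb h
      have hs := E.memOf_word_le cpx hb
      have hset : Spec E (At (l + 1) (Function.update P l (x m)) (I (m + 1))) (setR l step) 1
          (At (l + 1) (Function.update P l (x (m + 1))) (I (m + 1))) := by
        refine Spec.setR_at hws (hx (m + 1) (by omega)) (fun reg cpx h => ?_)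
          (hstep m (by omega))
        obtain ⟨h1, h2, h3⟩ := at_succ_iff.1 h
        exact ⟨h1, h3⟩
      obtain ⟨reg₁, cpx₁, t₁, he₁, ht₁, hb₁, h₁⟩ :=
        ((hbody m (by omega)).seq hset) reg cpx hb h
      obtain ⟨reg₂, cpx₂, t₂, he₂, ht₂, hb₂, h₂⟩ := ih (m + 1) (by omega) reg₁ cpx₁ hb₁ h₁
      refine ⟨reg₂, cpx₂, _, Exec.loopStep b _ _ _ _ _ _
        (Test.fits E.two_le _ hs _ (E.pow_wt_le hwb))
        ((htest m (by omega) reg cpx h).2 (by omega)) he₁ he₂, ?_, hb₂, h₂⟩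
      have : wtBound * ((d + 1) * (T + 2) + 1) =
        wtBound + wtBound * (T + 1) + wtBound * (d * (T + 2) + 1) := by ring
      omega
  have := (Spec.setR_at hwi (hx 0 (by omega)) (fun _ _ h => h) hinit).seq (main M 0 (by omega))
  exact this.mono (fun _ _ h => h) (fun _ _ h => h) (by omega)

/-- Counting loop with register `l` over `0, 1, …, hi - 1`. -/
def forLoop (l : ℕ) (hi : WExp) (body : Prog) : Prog :=
  BlockFFT.whileR l (.lit 0) (.lt (rg l) hi) (.add (rg l) (.lit 1)) body

/-- The rule for counting loops: an invariant `I` on the complex memory, indexed by the number of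
passes, suffices. -/
lemma Spec.forLoop {hi : WExp} {body : Prog} (M : ℕ) (I : ℕ → (ℕ → ℂ) → Prop)
    (hT : M * (T + 2) + 2 ≤ T')
    (hw : hi.wt + 3 * l + 100 ≤ wtBound) (hM : M ≤ E.U)
    (hpre : ∀ c, Φ c → I 0 c) (hpost : ∀ c, I M c → Ψ c)
    (hhi : ∀ reg cpx, (∀ r < l, reg r = P r) → hi.val (memOf E.ini reg cpx) = M)
    (hbody : ∀ m < M, Spec E (At (l + 1) (Function.update P l m) (I m)) body T
      (At (l + 1) (Function.update P l m) (I (m + 1)))) :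
    Spec E (At l P Φ) (forLoop l hi body) T' (At l P Ψ) := by
  have hwr : (rg l).wt = l + 15 := by simp only [rg, regAddr, WExp.wt]; omega
  refine ((Spec.whileR (E := E) (fun m => m) M I ?_ ?_ ?_ ?_ ?_ ?_ ?_ hbody).forget
    (Nat.le_succ l) (fun r hr => Function.update_of_ne (by omega) _ _)).mono
      (fun _ _ h => ⟨h.1, hpre _ h.2⟩) (fun _ _ h => ⟨h.1, hpost _ h.2⟩) hT
  · simp only [WExp.wt]; omega
  · simp only [WExp.wt]; omega
  · simp only [Test.wt]; omega
  · intro _ _ _; rfl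
  · intro m hm; exact hm.trans hM
  · intro m hm reg cpx h
    obtain ⟨h1, h2, h3⟩ := at_succ_iff.1 h
    simp [Test.Holds, h2, hhi reg cpx h1]
  · intro m hm reg cpx h
    obtain ⟨h1, h2, h3⟩ := at_succ_iff.1 h
    simp [WExp.val, h2]

/-- Loop with register `l` over the powers of two below `hi`. -/
def dblLoop (l : ℕ) (hi : WExp) (body : Prog) : Prog :=
  BlockFFT.whileR l (.lit 1) (.lt (rg l) hi) (.add (rg l) (rg l)) body

/-- The rule for loops over powers of two, with the invariant indexed by the exponent. -/
lemma Spec.dblLoop {hi : WExp} {body : Prog} (M : ℕ) (I : ℕ → (ℕ → ℂ) → Prop)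
    (hT : M * (T + 2) + 2 ≤ T')
    (hw : hi.wt + 3 * l + 100 ≤ wtBound) (hM : 2 ^ M ≤ E.U)
    (hpre : ∀ c, Φ c → I 0 c) (hpost : ∀ c, I M c → Ψ c)
    (hhi : ∀ reg cpx, (∀ r < l, reg r = P r) → hi.val (memOf E.ini reg cpx) = 2 ^ M)
    (hbody : ∀ m < M, Spec E (At (l + 1) (Function.update P l (2 ^ m)) (I m)) body T
      (At (l + 1) (Function.update P l (2 ^ m)) (I (m + 1)))) :
    Spec E (At l P Φ) (dblLoop l hi body) T' (At l P Ψ) := by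
  have hwr : (rg l).wt = l + 15 := by simp only [rg, regAddr, WExp.wt]; omega
  refine ((Spec.whileR (E := E) (fun m => 2 ^ m) M I ?_ ?_ ?_ ?_ ?_ ?_ ?_ hbody).forget
    (Nat.le_succ l) (fun r hr => Function.update_of_ne (by omega) _ _)).mono
      (fun _ _ h => ⟨h.1, hpre _ h.2⟩) (fun _ _ h => ⟨h.1, hpost _ h.2⟩) hT
  · simp only [WExp.wt]; omega
  · simp only [WExp.wt]; omega
  · simp only [Test.wt]; omega
  · intro _ _ _; rfl
  · intro m hm; exact (Nat.pow_le_pow_right (by omega) hm).trans hM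
  · intro m hm reg cpx h
    obtain ⟨h1, h2, h3⟩ := at_succ_iff.1 h
    simp only [Test.Holds, rg_val, h2, hhi reg cpx h1]
    exact Nat.pow_lt_pow_iff_right (by omega)
  · intro m hm reg cpx h
    obtain ⟨h1, h2, h3⟩ := at_succ_iff.1 h
    simp [WExp.val, h2, pow_succ]; ring

end rules

/-! ### Roots of unity -/

lemma rootPow_zero (m : ℕ) : rootPow m 0 = 1 := by simp [rootPow]

lemma rootPow_add (m : ℕ) (x y : ℤ) : rootPow m (x + y) = rootPow m x * rootPow m y := by
  rw [rootPow, rootPow, rootPow, ← Complex.exp_add]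
  congr 1; push_cast; ring

lemma rootPow_self_mul (m : ℕ) (x : ℤ) : rootPow m (m * x) = 1 := by
  rcases Nat.eq_zero_or_pos m with rfl | hm
  · simp [rootPow]
  have hm' : (m : ℂ) ≠ 0 := by exact_mod_cast hm.ne'
  rw [rootPow, show 2 * (Real.pi : ℂ) * Complex.I * ((m * x : ℤ) : ℂ) / m
    = x * (2 * Real.pi * Complex.I) by push_cast; field_simp]
  exact Complex.exp_int_mul_two_pi_mul_I x

lemma rootPow_congr {m : ℕ} {x y : ℤ} (h : x ≡ y [ZMOD m]) : rootPow m x = rootPow m y := by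
  obtain ⟨k, hk⟩ := h.dvd
  rw [show y = x + m * k by omega, rootPow_add, rootPow_self_mul, mul_one]

lemma rootPow_mul_mul {k : ℕ} (hk : k ≠ 0) (m : ℕ) (x : ℤ) :
    rootPow (k * m) (k * x) = rootPow m x := by
  have hk' : (k : ℂ) ≠ 0 := by exact_mod_cast hk
  rw [rootPow, rootPow]
  congr 1
  push_cast
  rw [show 2 * (Real.pi : ℂ) * Complex.I * (k * x) = k * (2 * Real.pi * Complex.I * x) by ring,
    mul_div_mul_left _ _ hk']

/-! ### The fast Fourier transform -/

/-- The state of the transform of length `2 ^ L` after `s` passes.  With `S = 2 ^ s` and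
`D = 2 ^ (L - s)`, entry `r D + b` (`r < S`, `b < D`) is the `r`-th coefficient of the
transform of length `S` of the subsequence `v b, v (b + D), v (b + 2 D), …`. -/
def fftStage (L : ℕ) (v : ℕ → ℂ) (s e : ℕ) : ℂ :=
  ∑ l ∈ Finset.range (2 ^ s), v (e % 2 ^ (L - s) + 2 ^ (L - s) * l) *
    rootPow (2 ^ s) ((e / 2 ^ (L - s) : ℕ) * l)

lemma fftStage_zero (L : ℕ) (v : ℕ → ℂ) {e : ℕ} (he : e < 2 ^ L) : fftStage L v 0 e = v e := by
  simp [fftStage, Nat.mod_eq_of_lt he, rootPow_zero]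

lemma fftStage_last (L : ℕ) (v : ℕ → ℂ) (e : ℕ) :
    fftStage L v L e = ∑ b ∈ Finset.range (2 ^ L), v b * rootPow (2 ^ L) (e * b) := by
  simp [fftStage, Nat.mod_one]

lemma sum_range_two_mul (f : ℕ → ℂ) (S : ℕ) :
    ∑ l ∈ Finset.range (2 * S), f l =
      ∑ l ∈ Finset.range S, f (2 * l) + ∑ l ∈ Finset.range S, f (2 * l + 1) := by
  induction S with
  | zero => simp
  | succ S ih =>
    rw [show 2 * (S + 1) = 2 * S + 1 + 1 by ring, Finset.sum_range_succ, Finset.sum_range_succ, ih,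
      Finset.sum_range_succ, Finset.sum_range_succ]
    ring

/-- The butterfly step: a transform of length `2 S` is combined from the transforms of length `S` of
the even and of the odd part of the sequence. -/
lemma fftStage_succ {L : ℕ} (v : ℕ → ℂ) {s : ℕ} (hs : s < L) (e : ℕ) :
    fftStage L v (s + 1) e =
      fftStage L v s (e / 2 ^ (L - (s + 1)) % 2 ^ s * 2 ^ (L - s) + e % 2 ^ (L - (s + 1))) +
      rootPow (2 * 2 ^ s) (e / 2 ^ (L - (s + 1)) : ℕ) *
        fftStage L v s (e / 2 ^ (L - (s + 1)) % 2 ^ s * 2 ^ (L - s) +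
          e % 2 ^ (L - (s + 1)) + 2 ^ (L - (s + 1))) := by
  have hD : 2 ^ (L - s) = 2 * 2 ^ (L - (s + 1)) := by
    rw [← pow_succ']; congr 1; omega
  set D := 2 ^ (L - (s + 1)) with hDdef
  have hD0 : 0 < D := by positivity
  simp only [fftStage]
  rw [← hDdef, hD]
  have hbD : e % D < D := Nat.mod_lt _ hD0
  generalize e / D = r at hbD ⊢
  generalize e % D = b at hbD ⊢
  have hmod : (r % 2 ^ s * (2 * D) + b) % (2 * D) = b := by
    rw [mul_comm, Nat.mul_add_mod, Nat.mod_eq_of_lt (by omega)]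
  have hdiv : (r % 2 ^ s * (2 * D) + b) / (2 * D) = r % 2 ^ s := by
    rw [mul_comm, Nat.mul_add_div (by omega), Nat.div_eq_of_lt (by omega), add_zero]
  have hmod' : (r % 2 ^ s * (2 * D) + b + D) % (2 * D) = b + D := by
    rw [add_assoc, mul_comm, Nat.mul_add_mod, Nat.mod_eq_of_lt (by omega)]
  have hdiv' : (r % 2 ^ s * (2 * D) + b + D) / (2 * D) = r % 2 ^ s := by
    rw [add_assoc, mul_comm, Nat.mul_add_div (by omega), Nat.div_eq_of_lt (by omega), add_zero]
  have hper : ∀ l : ℕ, rootPow (2 ^ s) ((r : ℤ) * l) =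
      rootPow (2 ^ s) (((r % 2 ^ s : ℕ) : ℤ) * l) := by
    intro l
    apply rootPow_congr
    apply Int.ModEq.mul_right
    rw [Int.natCast_mod]
    exact (Int.mod_modEq _ _).symm
  have htwo : ∀ x : ℤ, rootPow (2 * 2 ^ s) (2 * x) = rootPow (2 ^ s) x := fun x => by
    simpa using rootPow_mul_mul (k := 2) (by norm_num) (2 ^ s) x
  rw [hmod, hdiv, hmod', hdiv', pow_succ', sum_range_two_mul, Finset.mul_sum]
  congr 1
  · refine Finset.sum_congr rfl fun l _ => ?_
    rw [← hper l, ← htwo]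
    congr 2
    · congr 1; ring
    · push_cast; ring
  · refine Finset.sum_congr rfl fun l _ => ?_
    rw [← hper l, ← htwo, mul_left_comm, ← rootPow_add,
      show b + D * (2 * l + 1) = b + D + 2 * D * l by ring,
      show (r : ℤ) * ((2 * l + 1 : ℕ) : ℤ) = r + 2 * (r * l) by push_cast; ring]

/-- `exp (2 π i x / m)` as an expression. -/
def rootE (m x : WExp) : CExp :=
  .exp (.div (.mul (.mul (.mul (.ofWord (.lit 2)) .pi) .I) (.ofWord x)) (.ofWord m))

@[simp] lemma rootE_val (s : Mem) (m x : WExp) :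
    (rootE m x).val s = rootPow (m.val s) (x.val s) := by
  simp [rootE, CExp.val, WExp.val, rootPow]

lemma rootE_wt (m x : WExp) : (rootE m x).wt = m.wt + x.wt + 13 := by
  simp only [rootE, CExp.wt, WExp.wt]; omega

/-- The fast Fourier transform of length `M`, with registers from `l` on.  Its input is at address
`fb + M`, and after the pass that produces transforms of length `S` the data are at address
`fb + S M`. -/
def fftProg (l : ℕ) (M fb : WExp) : Prog :=
  let S := rg l
  let e := rg (l + 1)
  let D := .div M S
  let D' := .div D (.lit 2)
  let src := .add (.add fb (.mul S M)) (.add (.mul (.mod (.div e D') S) D) (.mod e D'))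
  dblLoop l M (forLoop (l + 1) M
    (.setC (.add (.add fb (.mul (.mul (.lit 2) S) M)) e)
      (.add (.get src) (.mul (rootE (.mul (.lit 2) S) (.div e D')) (.get (.add src D'))))))

/-- The number of steps of the transform of length `2 ^ L`. -/
def fftTime (L : ℕ) : ℕ := L * (2 ^ L * 3 + 4) + 2

/-- The memory below the buffers is untouched, and the result is in the last buffer, `M` buffers of
length `M` after the address `fb`. -/
lemma fftProg_spec {E : Env} {l : ℕ} {P : ℕ → ℕ} {Me fbe : WExp} {L fb : ℕ}
    (hl : l ≤ 100) (hMw : Me.wt ≤ 500) (hfw : fbe.wt ≤ 500) (hU : 2 ^ L ≤ E.U)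
    (hM : ∀ reg cpx, (∀ r < l, reg r = P r) → Me.val (memOf E.ini reg cpx) = 2 ^ L)
    (hfb : ∀ reg cpx, (∀ r < l, reg r = P r) → fbe.val (memOf E.ini reg cpx) = fb)
    (c₀ : ℕ → ℂ) (v : ℕ → ℂ) :
    Spec E (At l P (fun c => (∀ a < fb, c a = c₀ a) ∧ ∀ b < 2 ^ L, c (fb + 2 ^ L + b) = v b))
      (fftProg l Me fbe) (fftTime L)
      (At l P (fun c => (∀ a < fb, c a = c₀ a) ∧ ∀ r < 2 ^ L, c (fb + 2 ^ L * 2 ^ L + r) =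
        ∑ b ∈ Finset.range (2 ^ L), v b * rootPow (2 ^ L) (r * b))) := by
  have hrw : ∀ i, (rg i).wt = i + 15 := fun i => by simp only [rg, regAddr, WExp.wt]; omega
  refine Spec.dblLoop (T := 2 ^ L * 3 + 2) L (fun s c => (∀ a < fb, c a = c₀ a) ∧
      ∀ e < 2 ^ L, c (fb + 2 ^ s * 2 ^ L + e) = fftStage L v s e)
    (by rw [fftTime]) (by rw [wtBound]; omega) hU ?_ ?_ hM (fun s hs => ?_)
  · rintro c ⟨h1, h2⟩
    refine ⟨h1, fun e he => ?_⟩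
    rw [fftStage_zero _ _ he, ← h2 e he, pow_zero, one_mul]
  · rintro c ⟨h1, h2⟩
    refine ⟨h1, fun r hr => ?_⟩
    rw [h2 r hr, fftStage_last]
  · refine Spec.forLoop (T := 1) (2 ^ L) (fun i c => ((∀ a < fb, c a = c₀ a) ∧
        ∀ e < 2 ^ L, c (fb + 2 ^ s * 2 ^ L + e) = fftStage L v s e) ∧
        ∀ e < i, c (fb + 2 ^ (s + 1) * 2 ^ L + e) = fftStage L v (s + 1) e)
      le_rfl (by rw [wtBound]; omega) hU (fun c h => ⟨h, fun e he => by omega⟩)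
      (fun c h => ⟨h.1.1, h.2⟩) ?_ (fun i hi => Spec.setC_at ?_ ?_)
    · intro reg cpx h
      exact hM reg cpx fun r hr => by
        rw [h r (by omega), Function.update_of_ne (by omega)]
    · simp only [WExp.wt, CExp.wt, rootE_wt, hrw, wtBound]; omega
    · intro reg cpx h
      obtain ⟨h1, h2, ⟨h3, h4⟩, h5⟩ := at_succ_iff.1 h
      have hS : reg l = 2 ^ s := by simpa using h1 l (by omega)
      have h1' : ∀ r < l, reg r = P r := fun r hr => by
        rw [h1 r (by omega), Function.update_of_ne (by omega)]
      have hD : 2 ^ L / 2 ^ s = 2 ^ (L - s) := Nat.pow_div hs.le (by norm_num)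
      have hD' : 2 ^ (L - s) / 2 = 2 ^ (L - (s + 1)) := by
        rw [show L - s = L - (s + 1) + 1 by omega, pow_succ, Nat.mul_div_cancel _ (by norm_num)]
      have hD2 : 2 ^ (L - s) = 2 * 2 ^ (L - (s + 1)) := by
        rw [← pow_succ']; congr 1; omega
      simp only [WExp.val, CExp.val, rootE_val, rg_val, hM _ _ h1', hfb _ _ h1', h2, hS, hD, hD',
        memOf_cpx]
      have hlt : i / 2 ^ (L - (s + 1)) % 2 ^ s * 2 ^ (L - s) + i % 2 ^ (L - (s + 1))
          + 2 ^ (L - (s + 1)) < 2 ^ L := by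
        have e1 : i / 2 ^ (L - (s + 1)) % 2 ^ s + 1 ≤ 2 ^ s := Nat.mod_lt _ (by positivity)
        have e2 : i % 2 ^ (L - (s + 1)) < 2 ^ (L - (s + 1)) := Nat.mod_lt _ (by positivity)
        have e3 : 2 ^ L = 2 ^ s * 2 ^ (L - s) := by rw [← pow_add]; congr 1; omega
        have e4 := Nat.mul_le_mul_right (2 ^ (L - s)) e1
        rw [e3]
        rw [add_mul] at e4
        omega
      have hpos : 0 < 2 ^ (L - (s + 1)) := by positivity
      have hone : 1 ≤ 2 ^ s := Nat.one_le_two_pow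
      have hML : 2 ^ L ≤ 2 ^ s * 2 ^ L := Nat.le_mul_of_pos_left _ (by positivity)
      have hne : ∀ e < 2 ^ L, ∀ i, fb + 2 ^ s * 2 ^ L + e ≠ fb + 2 * 2 ^ s * 2 ^ L + i := by
        intro e he i; rw [mul_assoc]; omega
      refine ⟨⟨fun a ha => ?_, fun e he => ?_⟩, fun e he => ?_⟩
      · rw [Function.update_of_ne (by omega)]; exact h3 a ha
      · rw [Function.update_of_ne (hne e he i)]; exact h4 e he
      · rw [pow_succ']
        by_cases hei : e = i
        · subst hei
          rw [Function.update_self, add_assoc (fb + _), h4 _ hlt, h4 _ (by omega),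
            fftStage_succ v hs e]
        · rw [Function.update_of_ne (by omega), ← pow_succ']
          exact h5 e (by omega)

/-! ### The filter as a closed expression -/

/-- The value at the residue `x < N` of the spectrum of the filter of length `N` and width `w` with
logarithmic accuracy `lam`: the Dirichlet kernel of the box `|v| ≤ 3 w / 4`, times a Gaussian that
is cut off at `F = 32 (N / w) lam`, divided by `N`.  If the cut-off would exceed `N / 2`, the
Gaussian factor is dropped.  Indicator functions are written with truncated subtraction, and
`d = min x (N - x)`. -/
def filtVal (N w lam x : ℕ) : ℂ :=
  let d := x - (x - (N - x))
  let F := 32 * (N / w) * lam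
  let B := 3 * w / 4
  ((1 - (d - F) : ℕ) : ℂ) *
    ((((1 - x) * (2 * B + 1) : ℕ) : ℂ) + (rootPow N ((x * (2 * B + 1) : ℕ) : ℤ) - 1) /
      ((rootPow N (x : ℤ) - 1) * rootPow N ((x * B : ℕ) : ℤ))) /
    ((N : ℂ) * Complex.exp ((Real.pi : ℂ) * (((1 - (1 - (N - 2 * F))) * d * d : ℕ) : ℂ) /
      ((32 * (N / w) * (N / w) * lam : ℕ) : ℂ)))

/-- The expression whose value is `filtVal`.  It has constant size, so that the programs evaluate
the filters point by point and need no table of their values. -/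
def filtE (N w lam x : WExp) : CExp :=
  let d : WExp := .sub x (.sub x (.sub N x))
  let F : WExp := .mul (.mul (.lit 32) (.div N w)) lam
  let B : WExp := .div (.mul (.lit 3) w) (.lit 4)
  let B' : WExp := .add (.mul (.lit 2) B) (.lit 1)
  .div
    (.mul (.ofWord (.sub (.lit 1) (.sub d F)))
      (.add (.ofWord (.mul (.sub (.lit 1) x) B'))
        (.div (.sub (rootE N (.mul x B')) (.ofWord (.lit 1)))
          (.mul (.sub (rootE N x) (.ofWord (.lit 1))) (rootE N (.mul x B))))))
    (.mul (.ofWord N) (.exp (.div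
      (.mul .pi (.ofWord (.mul (.mul
        (.sub (.lit 1) (.sub (.lit 1) (.sub N (.mul (.lit 2) F)))) d) d)))
      (.ofWord (.mul (.mul (.mul (.lit 32) (.div N w)) (.div N w)) lam)))))

@[simp] lemma filtE_val (s : Mem) (N w lam x : WExp) :
    (filtE N w lam x).val s = filtVal (N.val s) (w.val s) (lam.val s) (x.val s) := by
  simp only [filtE, CExp.val, WExp.val, rootE_val, filtVal, Nat.cast_one]

/-! ### The common part of the two programs -/

/-- The data of a run of the common part: the inputs, the parameters of the two filters, and the
permutation `j ↦ σ j + Δ`.  If `flag = 1` the lift of the time index to a residue modulo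
`2 n / k₁` is used in any case, otherwise only if it has a representative in
`(-n / (2 k₁), n / (2 k₁)]`. -/
structure Inst where
  (n k₀ k₁ : ℕ)
  /-- The number of active blocks. -/
  len : ℕ
  (σ Δ flag : ℕ)
  /-- The number of lifts of the time index that are processed. -/
  npass : ℕ
  /-- The least power of two that is at least `k₀`. -/
  k : ℕ
  /-- The logarithmic accuracy of the filter of the first level. -/
  lam₁ : ℕ
  /-- The logarithmic accuracy of the filter of the second level. -/
  lam₂ : ℕ
  /-- The list of the active blocks. -/
  blk : ℕ → ℕ
  /-- The spectrum. -/
  X : ℕ → ℂ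

namespace Inst
variable (I : Inst)

/-- The length of the reduced spectra. -/
def N : ℕ := 2 * I.n / I.k₁
/-- The spacing of the frequencies of the second level. -/
def D : ℕ := I.N / (2 * I.k)
/-- Half the window of frequencies that a block influences on the first level.  The filter is
supported on `|ξ| ≤ 32 k₁ lam₁`, which is `64 lam₁` times the spacing `k₁ / 2` of the frequencies;
the summand `2` takes care of the extent of the block. -/
def H₁ : ℕ := 64 * I.lam₁ + 2
/-- Half the window of frequencies that a frequency influences on the second level.  The filter is
supported on `32 (N / k) lam₂`, which is `64 lam₂` times the spacing `D`; the summand `2` takes care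
of rounding. -/
def H₂ : ℕ := 64 * I.lam₂ + 2
/-- The length of the first window, `min (2 H₁ + 1) N`. -/
def len₁ : ℕ := (2 * I.H₁ + 1) - ((2 * I.H₁ + 1) - I.N)
/-- The length of the second window, `min (2 H₂ + 1) (2 k)`. -/
def len₂ : ℕ := (2 * I.H₂ + 1) - ((2 * I.H₂ + 1) - 2 * I.k)
/-- The number of columns of the output. -/
def q : ℕ := 2 * (I.k₀ / 2) + 1
/-- The address of the table of second level spectra.  It is preceded by `c`, by the `n` entries of
the input, and by the output, which has `2 k₁` rows of length `q`. -/
def zb : ℕ := I.n + 1 + 2 * I.k₁ * I.q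
/-- The address of the buffers of the transforms. -/
def fb : ℕ := I.zb + 4 * I.k₁ * I.k
/-- The `t`-th frequency in the window around the block `J`.  The block is centered at `J k₁`, which
is `2 J` times the spacing `k₁ / 2`; the summand `H₁ (N - 1)` is `-H₁` modulo `N`. -/
def freq (J t : ℕ) : ℕ := (2 * J + t + I.H₁ * (I.N - 1)) % I.N
/-- The permuted frequency. -/
def perm (f : ℕ) : ℕ := I.σ * f % I.N
/-- The `t`-th index in the second level window around the frequency `g`. -/
def idx (g t : ℕ) : ℕ := (g / I.D + t + I.H₂ * (2 * I.k - 1)) % (2 * I.k)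
/-- The position relative to the block `J` of its frequency that is congruent to `b` modulo `2 k₁`;
the position is at least `k₁` if there is none. -/
def pos (J b : ℕ) : ℕ :=
  (b + (2 * I.k₁ - (J * I.k₁ + I.n - I.k₁ / 2 + 1) % (2 * I.k₁))) % (2 * I.k₁)
/-- The frequency at the position `pos`. -/
def xi (J b : ℕ) : ℕ := (J * I.k₁ + I.n - I.k₁ / 2 + 1 + I.pos J b) % I.n
/-- The contribution of the block `J` to the aliased vector.  The factor
`1 - (pos + 1 - k₁)` vanishes unless `pos < k₁`. -/
def ali (J f b : ℕ) : ℂ :=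
  ((I.k₁ / 2 * (1 - (I.pos J b + 1 - I.k₁)) : ℕ) : ℂ) * I.X (I.xi J b) *
    filtVal I.n (I.n / I.k₁) I.lam₁ ((I.k₁ / 2 * f + I.n - I.xi J b) % I.n)
/-- The contribution of the block `J` to the `r`-th reduced spectrum. -/
def red (J f r : ℕ) : ℂ :=
  ∑ b ∈ Finset.range (2 * I.k₁), I.ali J f b * rootPow (2 * I.k₁) (r * b)
/-- The contribution of the block `J` to the `i`-th entry of the `r`-th second level spectrum. -/
def term (Δ' J f r i : ℕ) : ℂ :=
  (I.D : ℂ) * (I.red J f r * rootPow I.N ((f * Δ' : ℕ) : ℤ)) *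
    filtVal I.N I.k I.lam₂ ((I.D * i + I.N - I.perm f) % I.N)
/-- All contributions of the frequency `f` and the block `J`, as a modification of the memory. -/
def freqCon (Δ' J f : ℕ) : ℕ → ℂ :=
  ∑ r ∈ Finset.range (2 * I.k₁), ∑ t ∈ Finset.range I.len₂,
    Pi.single (I.zb + r * (2 * I.k) + I.idx (I.perm f) t)
      (I.term Δ' J f r (I.idx (I.perm f) t))
/-- The table of the second level spectra, as a modification of the memory. -/
def tableCon (Δ' : ℕ) : ℕ → ℂ :=
  ∑ J ∈ Finset.range I.len, ∑ t ∈ Finset.range I.len₁,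
    I.freqCon Δ' (I.blk J) (I.freq (I.blk J) t)
/-- The indicator function of the time indices for which the current lift is used.  With
`h = n / k₁` and `N = 2 h`, a residue `u` modulo `N` has a representative in `(-h / 2, h / 2]` if
and only if `(u + h / 2 - 1) % N < h`; the expression `1 - (1 - y)` is the indicator function of
`0 < y`. -/
def sel (Δ' jj : ℕ) : ℕ :=
  1 - (1 - (I.flag + (1 - (1 - (I.n / I.k₁ -
    (I.σ * (jj + I.N - I.k₀ / 2) + Δ' + (I.n / I.k₁ / 2 - 1)) % I.N)))))
/-- The entry of the output computed with the lift `Δ'`. -/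
def outVal (Δ' r jj : ℕ) : ℂ :=
  ∑ b ∈ Finset.range (2 * I.k), I.tableCon Δ' (I.zb + r * (2 * I.k) + b) *
    rootPow (2 * I.k) (((jj + 2 * I.k - I.k₀ / 2) % (2 * I.k) : ℕ) * b)
/-- The `r`-th row of the output, as a modification of the memory. -/
def rowCon (Δ' r : ℕ) : ℕ → ℂ :=
  ∑ jj ∈ Finset.range I.q,
    Pi.single (I.n + 1 + r * I.q + jj) ((I.sel Δ' jj : ℂ) * I.outVal Δ' r jj)
/-- The output computed with the lift `Δ'`, as a modification of the memory. -/
def passCon (Δ' : ℕ) : ℕ → ℂ := ∑ r ∈ Finset.range (2 * I.k₁), I.rowCon Δ' r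

end Inst

/-- The number `n`, which is found in the first word. -/
def nE : WExp := .get (.lit 0)

/-- The expression for `2 k₁`. -/
def twoK₁E : WExp := .mul (.lit 2) (rg 1)
/-- The expression for `2 k`. -/
def twoKE : WExp := .mul (.lit 2) (rg 13)
/-- The expression for `Inst.D`. -/
def DE : WExp := .div (rg 17) twoKE
/-- The expression for the first address of a block. -/
def blockE : WExp := .add (.sub (.add (.mul (rg 33) (rg 1)) nE) (.div (rg 1) (.lit 2))) (.lit 1)
/-- The expression for `Inst.pos`. -/
def posE : WExp := .mod (.add (rg 37) (.sub twoK₁E (.mod blockE twoK₁E))) twoK₁E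
/-- The expression for `Inst.xi`. -/
def xiE : WExp := .mod (.add blockE posE) nE
/-- The expression for `Inst.ali`. -/
def aliE : CExp :=
  .mul (.mul (.ofWord (.mul (.div (rg 1) (.lit 2))
      (.sub (.lit 1) (.sub (.add posE (.lit 1)) (rg 1)))))
    (.get (.add (.lit 1) xiE)))
    (filtE nE (.div nE (rg 1)) (rg 15)
      (.mod (.sub (.add (.mul (.div (rg 1) (.lit 2)) (rg 35)) nE) xiE) nE))
/-- The expression for `Inst.idx`. -/
def idxE : WExp :=
  .mod (.add (.add (.div (rg 36) DE) (rg 38)) (.mul (rg 23) (.sub twoKE (.lit 1)))) twoKE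
/-- The address at which a contribution is accumulated. -/
def cellE : WExp := .add (.add (rg 20) (.mul (rg 37) twoKE)) idxE
/-- The expression for `Inst.term`. -/
def termE : CExp :=
  .mul (.mul (.ofWord DE)
    (.mul (.get (.add (.add (rg 21) (.mul twoK₁E twoK₁E)) (rg 37)))
      (rootE (rg 17) (.mul (rg 35) (rg 31)))))
    (filtE (rg 17) (rg 13) (rg 16) (.mod (.sub (.add (.mul DE idxE) (rg 17)) (rg 36)) (rg 17)))
/-- The expression for `Inst.sel`. -/
def selE : WExp :=
  .sub (.lit 1) (.sub (.lit 1) (.add (rg 6) (.sub (.lit 1) (.sub (.lit 1)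
    (.sub (.div nE (rg 1))
      (.mod (.add (.add (.mul (rg 4) (.sub (.add (rg 33) (rg 17)) (.div (rg 0) (.lit 2))))
        (rg 31)) (.sub (.div (.div nE (rg 1)) (.lit 2)) (.lit 1))) (rg 17)))))))
/-- The address of an entry of the output. -/
def outE : WExp := .add (.add (.add nE (.lit 1)) (.mul (rg 32) (rg 22))) (rg 33)

/-- Adds a value to a cell of the complex memory. -/
def addC (a : WExp) (e : CExp) : Prog := .setC a (.add (.get a) e)

/-- Accumulates the contribution of the frequency in register `35` of the block in
register `33`. -/
def freqProg : Prog :=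
  .seq (forLoop 37 twoK₁E (.setC (.add (.add (rg 21) twoK₁E) (rg 37)) aliE))
    (.seq (fftProg 37 twoK₁E (rg 21))
      (forLoop 37 twoK₁E (forLoop 38 (rg 24) (addC cellE termE))))

/-- Fills the table of second level spectra. -/
def tableProg : Prog :=
  forLoop 32 (rg 2) (.seq (setR 33 (.get (.add (rg 3) (rg 32))))
    (forLoop 34 (rg 19)
      (.seq (setR 35 (.mod (.add (.add (.mul (.lit 2) (rg 33)) (rg 34))
          (.mul (rg 18) (.sub (rg 17) (.lit 1)))) (rg 17)))
        (.seq (setR 36 (.mod (.mul (rg 4) (rg 35)) (rg 17))) freqProg))))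

/-- Clears the table of second level spectra. -/
def clearProg : Prog :=
  forLoop 32 (.mul (.mul (.lit 4) (rg 1)) (rg 13)) (.setC (.add (rg 20) (rg 32)) (.ofWord (.lit 0)))

/-- Transforms the rows of the table and adds the results to the output. -/
def rowProg : Prog :=
  .seq (forLoop 33 twoKE (.setC (.add (.add (rg 21) twoKE) (rg 33))
      (.get (.add (.add (rg 20) (.mul (rg 32) twoKE)) (rg 33)))))
    (.seq (fftProg 33 twoKE (rg 21))
      (forLoop 33 (rg 22) (addC outE (.mul (.ofWord selE)
        (.get (.add (.add (rg 21) (.mul twoKE twoKE))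
          (.mod (.sub (.add (rg 33) twoKE) (.div (rg 0) (.lit 2))) twoKE)))))))

/-- The common part, for all lifts of the time index.  The registers below `25` hold the parameters
(see `Holds`), `30` the number of the lift and `31` its value.  While the table is filled, `33` is
the block, `35` the frequency, `36` the permuted frequency and `37` the row; afterwards `32` is the
row and `33` the column of the output. -/
def passProg : Prog :=
  forLoop 30 (rg 7) (.seq (setR 31 (.add (rg 5) (.mul (rg 30) (.div nE (rg 1)))))
    (.seq clearProg (.seq tableProg (forLoop 32 twoK₁E rowProg))))

/-! ### Correctness and running time of the common part -/

/-- The complex memory agrees with `c₀` below `B`, and has the further property `R`. -/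
def Ref (B : ℕ) (R : (ℕ → ℂ) → Prop) (c₀ : ℕ → ℂ) : (ℕ → ℂ) → Prop :=
  fun c => (∀ a < B, c a = c₀ a) ∧ R c

section
variable {E : Env} {l T T' B : ℕ} {P : ℕ → ℕ} {R : (ℕ → ℂ) → Prop}

/-- Accumulation into a cell is addition of a `Pi.single` to the relevant part of the memory. -/
lemma Spec.addC {a : WExp} {e : CExp} {c₀ : ℕ → ℂ} {a₀ : ℕ} {v : ℂ}
    (hw : 2 * a.wt + e.wt + 3 ≤ wtBound)
    (hR : ∀ c a v, a < B → R c → R (Function.update c a v)) (ha₀ : a₀ < B)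
    (ha : ∀ reg cpx, At l P (Ref B R c₀) reg cpx → a.val (memOf E.ini reg cpx) = a₀)
    (he : ∀ reg cpx, At l P (Ref B R c₀) reg cpx → e.val (memOf E.ini reg cpx) = v) :
    Spec E (At l P (Ref B R c₀)) (BlockFFT.addC a e) 1
      (At l P (Ref B R (c₀ + Pi.single a₀ v))) := by
  refine Spec.setC_at (by simp only [CExp.wt]; omega) fun reg cpx h => ⟨fun x hx => ?_, ?_⟩
  · simp only [CExp.val, ha reg cpx h, he reg cpx h, memOf_cpx, Pi.add_apply]
    by_cases hxa : x = a₀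
    · subst hxa; simp [h.2.1 x hx]
    · simp [hxa, h.2.1 x hx]
  · rw [ha reg cpx h]
    exact hR _ _ _ ha₀ h.2.2

/-- A loop each pass of which adds a function to the relevant part of the memory. -/
lemma Spec.sumLoop {hi : WExp} {body : Prog} {M : ℕ} (con : ℕ → ℕ → ℂ) (Ok : (ℕ → ℂ) → Prop)
    (hT : M * (T + 2) + 2 ≤ T') (hw : hi.wt + 3 * l + 100 ≤ wtBound) (hM : M ≤ E.U)
    (hhi : ∀ reg cpx, (∀ r < l, reg r = P r) → hi.val (memOf E.ini reg cpx) = M)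
    (hOk : ∀ m < M, ∀ c, Ok c → Ok (c + con m))
    (hbody : ∀ m < M, ∀ c, Ok c → Spec E (At (l + 1) (Function.update P l m) (Ref B R c)) body T
      (At (l + 1) (Function.update P l m) (Ref B R (c + con m)))) {c : ℕ → ℂ} (hc : Ok c) :
    Spec E (At l P (Ref B R c)) (BlockFFT.forLoop l hi body) T'
      (At l P (Ref B R (c + ∑ m ∈ Finset.range M, con m))) := by
  have hok : ∀ m ≤ M, Ok (c + ∑ i ∈ Finset.range m, con i) := by
    intro m
    induction m with
    | zero => intro _; simpa using hc
    | succ m ih =>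
      intro hm
      rw [Finset.sum_range_succ, ← add_assoc]
      exact hOk m (by omega) _ (ih (by omega))
  refine Spec.forLoop (T := T) M (fun m => Ref B R (c + ∑ i ∈ Finset.range m, con i)) hT hw hM
    (fun c h => by simpa using h) (fun c h => h) hhi fun m hm => ?_
  have := hbody m hm _ (hok m hm.le)
  rwa [add_assoc, ← Finset.sum_range_succ] at this

/-- A loop that fills a buffer above the relevant part of the memory. -/
lemma Spec.fillLoop {hi a : WExp} {e : CExp} {M : ℕ} {c₀ v : ℕ → ℂ} {B' : ℕ} (hB : B ≤ B')
    (hT : M * 3 + 2 ≤ T') (hw : hi.wt + 3 * l + 100 ≤ wtBound) (hM : M ≤ E.U)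
    (hwa : a.wt + e.wt + 1 ≤ wtBound)
    (hhi : ∀ reg cpx, (∀ r < l, reg r = P r) → hi.val (memOf E.ini reg cpx) = M)
    (ha : ∀ m < M, ∀ reg cpx, (∀ r < l, reg r = P r) → reg l = m →
      a.val (memOf E.ini reg cpx) = B' + m)
    (he : ∀ m < M, ∀ reg cpx, (∀ r < l, reg r = P r) → reg l = m → (∀ a < B, cpx a = c₀ a) →
      e.val (memOf E.ini reg cpx) = v m) :
    Spec E (At l P (fun c => ∀ a < B, c a = c₀ a)) (BlockFFT.forLoop l hi (.setC a e)) T'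
      (At l P (fun c => (∀ a < B, c a = c₀ a) ∧ ∀ m < M, c (B' + m) = v m)) := by
  refine Spec.forLoop (T := 1) M (fun i c => (∀ a < B, c a = c₀ a) ∧ ∀ m < i, c (B' + m) = v m)
    hT hw hM (fun c h => ⟨h, fun m hm => by omega⟩) (fun c h => h) hhi
    fun m hm => Spec.setC_at hwa fun reg cpx h => ?_
  obtain ⟨h1, h2, h3, h4⟩ := at_succ_iff.1 h
  rw [ha m hm reg cpx h1 h2, he m hm reg cpx h1 h2 h3]
  refine ⟨fun x hx => ?_, fun i hi => ?_⟩
  · rw [Function.update_of_ne (by omega)]; exact h3 x hx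
  · by_cases him : i = m
    · subst him; simp
    · rw [Function.update_of_ne (by omega)]; exact h4 i (by omega)

end

lemma sum_single_eq_zero {ι : Type*} (s : Finset ι) (f : ι → ℕ) (v : ι → ℂ) {x : ℕ}
    (h : ∀ i ∈ s, f i ≠ x) : (∑ i ∈ s, (Pi.single (f i) (v i) : ℕ → ℂ)) x = 0 := by
  rw [Finset.sum_apply]
  exact Finset.sum_eq_zero fun i hi => by simp [(h i hi).symm]

/-- The registers that hold the parameters of the common part; `lb` is the address of the list of
active blocks. -/
structure Holds (I : Inst) (lb : ℕ) (P : ℕ → ℕ) : Prop where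
  h0 : P 0 = I.k₀
  h1 : P 1 = I.k₁
  h2 : P 2 = I.len
  h3 : P 3 = lb
  h4 : P 4 = I.σ
  h5 : P 5 = I.Δ
  h6 : P 6 = I.flag
  h7 : P 7 = I.npass
  h13 : P 13 = I.k
  h15 : P 15 = I.lam₁
  h16 : P 16 = I.lam₂
  h17 : P 17 = I.N
  h18 : P 18 = I.H₁
  h19 : P 19 = I.len₁
  h20 : P 20 = I.zb
  h21 : P 21 = I.fb
  h22 : P 22 = I.q
  h23 : P 23 = I.H₂
  h24 : P 24 = I.len₂

/-- Writing a register from `30` on does not affect the parameters. -/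
lemma Holds.update {I : Inst} {lb : ℕ} {P : ℕ → ℕ} (h : Holds I lb P) {i : ℕ} (hi : 30 ≤ i)
    (v : ℕ) : Holds I lb (Function.update P i v) := by
  have hu : ∀ r < 30, Function.update P i v r = P r := fun r hr =>
    Function.update_of_ne (by omega) _ _
  constructor <;> rw [hu _ (by norm_num)]
  exacts [h.h0, h.h1, h.h2, h.h3, h.h4, h.h5, h.h6, h.h7, h.h13, h.h15, h.h16, h.h17, h.h18, h.h19,
    h.h20, h.h21, h.h22, h.h23, h.h24]

lemma Holds.of_agree {I : Inst} {lb : ℕ} {P reg : ℕ → ℕ} {l : ℕ} (h : Holds I lb P)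
    (hl : 25 ≤ l) (hr : ∀ r < l, reg r = P r) : Holds I lb reg := by
  have hu : ∀ r < 25, reg r = P r := fun r hr' => hr r (by omega)
  constructor <;> rw [hu _ (by norm_num)]
  exacts [h.h0, h.h1, h.h2, h.h3, h.h4, h.h5, h.h6, h.h7, h.h13, h.h15, h.h16, h.h17, h.h18, h.h19,
    h.h20, h.h21, h.h22, h.h23, h.h24]

/-- The conditions on the data of a run under which the common part is correct. -/
structure Inst.Good (I : Inst) (lb : ℕ) (E : Env) : Prop where
  ini0 : E.ini 0 = I.n
  list : ∀ j < I.len, E.ini (lb + j) = I.blk j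
  lb_le : lb + I.len ≤ I.n + 10
  n_pos : 0 < I.n
  N_pos : 0 < I.N
  k₁_pow : ∃ b, I.k₁ = 2 ^ b
  k_pow : ∃ e, I.k = 2 ^ e
  lenU : I.len ≤ E.U
  fbU : I.fb ≤ E.U
  nU : I.n ≤ E.U
  NU : I.N ≤ E.U
  npassU : I.npass ≤ E.U
  shiftU : ∀ m < I.npass, I.Δ + m * (I.n / I.k₁) ≤ E.U

namespace Inst.Good
variable {I : Inst} {lb : ℕ} {E : Env} (hI : I.Good lb E)
include hI

lemma k₁_pos : 0 < I.k₁ := by obtain ⟨b, hb⟩ := hI.k₁_pow; rw [hb]; positivity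
lemma k_pos : 0 < I.k := by obtain ⟨b, hb⟩ := hI.k_pow; rw [hb]; positivity

end Inst.Good

namespace Inst
variable (I : Inst)

/-- The number of steps for one pair of a block and a frequency, if `2 k₁ = 2 ^ b`. -/
def freqTime (b : ℕ) : ℕ :=
  (2 * I.k₁ * 3 + 2) + (fftTime b + (2 * I.k₁ * ((I.len₂ * 3 + 2) + 2) + 2))
/-- The number of steps to fill the table. -/
def tableTime (b : ℕ) : ℕ :=
  I.len * ((1 + (I.len₁ * ((1 + (1 + I.freqTime b)) + 2) + 2)) + 2) + 2
/-- The number of steps to transform one row, if `2 k = 2 ^ e`. -/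
def rowTime (e : ℕ) : ℕ := (2 * I.k * 3 + 2) + (fftTime e + (I.q * 3 + 2))
/-- The number of steps of the common part. -/
def passTime (b e : ℕ) : ℕ :=
  I.npass * ((1 + ((4 * I.k₁ * I.k * 3 + 2) + (I.tableTime b +
    (2 * I.k₁ * (I.rowTime e + 2) + 2)))) + 2) + 2

end Inst

section
variable {I : Inst} {lb : ℕ} {E : Env} {P : ℕ → ℕ}

lemma nE_val {reg : ℕ → ℕ} {cpx : ℕ → ℂ} (hI : I.Good lb E) :
    nE.val (memOf E.ini reg cpx) = I.n := by
  simp [nE, WExp.val, memOf, hI.ini0]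

lemma twoK₁E_val {reg : ℕ → ℕ} {cpx : ℕ → ℂ} (h : Holds I lb reg) :
    twoK₁E.val (memOf E.ini reg cpx) = 2 * I.k₁ := by
  simp [twoK₁E, WExp.val, h.h1]

lemma twoKE_val {reg : ℕ → ℕ} {cpx : ℕ → ℂ} (h : Holds I lb reg) :
    twoKE.val (memOf E.ini reg cpx) = 2 * I.k := by
  simp [twoKE, WExp.val, h.h13]

lemma DE_val {reg : ℕ → ℕ} {cpx : ℕ → ℂ} (h : Holds I lb reg) :
    DE.val (memOf E.ini reg cpx) = I.D := by
  simp [DE, WExp.val, h.h17, twoKE_val h, Inst.D]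

lemma idxE_val {reg : ℕ → ℕ} {cpx : ℕ → ℂ} (h : Holds I lb reg) {g t : ℕ}
    (hg : reg 36 = g) (ht : reg 38 = t) :
    idxE.val (memOf E.ini reg cpx) = I.idx g t := by
  simp [idxE, WExp.val, DE_val h, twoKE_val h, hg, ht, h.h23, Inst.idx]

lemma posE_val {reg : ℕ → ℕ} {cpx : ℕ → ℂ} (hI : I.Good lb E) (h : Holds I lb reg) {J b : ℕ}
    (hJ : reg 33 = J) (hb : reg 37 = b) :
    posE.val (memOf E.ini reg cpx) = I.pos J b := by
  simp [posE, WExp.val, twoK₁E_val h, blockE, nE_val hI, hJ, hb, h.h1, Inst.pos]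

lemma xiE_val {reg : ℕ → ℕ} {cpx : ℕ → ℂ} (hI : I.Good lb E) (h : Holds I lb reg) {J b : ℕ}
    (hJ : reg 33 = J) (hb : reg 37 = b) :
    xiE.val (memOf E.ini reg cpx) = I.xi J b := by
  simp [xiE, WExp.val, posE_val hI h hJ hb, blockE, nE_val hI, hJ, h.h1, Inst.xi]

lemma aliE_val {reg : ℕ → ℕ} {cpx : ℕ → ℂ} (hI : I.Good lb E) (h : Holds I lb reg) {J f b : ℕ}
    (hJ : reg 33 = J) (hf : reg 35 = f) (hb : reg 37 = b)
    (hX : ∀ x < I.n, cpx (1 + x) = I.X x) :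
    aliE.val (memOf E.ini reg cpx) = I.ali J f b := by
  have hxi : I.xi J b < I.n := Nat.mod_lt _ hI.n_pos
  simp only [aliE, CExp.val, WExp.val, filtE_val, posE_val hI h hJ hb, xiE_val hI h hJ hb,
    nE_val hI, rg_val, h.h1, h.h15, hf, memOf_cpx, hX _ hxi, Inst.ali]

lemma termE_val {reg : ℕ → ℕ} {cpx : ℕ → ℂ} (h : Holds I lb reg)
    {Δ' J f r t : ℕ} (hΔ : reg 31 = Δ') (hf : reg 35 = f) (hg : reg 36 = I.perm f)
    (hr : reg 37 = r) (ht : reg 38 = t)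
    (hV : cpx (I.fb + 2 * I.k₁ * (2 * I.k₁) + r) = I.red J f r) :
    termE.val (memOf E.ini reg cpx) = I.term Δ' J f r (I.idx (I.perm f) t) := by
  simp only [termE, CExp.val, WExp.val, filtE_val, rootE_val, idxE_val h hg ht, DE_val h,
    twoK₁E_val h, rg_val, h.h13, h.h16, h.h17, h.h21, hΔ, hf, hg, hr, memOf_cpx, hV, Inst.term]

lemma selE_val {reg : ℕ → ℕ} {cpx : ℕ → ℂ} (hI : I.Good lb E) (h : Holds I lb reg) {Δ' jj : ℕ}
    (hΔ : reg 31 = Δ') (hj : reg 33 = jj) :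
    selE.val (memOf E.ini reg cpx) = I.sel Δ' jj := by
  simp only [selE, WExp.val, nE_val hI, rg_val, h.h0, h.h1, h.h4, h.h6, h.h17, hΔ, hj, Inst.sel]

/-- One transform of length `2 k₁` yields the contributions of a block to all reduced spectra at the
frequency `f` simultaneously; they are then scattered to the second level. -/
lemma freqProg_spec (hI : I.Good lb E) (hP : Holds I lb P) {Δ' J f b : ℕ}
    (hb : 2 * I.k₁ = 2 ^ b) (hΔ : P 31 = Δ') (hJ : P 33 = J) (hf : P 35 = f)
    (hg : P 36 = I.perm f) {c : ℕ → ℂ} (hc : ∀ x < I.n, c (1 + x) = I.X x) :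
    Spec E (At 37 P (Ref I.fb (fun _ => True) c)) freqProg (I.freqTime b)
      (At 37 P (Ref I.fb (fun _ => True) (c + I.freqCon Δ' J f))) := by
  have hfbU := hI.fbU
  have hk₁ := hI.k₁_pos
  have hk := hI.k_pos
  have hn_fb : I.n < I.fb := by rw [Inst.fb, Inst.zb]; omega
  have h2k₁U : 2 * I.k₁ ≤ E.U := by
    have : 2 * I.k₁ ≤ 4 * I.k₁ * I.k := by nlinarith
    rw [Inst.fb] at hfbU; omega
  have hlen₂ : I.len₂ ≤ 2 * I.k := by rw [Inst.len₂]; omega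
  have hlen₂U : I.len₂ ≤ E.U := by
    have : 2 * I.k ≤ 4 * I.k₁ * I.k := by nlinarith
    rw [Inst.fb] at hfbU; omega
  have hfill : Spec E (At 37 P (fun c' => ∀ a < I.fb, c' a = c a))
      (forLoop 37 twoK₁E (.setC (.add (.add (rg 21) twoK₁E) (rg 37)) aliE)) (2 * I.k₁ * 3 + 2)
      (At 37 P (fun c' => (∀ a < I.fb, c' a = c a) ∧
        ∀ m < 2 * I.k₁, c' (I.fb + 2 * I.k₁ + m) = I.ali J f m)) := by
    refine Spec.fillLoop le_self_add le_rfl (by decide +kernel) h2k₁U (by decide +kernel) ?_ ?_ ?_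
    · intro reg cpx h
      exact twoK₁E_val (hP.of_agree (by norm_num) h)
    · intro m hm reg cpx h hr
      have h' := hP.of_agree (by norm_num) h
      simp [WExp.val, twoK₁E_val h', h'.h21, hr]
    · intro m hm reg cpx h hr hcp
      have h' := hP.of_agree (by norm_num) h
      refine aliE_val hI h' ((h _ (by norm_num)).trans hJ) ((h _ (by norm_num)).trans hf) hr
        fun x hx => ?_
      rw [hcp _ (by omega), hc x hx]
  have hfft := fftProg_spec (E := E) (l := 37) (P := P) (Me := twoK₁E) (fbe := rg 21) (L := b)
    (fb := I.fb) (by norm_num) (by decide +kernel) (by decide +kernel) (hb ▸ h2k₁U)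
    (fun reg cpx h => by rw [twoK₁E_val (hP.of_agree (by norm_num) h), hb])
    (fun reg cpx h => by rw [rg_val, (hP.of_agree (by norm_num) h).h21]) c (I.ali J f)
  rw [← hb] at hfft
  set R : (ℕ → ℂ) → Prop := fun c' =>
    ∀ r < 2 * I.k₁, c' (I.fb + 2 * I.k₁ * (2 * I.k₁) + r) = I.red J f r with hRdef
  have hR : ∀ c a v, a < I.fb → R c → R (Function.update c a v) := fun c a v ha h r hr => by
    rw [Function.update_of_ne (by omega)]; exact h r hr
  have hacc : Spec E (At 37 P (Ref I.fb R c)) (forLoop 37 twoK₁E (forLoop 38 (rg 24)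
      (addC cellE termE))) (2 * I.k₁ * ((I.len₂ * 3 + 2) + 2) + 2)
      (At 37 P (Ref I.fb R (c + I.freqCon Δ' J f))) := by
    refine Spec.sumLoop (T := I.len₂ * 3 + 2) _ (fun _ => True) le_rfl (by decide +kernel) h2k₁U ?_
      (fun _ _ _ _ => trivial) (fun r hr c _ => ?_) trivial
    · intro reg cpx h
      exact twoK₁E_val (hP.of_agree (by norm_num) h)
    have hP₁ := hP.update (i := 37) (by norm_num) r
    refine Spec.sumLoop (T := 1) _ (fun _ => True) le_rfl (by decide +kernel) hlen₂U ?_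
      (fun _ _ _ _ => trivial) (fun t ht c _ => ?_) trivial
    · intro reg cpx h
      rw [rg_val, (hP₁.of_agree (by norm_num) h).h24]
    have hidx : I.idx (I.perm f) t < 2 * I.k := Nat.mod_lt _ (by omega)
    refine Spec.addC (by decide +kernel) hR ?_ ?_ ?_
    · rw [Inst.fb]
      have : (r + 1) * (2 * I.k) ≤ 2 * I.k₁ * (2 * I.k) := Nat.mul_le_mul_right _ hr
      nlinarith
    · intro reg cpx h
      obtain ⟨h1, h2, h3⟩ := at_succ_iff.1 h
      have h' := hP₁.of_agree (by norm_num) h1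
      have hg' : reg 36 = I.perm f := by rw [h1 _ (by norm_num)]; simpa using hg
      have hr' : reg 37 = r := by rw [h1 _ (by norm_num)]; simp
      simp only [cellE, WExp.val, idxE_val h' hg' h2, twoKE_val h', rg_val, h'.h20, hr']
    · intro reg cpx h
      obtain ⟨h1, h2, h3⟩ := at_succ_iff.1 h
      have h' := hP₁.of_agree (by norm_num) h1
      refine termE_val h' ?_ ?_ ?_ ?_ h2 (h3.2 r hr)
      · rw [h1 _ (by norm_num)]; simpa using hΔ
      · rw [h1 _ (by norm_num)]; simpa using hf
      · rw [h1 _ (by norm_num)]; simpa using hg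
      · rw [h1 _ (by norm_num)]; simp
  refine (hfill.conseq (fun c h => h.1) (fun c h => h)).seq (hfft.seq (hacc.conseq ?_ ?_))
  · intro c h; exact ⟨h.1, fun r hr => h.2 r hr⟩
  · intro c h; exact ⟨h.1, trivial⟩

lemma freqCon_apply_eq_zero (Δ' J f : ℕ) {a : ℕ} (ha : a < I.zb) :
    I.freqCon Δ' J f a = 0 := by
  rw [Inst.freqCon, Finset.sum_apply]
  exact Finset.sum_eq_zero fun r _ => sum_single_eq_zero _ _ _ fun t _ => by omega

/-- Summing over all active blocks and the frequencies in their windows fills the table. -/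
lemma tableProg_spec (hI : I.Good lb E) (hP : Holds I lb P) {Δ' b : ℕ}
    (hb : 2 * I.k₁ = 2 ^ b) (hΔ : P 31 = Δ') {c : ℕ → ℂ} (hc : ∀ x < I.n, c (1 + x) = I.X x) :
    Spec E (At 32 P (Ref I.fb (fun _ => True) c)) tableProg (I.tableTime b)
      (At 32 P (Ref I.fb (fun _ => True) (c + I.tableCon Δ'))) := by
  have hzb : I.n < I.zb := by rw [Inst.zb]; omega
  have hNU := hI.NU
  have hN := hI.N_pos
  have hOk : ∀ (J f : ℕ) (c : ℕ → ℂ), (∀ x < I.n, c (1 + x) = I.X x) →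
      ∀ x < I.n, (c + I.freqCon Δ' J f) (1 + x) = I.X x := by
    intro J f c hc x hx
    rw [Pi.add_apply, freqCon_apply_eq_zero _ _ _ (by omega), add_zero, hc x hx]
  have hOk' : ∀ (J m : ℕ) (c : ℕ → ℂ), (∀ x < I.n, c (1 + x) = I.X x) →
      ∀ x < I.n, (c + ∑ t ∈ Finset.range m, I.freqCon Δ' J (I.freq J t)) (1 + x) = I.X x := by
    intro J m
    induction m with
    | zero => intro c hc; simpa using hc
    | succ m ih =>
      intro c hc
      rw [Finset.sum_range_succ, ← add_assoc]
      exact hOk _ _ _ (ih c hc)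
  refine Spec.sumLoop (T := 1 + (I.len₁ * ((1 + (1 + I.freqTime b)) + 2) + 2)) _
    (fun c => ∀ x < I.n, c (1 + x) = I.X x) le_rfl (by decide +kernel) hI.lenU ?_
    (fun m _ c hc => hOk' _ _ c hc) (fun j hj c hc => ?_) hc
  · intro reg cpx h
    rw [rg_val, (hP.of_agree (by norm_num) h).h2]
  have hP₁ := hP.update (i := 32) (by norm_num) j
  have hΔ₁ : Function.update P 32 j 31 = Δ' := by simpa using hΔ
  generalize hQ₁ : Function.update P 32 j = P₁ at hP₁ hΔ₁ ⊢
  have hj₁ : P₁ 32 = j := by simp [← hQ₁]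
  refine Spec.seq (mid := At 34 (Function.update P₁ 33 (I.blk j)) (Ref I.fb (fun _ => True) c))
    (Spec.setR_at (by decide +kernel) ?_ (fun _ _ h => h) ?_) ?_
  · rw [← hI.list j hj]; exact E.ini_le _
  · intro reg cpx h
    have h' := hP₁.of_agree (by norm_num) h.1
    have := hI.lb_le
    simp only [WExp.val, rg_val, h'.h3, h.1 32 (by norm_num), hj₁]
    rw [memOf_word_lt _ _ (by rw [hI.ini0]; omega), hI.list j hj]
  have hP₂ := hP₁.update (i := 33) (by norm_num) (I.blk j)
  have hΔ₂ : Function.update P₁ 33 (I.blk j) 31 = Δ' := by simpa using hΔ₁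
  refine Spec.forget (l' := 34) (P' := Function.update P₁ 33 (I.blk j)) ?_ (by norm_num)
    (fun r hr => Function.update_of_ne (by omega) _ _)
  generalize hQ₂ : Function.update P₁ 33 (I.blk j) = P₂ at hP₂ hΔ₂ ⊢
  have hJ₂ : P₂ 33 = I.blk j := by simp [← hQ₂]
  refine Spec.sumLoop (T := 1 + (1 + I.freqTime b)) _
    (fun c => ∀ x < I.n, c (1 + x) = I.X x) le_rfl (by decide +kernel)
    (by rw [Inst.len₁]; omega) ?_ (fun m _ c hc => hOk _ _ c hc) (fun t ht c hc => ?_) hc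
  · intro reg cpx h
    rw [rg_val, (hP₂.of_agree (by norm_num) h).h19]
  have hP₃ := hP₂.update (i := 34) (by norm_num) t
  refine Spec.seq (mid := At 36 (Function.update (Function.update P₂ 34 t) 35
    (I.freq (I.blk j) t)) (Ref I.fb (fun _ => True) c))
    (Spec.setR_at (by decide +kernel) ?_ (fun _ _ h => h) ?_) ?_
  · exact (Nat.mod_lt _ hN).le.trans hNU
  · intro reg cpx h
    have h' := hP₃.of_agree (by norm_num) h.1
    simp [WExp.val, h'.h17, h'.h18, h.1 33, h.1 34, hJ₂, Inst.freq]
  have hP₄ := hP₃.update (i := 35) (by norm_num) (I.freq (I.blk j) t)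
  refine Spec.seq (mid := At 37 (Function.update (Function.update (Function.update P₂ 34 t) 35
    (I.freq (I.blk j) t)) 36 (I.perm (I.freq (I.blk j) t))) (Ref I.fb (fun _ => True) c))
    (Spec.setR_at (by decide +kernel) ?_ (fun _ _ h => h) ?_) ?_
  · exact (Nat.mod_lt _ hN).le.trans hNU
  · intro reg cpx h
    have h' := hP₄.of_agree (by norm_num) h.1
    simp [WExp.val, h'.h17, h'.h4, h.1 35, Inst.perm]
  have hP₅ := hP₄.update (i := 36) (by norm_num) (I.perm (I.freq (I.blk j) t))
  refine (freqProg_spec hI hP₅ hb ?_ ?_ ?_ ?_ hc).forget (by norm_num) fun r hr => ?_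
  · simpa using hΔ₂
  · simpa using hJ₂
  · simp
  · simp
  · rw [Function.update_of_ne (by omega), Function.update_of_ne (by omega)]

lemma tableCon_apply_eq_zero (Δ' : ℕ) {a : ℕ} (ha : a < I.zb) :
    I.tableCon Δ' a = 0 := by
  simp only [Inst.tableCon, Finset.sum_apply]
  exact Finset.sum_eq_zero fun J _ => Finset.sum_eq_zero fun t _ =>
    freqCon_apply_eq_zero _ _ _ ha

lemma rowCon_apply_eq_zero (Δ' r : ℕ) (hr : r < 2 * I.k₁) {a : ℕ}
    (ha : a ≤ I.n ∨ I.zb ≤ a) : I.rowCon Δ' r a = 0 := by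
  rw [Inst.rowCon]
  refine sum_single_eq_zero _ _ _ fun jj hjj => ?_
  have hjj' := Finset.mem_range.1 hjj
  have : (r + 1) * I.q ≤ 2 * I.k₁ * I.q := Nat.mul_le_mul_right _ hr
  rw [Inst.zb] at ha
  rw [add_mul] at this
  omega

/-- A row of the output is obtained from a row of the table by one transform of length `2 k`. -/
lemma rowProg_spec (hI : I.Good lb E) (hP : Holds I lb P) {Δ' r e : ℕ}
    (he : 2 * I.k = 2 ^ e) (hΔ : P 31 = Δ') (hr : P 32 = r) (hr' : r < 2 * I.k₁) {c : ℕ → ℂ}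
    (hc : ∀ a, I.zb ≤ a → a < I.fb → c a = I.tableCon Δ' a) :
    Spec E (At 33 P (Ref I.fb (fun _ => True) c)) rowProg (I.rowTime e)
      (At 33 P (Ref I.fb (fun _ => True) (c + I.rowCon Δ' r))) := by
  have hfbU := hI.fbU
  have hk₁ := hI.k₁_pos
  have hk := hI.k_pos
  have hzb_fb : I.zb ≤ I.fb := by rw [Inst.fb]; omega
  have hrk : r * (2 * I.k) + 2 * I.k ≤ 4 * I.k₁ * I.k := by
    have : (r + 1) * (2 * I.k) ≤ 2 * I.k₁ * (2 * I.k) := Nat.mul_le_mul_right _ hr'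
    nlinarith
  have hrq : r * I.q + I.q ≤ 2 * I.k₁ * I.q := by
    have : (r + 1) * I.q ≤ 2 * I.k₁ * I.q := Nat.mul_le_mul_right _ hr'
    nlinarith
  have h2kU : 2 * I.k ≤ E.U := by rw [Inst.fb] at hfbU; omega
  have hqU : I.q ≤ E.U := by rw [Inst.fb, Inst.zb] at hfbU; omega
  set v : ℕ → ℂ := fun b => I.tableCon Δ' (I.zb + r * (2 * I.k) + b) with hv
  have hfill : Spec E (At 33 P (fun c' => ∀ a < I.fb, c' a = c a))
      (forLoop 33 twoKE (.setC (.add (.add (rg 21) twoKE) (rg 33))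
      (.get (.add (.add (rg 20) (.mul (rg 32) twoKE)) (rg 33))))) (2 * I.k * 3 + 2)
      (At 33 P (fun c' => (∀ a < I.fb, c' a = c a) ∧
        ∀ m < 2 * I.k, c' (I.fb + 2 * I.k + m) = v m)) := by
    refine Spec.fillLoop le_self_add le_rfl (by decide +kernel) h2kU (by decide +kernel) ?_ ?_ ?_
    · intro reg cpx h
      exact twoKE_val (hP.of_agree (by norm_num) h)
    · intro m hm reg cpx h hr
      have h' := hP.of_agree (by norm_num) h
      simp [WExp.val, twoKE_val h', h'.h21, hr]
    · intro m hm reg cpx h hm' hcp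
      have h' := hP.of_agree (by norm_num) h
      simp only [CExp.val, WExp.val, rg_val, twoKE_val h', h'.h20, hm', h 32 (by norm_num), hr,
        memOf_cpx]
      have hlt : I.zb + r * (2 * I.k) + m < I.fb := by rw [Inst.fb]; omega
      rw [hcp _ hlt, hc _ (by omega) hlt]
  have hfft := fftProg_spec (E := E) (l := 33) (P := P) (Me := twoKE) (fbe := rg 21) (L := e)
    (fb := I.fb) (by norm_num) (by decide +kernel) (by decide +kernel) (he ▸ h2kU)
    (fun reg cpx h => by rw [twoKE_val (hP.of_agree (by norm_num) h), he])
    (fun reg cpx h => by rw [rg_val, (hP.of_agree (by norm_num) h).h21]) c v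
  rw [← he] at hfft
  set R : (ℕ → ℂ) → Prop := fun c' =>
    ∀ r < 2 * I.k, c' (I.fb + 2 * I.k * (2 * I.k) + r) =
      ∑ b ∈ Finset.range (2 * I.k), v b * rootPow (2 * I.k) (r * b) with hRdef
  have hR : ∀ c a v, a < I.fb → R c → R (Function.update c a v) := fun c a v ha h r hr => by
    rw [Function.update_of_ne (by omega)]; exact h r hr
  refine (hfill.conseq (fun c h => h.1) (fun c h => h)).seq (hfft.seq ?_)
  refine Spec.conseq (Φ := Ref I.fb R c) (Ψ := Ref I.fb R (c + I.rowCon Δ' r)) ?_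
    (fun c h => h) (fun c h => ⟨h.1, trivial⟩)
  refine Spec.sumLoop (T := 1) _ (fun _ => True) le_rfl (by decide +kernel) hqU ?_
    (fun _ _ _ _ => trivial) (fun jj hjj c _ => ?_) trivial
  · intro reg cpx h
    rw [rg_val, (hP.of_agree (by norm_num) h).h22]
  refine Spec.addC (by decide +kernel) hR (by rw [Inst.fb, Inst.zb]; omega) ?_ ?_
  · intro reg cpx h
    obtain ⟨h1, h2, h3⟩ := at_succ_iff.1 h
    have h' := hP.of_agree (by norm_num) h1
    simp only [outE, WExp.val, nE_val hI, rg_val, h'.h22, h2, h1 32 (by norm_num), hr]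
  · intro reg cpx h
    obtain ⟨h1, h2, h3⟩ := at_succ_iff.1 h
    have h' := hP.of_agree (by norm_num) h1
    have hlt : (jj + 2 * I.k - I.k₀ / 2) % (2 * I.k) < 2 * I.k := Nat.mod_lt _ (by omega)
    simp only [CExp.val, WExp.val, selE_val hI h' ((h1 31 (by norm_num)).trans hΔ) h2, rg_val,
      twoKE_val h', h'.h21, h'.h0, h2, memOf_cpx, h3.2 _ hlt, Inst.outVal, hv]

/-- The common part adds the outputs of all lifts to the memory. -/
lemma passProg_spec (hI : I.Good lb E) (hP : Holds I lb P) {b e : ℕ}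
    (hb : 2 * I.k₁ = 2 ^ b) (he : 2 * I.k = 2 ^ e) {c : ℕ → ℂ}
    (hc : ∀ x < I.n, c (1 + x) = I.X x) :
    Spec E (At 30 P (Ref I.zb (fun _ => True) c)) passProg (I.passTime b e)
      (At 30 P (Ref I.zb (fun _ => True)
        (c + ∑ m ∈ Finset.range I.npass, I.passCon (I.Δ + m * (I.n / I.k₁))))) := by
  have hfbU := hI.fbU
  have hzb_fb : I.zb ≤ I.fb := by rw [Inst.fb]; omega
  have hzb : I.n < I.zb := by rw [Inst.zb]; omega
  have h2k₁U : 2 * I.k₁ ≤ E.U := by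
    have := hI.k_pos
    have : 2 * I.k₁ ≤ 4 * I.k₁ * I.k := by nlinarith
    rw [Inst.fb] at hfbU; omega
  have hpass0 : ∀ Δ' a, a ≤ I.n ∨ I.zb ≤ a → I.passCon Δ' a = 0 := by
    intro Δ' a ha
    rw [Inst.passCon, Finset.sum_apply]
    exact Finset.sum_eq_zero fun r hr => rowCon_apply_eq_zero _ _ (Finset.mem_range.1 hr) ha
  refine Spec.sumLoop (T := 1 + ((4 * I.k₁ * I.k * 3 + 2) + (I.tableTime b +
    (2 * I.k₁ * (I.rowTime e + 2) + 2)))) _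
    (fun c => ∀ x < I.n, c (1 + x) = I.X x) le_rfl (by decide +kernel) hI.npassU ?_ ?_
    (fun m hm c hc => ?_) hc
  · intro reg cpx h
    rw [rg_val, (hP.of_agree (by norm_num) h).h7]
  · intro m hm c hc x hx
    rw [Pi.add_apply, hpass0 _ _ (by omega), add_zero, hc x hx]
  have hP₁ := hP.update (i := 30) (by norm_num) m
  set Δ' := I.Δ + m * (I.n / I.k₁) with hΔ'
  refine Spec.seq (mid := At 32 (Function.update (Function.update P 30 m) 31 Δ')
    (Ref I.zb (fun _ => True) c))
    (Spec.setR_at (by decide +kernel) (hI.shiftU m hm) (fun _ _ h => h) ?_) ?_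
  · intro reg cpx h
    have h' := hP₁.of_agree (by norm_num) h.1
    simp [WExp.val, nE_val hI, h'.h5, h'.h1, h.1 30, hΔ']
  have hP₂ := hP₁.update (i := 31) (by norm_num) Δ'
  refine Spec.forget (l' := 32) (P' := Function.update (Function.update P 30 m) 31 Δ') ?_
    (by norm_num) (fun r hr => Function.update_of_ne (by omega) _ _)
  generalize hQ₂ : Function.update (Function.update P 30 m) 31 Δ' = P₂ at hP₂ ⊢
  have hΔ₂ : P₂ 31 = Δ' := by simp [← hQ₂]
  set c₁ : ℕ → ℂ := fun a => if a < I.zb then c a else 0 with hc₁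
  have hclear : Spec E (At 32 P₂ (Ref I.zb (fun _ => True) c)) clearProg
      (4 * I.k₁ * I.k * 3 + 2) (At 32 P₂ (Ref I.fb (fun _ => True) c₁)) := by
    refine Spec.conseq (Spec.fillLoop (B := I.zb) (B' := I.zb) (c₀ := c) (v := fun _ => 0) le_rfl
      le_rfl (by decide +kernel) (M := 4 * I.k₁ * I.k) (by rw [Inst.fb] at hfbU; omega)
      (by decide +kernel) ?_ ?_ ?_) (fun c h => h.1) ?_
    · intro reg cpx h
      have h' := hP₂.of_agree (by norm_num) h
      simp [WExp.val, h'.h1, h'.h13]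
    · intro m hm reg cpx h hr
      have h' := hP₂.of_agree (by norm_num) h
      simp [WExp.val, h'.h20, hr]
    · intro m hm reg cpx h hr _
      simp [CExp.val, WExp.val]
    · rintro c' ⟨h1, h2⟩
      refine ⟨fun a ha => ?_, trivial⟩
      simp only [hc₁]
      split_ifs with h
      · exact h1 a h
      · have := h2 (a - I.zb) (by rw [Inst.fb] at ha; omega)
        rwa [show I.zb + (a - I.zb) = a by omega] at this
  have hc₁ok : ∀ x < I.n, c₁ (1 + x) = I.X x := fun x hx => by
    simp only [hc₁]; rw [if_pos (by omega), hc x hx]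
  refine hclear.seq ((tableProg_spec hI hP₂ hb hΔ₂ hc₁ok).seq ?_)
  refine Spec.conseq (Spec.sumLoop (T := I.rowTime e) (fun r => I.rowCon Δ' r)
    (fun c => ∀ a, I.zb ≤ a → a < I.fb → c a = I.tableCon Δ' a) le_rfl (by decide +kernel) h2k₁U ?_
    ?_ (fun r hr c hc => ?_) (c := c₁ + I.tableCon Δ') ?_) (fun c h => h) ?_
  · intro reg cpx h
    exact twoK₁E_val (hP₂.of_agree (by norm_num) h)
  · intro r hr c hc a ha ha'
    rw [Pi.add_apply, rowCon_apply_eq_zero _ _ hr (Or.inr ha), add_zero, hc a ha ha']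
  · exact rowProg_spec hI (hP₂.update (i := 32) (by norm_num) r) he (by simpa using hΔ₂) (by simp)
      hr hc
  · intro a ha ha'
    simp [hc₁, not_lt.2 ha]
  · rintro c' ⟨h1, -⟩
    refine ⟨fun a ha => ?_, trivial⟩
    rw [h1 a (by omega)]
    simp only [Pi.add_apply, tableCon_apply_eq_zero _ ha, hc₁, if_pos ha, add_zero, Inst.passCon]

end

/-! ### The programs -/

section
variable {E : Env} {l T : ℕ} {P : ℕ → ℕ} {Φ : (ℕ → ℂ) → Prop} {post : Assertion}

lemma Spec.skip (pre : Assertion) : Spec E pre .skip 1 pre := fun reg cpx hb h =>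
  ⟨reg, cpx, 1, .skip _, by rw [wtBound]; norm_num, hb, h⟩

/-- An assignment to the next register, where `P` already contains its future value. -/
lemma Spec.letR {e : WExp} {p : Prog} (hw : e.wt + l + 20 ≤ wtBound)
    (hv : P l ≤ E.U) (he : ∀ reg cpx, At l P Φ reg cpx → e.val (memOf E.ini reg cpx) = P l)
    (hp : Spec E (At (l + 1) P Φ) p T post) :
    Spec E (At l P Φ) (.seq (setR l e) p) (1 + T) post := by
  have h := Spec.setR_at hw hv (fun _ _ h => h) he
  rw [Function.update_eq_self] at h
  exact h.seq hp

/-- Computes the base two logarithm `L` of a power of two, or its rounded up value in general, and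
the power `2 ^ L`.  Both are packed into one register, as loops have a single control register:
after `m` passes the register `l` contains `4 n m + 2 ^ m`. -/
def logProg (l : ℕ) (x : WExp) : Prog :=
  whileR l (.lit 1) (.lt (.mod (rg l) (.mul (.lit 4) nE)) x)
    (.add (.add (rg l) (.mod (rg l) (.mul (.lit 4) nE))) (.mul (.lit 4) nE)) .skip

lemma Spec.logProg {x : WExp} {p : Prog} {n y : ℕ} (L : ℕ) (hl : l ≤ 100)
    (hw : x.wt ≤ 100) (hn : E.ini 0 = n)
    (hx : ∀ reg cpx, (∀ r < l, reg r = P r) → x.val (memOf E.ini reg cpx) = y)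
    (hL : ∀ m, 2 ^ m < y ↔ m < L) (hLn : 2 ^ L < 4 * n) (hU : L * (4 * n) + 4 * n ≤ E.U)
    (hP : P l = L * (4 * n) + 2 ^ L) (hp : Spec E (At (l + 1) P Φ) p T post) :
    Spec E (At l P Φ) (.seq (logProg l x) p) (L * 3 + 2 + T) post := by
  rw [← Function.update_eq_self l P, hP] at hp
  have hwr : (rg l).wt = l + 15 := by simp only [rg, regAddr, WExp.wt]; omega
  have hwn : nE.wt = 2 := by decide
  have hnv : ∀ reg cpx, nE.val (memOf E.ini reg cpx) = n := fun reg cpx => by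
    simp [nE, WExp.val, memOf, hn]
  have hpow : ∀ m ≤ L, 2 ^ m < 4 * n := fun m hm =>
    (Nat.pow_le_pow_right (by norm_num) hm).trans_lt hLn
  have hmod : ∀ m ≤ L, (m * (4 * n) + 2 ^ m) % (4 * n) = 2 ^ m := fun m hm => by
    rw [mul_comm, Nat.mul_add_mod, Nat.mod_eq_of_lt (hpow m hm)]
  refine Spec.seq (Spec.whileR (T := 1) (fun m => m * (4 * n) + 2 ^ m) L (fun _ => Φ) ?_ ?_ ?_ ?_
    ?_ ?_ ?_ (fun _ _ => Spec.skip _)) hp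
  · simp only [WExp.wt, wtBound]; omega
  · simp only [WExp.wt, hwr, hwn, wtBound]; omega
  · simp only [Test.wt, WExp.wt, hwr, hwn, wtBound]; omega
  · intro _ _ _; simp [WExp.val]
  · intro m hm
    have := hpow m hm
    have : m * (4 * n) ≤ L * (4 * n) := Nat.mul_le_mul_right _ hm
    omega
  · intro m hm reg cpx h
    obtain ⟨h1, h2, h3⟩ := at_succ_iff.1 h
    simp only [Test.Holds, WExp.val, rg_val, h2, hnv, hmod m hm, hx reg cpx h1, hL]
  · intro m hm reg cpx h
    obtain ⟨h1, h2, h3⟩ := at_succ_iff.1 h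
    simp only [WExp.val, rg_val, h2, hnv, hmod m hm.le, pow_succ]
    ring

/-- Computes `⌊c a⌋ + 1`, where `c` is the number in the first cell of the complex memory. -/
def floorProg (l : ℕ) (a : WExp) : Prog :=
  whileR l (.lit 1) (.le (.ofWord (rg l)) (.mul (.get (.lit 0)) (.ofWord a)))
    (.add (rg l) (.lit 1)) .skip

lemma Spec.floorProg {x : WExp} {p : Prog} {a : ℕ} {c : ℝ} (hc0 : 0 ≤ c) (hl : l ≤ 100)
    (hw : x.wt ≤ 100) (hx : ∀ reg cpx, (∀ r < l, reg r = P r) → x.val (memOf E.ini reg cpx) = a)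
    (hc : ∀ cpx, Φ cpx → cpx 0 = (c : ℂ)) (hU : ⌊c * a⌋₊ + 1 ≤ E.U)
    (hP : P l = ⌊c * a⌋₊ + 1) (hp : Spec E (At (l + 1) P Φ) p T post) :
    Spec E (At l P Φ) (.seq (floorProg l x) p) (⌊c * a⌋₊ * 3 + 2 + T) post := by
  rw [← Function.update_eq_self l P, hP] at hp
  have hwr : (rg l).wt = l + 15 := by simp only [rg, regAddr, WExp.wt]; omega
  refine Spec.seq (Spec.whileR (T := 1) (fun m => m + 1) ⌊c * a⌋₊ (fun _ => Φ) ?_ ?_ ?_ ?_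
    ?_ ?_ ?_ (fun _ _ => Spec.skip _)) hp
  · simp only [WExp.wt, wtBound]; omega
  · simp only [WExp.wt, hwr, wtBound]; omega
  · simp only [Test.wt, WExp.wt, CExp.wt, hwr, wtBound]; omega
  · intro _ _ _; simp [WExp.val]
  · intro m hm; omega
  · intro m hm reg cpx h
    obtain ⟨h1, h2, h3⟩ := at_succ_iff.1 h
    have h0 : ((c : ℂ) * (a : ℂ)).re = c * a := by
      rw [← Complex.ofReal_natCast, ← Complex.ofReal_mul, Complex.ofReal_re]
    simp only [Test.Holds, CExp.val, WExp.val, rg_val, h2, hx reg cpx h1, memOf_cpx, hc _ h3, h0,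
      Complex.natCast_re]
    rw [← Nat.le_floor_iff (by positivity)]
    omega
  · intro m hm reg cpx h
    obtain ⟨h1, h2, h3⟩ := at_succ_iff.1 h
    simp only [WExp.val, rg_val, h2]

end

/-- Computes the parameters of the common part, and continues with `p`. -/
def setupProg (p : Prog) : Prog :=
  .seq (logProg 8 nE) (.seq (setR 9 (.div (rg 8) (.mul (.lit 4) nE)))
  (.seq (logProg 10 (rg 1)) (.seq (setR 11 (.div (rg 10) (.mul (.lit 4) nE)))
  (.seq (logProg 12 (rg 0)) (.seq (setR 13 (.mod (rg 12) (.mul (.lit 4) nE)))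
  (.seq (floorProg 14 (rg 9)) (.seq (setR 15 (.add (rg 9) (rg 14)))
  (.seq (setR 16 (.add (.sub (.add (.mul (.lit 2) (rg 9)) (.lit 1)) (rg 11)) (rg 14)))
  (.seq (setR 17 (.div (.mul (.lit 2) nE) (rg 1)))
  (.seq (setR 18 (.add (.mul (.lit 64) (rg 15)) (.lit 2)))
  (.seq (setR 19 (.sub (.add (.mul (.lit 2) (rg 18)) (.lit 1))
    (.sub (.add (.mul (.lit 2) (rg 18)) (.lit 1)) (rg 17))))
  (.seq (setR 20 (.add (.add nE (.lit 1)) (.mul twoK₁E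
    (.add (.mul (.lit 2) (.div (rg 0) (.lit 2))) (.lit 1)))))
  (.seq (setR 21 (.add (rg 20) (.mul (.mul (.lit 4) (rg 1)) (rg 13))))
  (.seq (setR 22 (.add (.mul (.lit 2) (.div (rg 0) (.lit 2))) (.lit 1)))
  (.seq (setR 23 (.add (.mul (.lit 64) (rg 16)) (.lit 2)))
  (.seq (setR 24 (.sub (.add (.mul (.lit 2) (rg 23)) (.lit 1))
    (.sub (.add (.mul (.lit 2) (rg 23)) (.lit 1)) twoKE))) p))))))))))))))))

/-- The relations between the inputs, the parameters, and the bound `B = n ⌈c⌉`. -/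
structure Inst.Params (I : Inst) (c : ℝ) (a b e B : ℕ) : Prop where
  n_eq : I.n = 2 ^ a
  k₁_eq : I.k₁ = 2 ^ b
  k_eq : I.k = 2 ^ e
  e_eq : e = Nat.clog 2 I.k₀
  b_pos : 1 ≤ b
  two_k₁_le : 2 * I.k₁ ≤ I.n
  k₀_pos : 1 ≤ I.k₀
  k₀_le : I.k₀ ≤ I.n / I.k₁
  c_ge : 1 ≤ c
  lam₁_eq : I.lam₁ = a + (⌊c * a⌋₊ + 1)
  lam₂_eq : I.lam₂ = 2 * a + 1 - b + (⌊c * a⌋₊ + 1)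
  n_le : I.n ≤ B
  floor_le : ⌊c * a⌋₊ ≤ B
  four_le : 4 ≤ B

namespace Inst.Params
variable {I : Inst} {c : ℝ} {a b e B : ℕ} (h : I.Params c a b e B)
include h

lemma k₁_pos : 0 < I.k₁ := by rw [h.k₁_eq]; positivity
lemma k_pos : 0 < I.k := by rw [h.k_eq]; positivity
lemma n_pos : 0 < I.n := by rw [h.n_eq]; positivity
lemma b_lt : b < a := by
  have := h.two_k₁_le
  rw [h.n_eq, h.k₁_eq, ← pow_succ'] at this
  exact (Nat.pow_le_pow_iff_right (by norm_num)).1 this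
lemma k₁_dvd : I.k₁ ∣ I.n := by
  rw [h.n_eq, h.k₁_eq]; exact Nat.pow_dvd_pow _ h.b_lt.le
lemma k₀_mul_le : I.k₀ * I.k₁ ≤ I.n := by
  have := Nat.mul_le_mul_right I.k₁ h.k₀_le
  rwa [Nat.div_mul_cancel h.k₁_dvd] at this
lemma N_eq : I.N = 2 * (I.n / I.k₁) := by
  rw [Inst.N, Nat.mul_div_assoc _ h.k₁_dvd]
lemma N_pow : I.N = 2 ^ (a + 1 - b) := by
  have := h.b_lt
  rw [Inst.N, h.n_eq, h.k₁_eq, ← pow_succ', Nat.pow_div (by omega) (by norm_num)]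
lemma N_le : I.N ≤ I.n := by
  have := h.b_pos
  rw [h.N_pow, h.n_eq]
  exact Nat.pow_le_pow_right (by norm_num) (by omega)
lemma k₀_le_k : I.k₀ ≤ I.k := by
  rw [h.k_eq, h.e_eq]; exact Nat.le_pow_clog (by norm_num) _
lemma e_le : e ≤ a - b := by
  have := h.b_lt
  rw [h.e_eq]
  refine (Nat.clog_le_iff_le_pow (by norm_num)).2 (h.k₀_le.trans ?_)
  rw [h.n_eq, h.k₁_eq, Nat.pow_div (by omega) (by norm_num)]
lemma two_k_le : 2 * I.k ≤ I.N := by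
  have := h.b_lt
  have := h.e_le
  rw [h.k_eq, h.N_pow, ← pow_succ']
  exact Nat.pow_le_pow_right (by norm_num) (by omega)
lemma k_le : I.k ≤ 2 * I.k₀ := by
  rw [h.k_eq]
  rcases Nat.eq_zero_or_pos e with he | he
  · rw [he]; have := h.k₀_pos; omega
  · have : ¬ I.k₀ ≤ 2 ^ (e - 1) := fun hle => by
      have := (Nat.clog_le_iff_le_pow (b := 2) (by norm_num)).2 hle
      rw [← h.e_eq] at this; omega
    have h2 : 2 ^ e = 2 * 2 ^ (e - 1) := by rw [← pow_succ']; congr 1; omega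
    omega
lemma a_le : a ≤ I.n := by rw [h.n_eq]; exact Nat.lt_two_pow_self.le
lemma fb_le : I.fb ≤ 20 * B := by
  have h1 := h.k₀_mul_le
  have h2 := h.two_k₁_le
  have h3 := h.n_le
  have h4 : I.q ≤ I.k₀ + 1 := by rw [Inst.q]; omega
  have h5 := Nat.mul_le_mul_left (2 * I.k₁) h4
  have h6 := Nat.mul_le_mul_left (4 * I.k₁) h.k_le
  have h7 := h.four_le
  rw [Inst.fb, Inst.zb]
  nlinarith

end Inst.Params

/-- The number of steps to compute the parameters. -/
def setupTime (a b e m : ℕ) : ℕ := (a * 3 + 2) + (b * 3 + 2) + (e * 3 + 2) + (m * 3 + 2) + 13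

/-- The final contents of the registers that hold parameters; `a`, `b`, `e` are the logarithms of
`n`, `k₁`, `k`. -/
def Inst.regs (I : Inst) (lb a b e m : ℕ) (i : ℕ) : ℕ :=
  [I.k₀, I.k₁, I.len, lb, I.σ, I.Δ, I.flag, I.npass, a * (4 * I.n) + 2 ^ a, a,
    b * (4 * I.n) + 2 ^ b, b, e * (4 * I.n) + 2 ^ e, I.k, m, I.lam₁, I.lam₂, I.N, I.H₁, I.len₁,
    I.zb, I.fb, I.q, I.H₂, I.len₂].getD i 0

/-- The registers are written in increasing order, so that every assignment is an instance of
`Spec.letR` for the final contents `Inst.regs`. -/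
lemma setupProg_spec {I : Inst} {E : Env} {lb : ℕ} {c : ℝ} {a b e B T : ℕ} {P : ℕ → ℕ}
    {Φ : (ℕ → ℂ) → Prop} {post : Assertion} {p : Prog}
    (hI : I.Params c a b e B) (hB : 1000 * B ^ 2 ≤ E.U) (hn : E.ini 0 = I.n)
    (hc : ∀ cpx, Φ cpx → cpx 0 = (c : ℂ)) (hP : P = I.regs lb a b e (⌊c * a⌋₊ + 1))
    (hp : Holds I lb P → Spec E (At 25 P Φ) p T post) :
    Spec E (At 8 P Φ) (setupProg p) (setupTime a b e ⌊c * a⌋₊ + T) post := by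
  have hH : Holds I lb P := by rw [hP]; constructor <;> rfl
  have p8 : P 8 = a * (4 * I.n) + 2 ^ a := by rw [hP]; rfl
  have p9 : P 9 = a := by rw [hP]; rfl
  have p10 : P 10 = b * (4 * I.n) + 2 ^ b := by rw [hP]; rfl
  have p11 : P 11 = b := by rw [hP]; rfl
  have p12 : P 12 = e * (4 * I.n) + 2 ^ e := by rw [hP]; rfl
  have p14 : P 14 = ⌊c * a⌋₊ + 1 := by rw [hP]; rfl
  have hnv : ∀ reg cpx, nE.val (memOf E.ini reg cpx) = I.n := fun reg cpx => by
    simp [nE, WExp.val, memOf, hn]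
  have hb := hI.b_lt
  have he := hI.e_le
  have hn0 := hI.n_pos
  have hnB := hI.n_le
  have haB := hI.a_le.trans hnB
  have hfl := hI.floor_le
  have h4B := hI.four_le
  have hBB : 1000 * B ≤ E.U := by
    have : B ≤ B ^ 2 := Nat.le_self_pow (by norm_num) B
    omega
  have hpow : ∀ x ≤ a, 2 ^ x ≤ I.n := fun x hx => by
    rw [hI.n_eq]; exact Nat.pow_le_pow_right (by norm_num) hx
  have hlogU : ∀ L ≤ a, L * (4 * I.n) + 4 * I.n ≤ E.U := fun L hL => by
    have h1 : L * (4 * I.n) ≤ B * (4 * B) := Nat.mul_le_mul (by omega) (by omega)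
    have h2 : B * (4 * B) = 4 * B ^ 2 := by ring
    have h3 : B ≤ B ^ 2 := Nat.le_self_pow (by norm_num) B
    omega
  have hdiv : ∀ L ≤ a, (L * (4 * I.n) + 2 ^ L) / (4 * I.n) = L := fun L hL => by
    have := hpow L hL
    rw [mul_comm, Nat.mul_add_div (by omega), Nat.div_eq_of_lt (by omega), add_zero]
  have hmod : ∀ L ≤ a, (L * (4 * I.n) + 2 ^ L) % (4 * I.n) = 2 ^ L := fun L hL => by
    have := hpow L hL
    rw [mul_comm, Nat.mul_add_mod, Nat.mod_eq_of_lt (by omega)]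
  have hfbU : I.fb ≤ E.U := hI.fb_le.trans (by omega)
  have hlam₁ := hI.lam₁_eq
  have hlam₂ := hI.lam₂_eq
  have hNn := hI.N_le
  have h2kN := hI.two_k_le
  refine Spec.mono (T := (a * 3 + 2) + (1 + ((b * 3 + 2) + (1 + ((e * 3 + 2) + (1 +
    ((⌊c * a⌋₊ * 3 + 2) + (1 + (1 + (1 + (1 + (1 + (1 + (1 + (1 + (1 + (1 + T))))))))))))))))) ?_
    (fun _ _ h => h) (fun _ _ h => h) (le_of_eq (by rw [setupTime]; ring))
  refine Spec.logProg (n := I.n) (y := I.n) a (by norm_num) (by decide) hn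
    (fun reg cpx _ => hnv _ _)
    (fun m => by rw [hI.n_eq]; exact Nat.pow_lt_pow_iff_right (by norm_num))
    (by rw [← hI.n_eq]; omega) (hlogU a le_rfl) p8 ?_
  refine Spec.letR (by decide +kernel) (by rw [p9]; omega) (fun reg cpx h => ?_) ?_
  · simp [WExp.val, h.1 8, hnv, p8, p9, hdiv a le_rfl]
  refine Spec.logProg (n := I.n) (y := I.k₁) b (by norm_num) (by decide) hn (fun reg cpx h => ?_)
    (fun m => by rw [hI.k₁_eq]; exact Nat.pow_lt_pow_iff_right (by norm_num))
    ((hpow b hb.le).trans_lt (by omega)) (hlogU b hb.le) p10 ?_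
  · simp [h 1, hH.h1]
  refine Spec.letR (by decide +kernel) (by rw [p11]; omega) (fun reg cpx h => ?_) ?_
  · simp [WExp.val, h.1 10, hnv, p10, p11, hdiv b hb.le]
  refine Spec.logProg (n := I.n) (y := I.k₀) e (by norm_num) (by decide) hn (fun reg cpx h => ?_)
    (fun m => by rw [hI.e_eq, Nat.lt_clog_iff_pow_lt (by norm_num)])
    ((hpow e (by omega)).trans_lt (by omega)) (hlogU e (by omega)) p12 ?_
  · simp [h 0, hH.h0]
  refine Spec.letR (by decide +kernel) (by rw [hH.h13]; omega) (fun reg cpx h => ?_) ?_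
  · simp [WExp.val, h.1 12, hnv, p12, hH.h13, hmod e (by omega), hI.k_eq]
  refine Spec.floorProg (a := a) (c := c) (by linarith [hI.c_ge]) (by norm_num) (by decide)
    (fun reg cpx h => ?_) hc (by omega) p14 ?_
  · simp [h 9, p9]
  refine Spec.letR (by decide +kernel) (by rw [hH.h15]; omega) (fun reg cpx h => ?_) ?_
  · simp [WExp.val, h.1 9, h.1 14, p9, p14, hH.h15, hlam₁]
  refine Spec.letR (by decide +kernel) (by rw [hH.h16]; omega) (fun reg cpx h => ?_) ?_
  · simp [WExp.val, h.1 9, h.1 14, h.1 11, p9, p11, p14, hH.h16, hlam₂]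
  refine Spec.letR (by decide +kernel) (by rw [hH.h17]; omega) (fun reg cpx h => ?_) ?_
  · simp [WExp.val, h.1 1, hnv, hH.h1, hH.h17, Inst.N]
  refine Spec.letR (by decide +kernel) (by rw [hH.h18, Inst.H₁]; omega) (fun reg cpx h => ?_) ?_
  · simp [WExp.val, h.1 15, hH.h15, hH.h18, Inst.H₁]
  refine Spec.letR (by decide +kernel) (by rw [hH.h19, Inst.len₁]; omega)
    (fun reg cpx h => ?_) ?_
  · simp [WExp.val, h.1 18, h.1 17, hH.h17, hH.h18, hH.h19, Inst.len₁]
  refine Spec.letR (by decide +kernel) (by rw [hH.h20]; rw [Inst.fb] at hfbU; omega)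
    (fun reg cpx h => ?_) ?_
  · simp [WExp.val, twoK₁E, h.1 0, h.1 1, hnv, hH.h0, hH.h1, hH.h20, Inst.zb, Inst.q]
  refine Spec.letR (by decide +kernel) (by rwa [hH.h21]) (fun reg cpx h => ?_) ?_
  · simp [WExp.val, h.1 20, h.1 1, h.1 13, hH.h1, hH.h13, hH.h20, hH.h21, Inst.fb]
  refine Spec.letR (by decide +kernel) ?_ (fun reg cpx h => ?_) ?_
  · have := hI.k₁_pos
    rw [Inst.fb, Inst.zb] at hfbU
    have : I.q ≤ 2 * I.k₁ * I.q := Nat.le_mul_of_pos_left _ (by omega)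
    rw [hH.h22]
    omega
  · simp [WExp.val, h.1 0, hH.h0, hH.h22, Inst.q]
  refine Spec.letR (by decide +kernel) (by rw [hH.h23, Inst.H₂]; omega) (fun reg cpx h => ?_) ?_
  · simp [WExp.val, h.1 16, hH.h16, hH.h23, Inst.H₂]
  refine Spec.letR (by decide +kernel) (by rw [hH.h24, Inst.len₂]; omega)
    (fun reg cpx h => ?_) ?_
  · simp [WExp.val, twoKE, h.1 23, h.1 13, hH.h13, hH.h23, hH.h24, Inst.len₂]
  exact hp hH

/-- The complete program; at the end the address of the output is written to the first word.  The
expressions say where the number of active blocks, the list of these, and `σ`, `Δ` are found. -/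
def mainProg (len lb σ Δ flag npass : WExp) : Prog :=
  .seq (.seq (setR 0 (.get (.lit 1))) (.seq (setR 1 (.get (.lit 2))) (.seq (setR 2 len)
    (.seq (setR 3 lb) (.seq (setR 4 σ) (.seq (setR 5 Δ) (.seq (setR 6 flag)
    (.seq (setR 7 npass) (setupProg passProg)))))))))
    (.setW (.lit 0) (.add nE (.lit 1)))

/-- An entry of a table that is filled row by row, with contributions at the columns `f t`. -/
lemma sum_sum_single (base q M T : ℕ) (v : ℕ → ℕ → ℂ) (f : ℕ → ℕ) (hf : ∀ t < T, f t < q)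
    {r j : ℕ} (hr : r < M) (hj : j < q) :
    (∑ r' ∈ Finset.range M, ∑ t ∈ Finset.range T,
      (Pi.single (base + r' * q + f t) (v r' t) : ℕ → ℂ)) (base + r * q + j) =
    ∑ t ∈ Finset.range T, if f t = j then v r t else 0 := by
  simp only [Finset.sum_apply]
  rw [Finset.sum_eq_single r]
  · refine Finset.sum_congr rfl fun t _ => ?_
    rw [Pi.single_apply]
    congr 1
    exact propext ⟨fun h => by omega, fun h => by omega⟩
  · intro r' _ hr'
    refine Finset.sum_eq_zero fun t ht => ?_
    have := hf t (Finset.mem_range.1 ht)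
    rw [Pi.single_apply, if_neg]
    intro h
    rcases Nat.lt_or_gt_of_ne hr' with hlt | hlt
    · have := Nat.mul_le_mul_right q hlt
      rw [Nat.succ_mul] at this; omega
    · have := Nat.mul_le_mul_right q hlt
      rw [Nat.succ_mul] at this; omega
  · intro h; exact absurd (Finset.mem_range.2 hr) h

lemma passCon_apply {I : Inst} (Δ' : ℕ) {r j : ℕ} (hr : r < 2 * I.k₁) (hj : j < I.q) :
    I.passCon Δ' (I.n + 1 + r * I.q + j) = (I.sel Δ' j : ℂ) * I.outVal Δ' r j := by
  have h := sum_sum_single (I.n + 1) I.q (2 * I.k₁) I.q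
    (fun r j => (I.sel Δ' j : ℂ) * I.outVal Δ' r j) (fun t => t) (fun t ht => ht) hr hj
  rw [Finset.sum_ite_eq' _ j, if_pos (Finset.mem_range.2 hj)] at h
  exact h

/-- The output of the complete program is the sum over all lifts of the time index, of which
`Inst.sel` selects some. -/
lemma mainProg_spec {I : Inst} {E : Env} {lb : ℕ} {c : ℝ} {a b e B : ℕ}
    (hp : I.Params c a b e B) (hI : I.Good lb E) (hB : 1000 * B ^ 2 ≤ E.U)
    {len lbE σ Δ flag npass : WExp}
    (hw : len.wt ≤ 100 ∧ lbE.wt ≤ 100 ∧ σ.wt ≤ 100 ∧ Δ.wt ≤ 100 ∧ flag.wt ≤ 100 ∧ npass.wt ≤ 100)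
    (h0 : E.ini 1 = I.k₀) (h1 : E.ini 2 = I.k₁)
    (h2 : ∀ reg cpx, len.val (memOf E.ini reg cpx) = I.len)
    (h3 : ∀ reg cpx, lbE.val (memOf E.ini reg cpx) = lb)
    (h4 : ∀ reg cpx, σ.val (memOf E.ini reg cpx) = I.σ)
    (h5 : ∀ reg cpx, Δ.val (memOf E.ini reg cpx) = I.Δ)
    (h6 : ∀ reg cpx, flag.val (memOf E.ini reg cpx) = I.flag)
    (h7 : ∀ reg cpx, npass.val (memOf E.ini reg cpx) = I.npass)
    (hlU : lb ≤ E.U) (hσU : I.σ ≤ E.U) (hΔU : I.Δ ≤ E.U) (hfU : I.flag ≤ E.U)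
    {c₀ : ℕ → ℂ} (hc₀ : c₀ 0 = (c : ℂ)) (hX : ∀ x < I.n, c₀ (1 + x) = I.X x)
    (hzero : ∀ x, I.n < x → c₀ x = 0) :
    ∃ s t, Exec E.W (mainProg len lbE σ Δ flag npass) (memOf E.ini (fun _ => 0) c₀) s t ∧
      t ≤ wtBound * (setupTime a b e ⌊c * a⌋₊ + I.passTime (b + 1) (e + 1) + 9) ∧
      ∀ r < 2 * I.k₁, ∀ j < I.q, s.cpx (s.word 0 + r * I.q + j) =
        ∑ m ∈ Finset.range I.npass, (I.sel (I.Δ + m * (I.n / I.k₁)) j : ℂ) *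
          I.outVal (I.Δ + m * (I.n / I.k₁)) r j := by
  obtain ⟨hw2, hw3, hw4, hw5, hw6, hw7⟩ := hw
  have hpass : ∀ P, Holds I lb P → Spec E (At 25 P (fun cpx => cpx = c₀)) passProg
      (I.passTime (b + 1) (e + 1)) (fun _ => Ref I.zb (fun _ => True)
        (c₀ + ∑ m ∈ Finset.range I.npass, I.passCon (I.Δ + m * (I.n / I.k₁)))) := by
    intro P hP reg cpx hb h
    have hreg := hP.of_agree (by norm_num) h.1
    refine (passProg_spec (P := reg) hI hreg (b := b + 1) (e := e + 1)
      (by rw [hp.k₁_eq, pow_succ']) (by rw [hp.k_eq, pow_succ']) hX).mono (fun _ _ h => h)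
      (fun _ _ h => h.2) le_rfl reg cpx hb ⟨fun _ _ => rfl, fun a _ => by rw [h.2], trivial⟩
  have hmem : ∀ reg cpx i, i < 10 → (memOf E.ini reg cpx).word i = E.ini i := fun reg cpx i hi =>
    memOf_word_lt _ _ (by omega)
  have hspec := Spec.letR (E := E) (l := 0) (P := I.regs lb a b e (⌊c * a⌋₊ + 1))
    (Φ := fun cpx => cpx = c₀) (e := .get (.lit 1)) (by decide +kernel)
    (h0 ▸ E.ini_le 1 : I.k₀ ≤ E.U)
    (fun reg cpx _ => by simp [WExp.val, hmem, h0, Inst.regs])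
    (Spec.letR (e := .get (.lit 2)) (by decide +kernel) (h1 ▸ E.ini_le 2 : I.k₁ ≤ E.U)
    (fun reg cpx _ => by simp [WExp.val, hmem, h1, Inst.regs])
    (Spec.letR (e := len) (by rw [wtBound]; omega) hI.lenU (fun reg cpx _ => h2 _ _)
    (Spec.letR (e := lbE) (by rw [wtBound]; omega) hlU (fun reg cpx _ => h3 _ _)
    (Spec.letR (e := σ) (by rw [wtBound]; omega) hσU (fun reg cpx _ => h4 _ _)
    (Spec.letR (e := Δ) (by rw [wtBound]; omega) hΔU (fun reg cpx _ => h5 _ _)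
    (Spec.letR (e := flag) (by rw [wtBound]; omega) hfU (fun reg cpx _ => h6 _ _)
    (Spec.letR (e := npass) (by rw [wtBound]; omega) hI.npassU (fun reg cpx _ => h7 _ _)
    (setupProg_spec hp hB hI.ini0 (fun cpx h => by rw [h, hc₀]) rfl (hpass _)))))))))
  obtain ⟨reg, cpx, t, hex, ht, hb, hpost⟩ := hspec (fun _ => 0) c₀ (fun _ => Nat.zero_le _)
    ⟨fun r hr => by omega, rfl⟩
  have hs := E.memOf_word_le cpx hb
  have hfin := Exec.setW (W := E.W) (.lit 0) (.add nE (.lit 1)) (memOf E.ini reg cpx)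
    (WExp.fits E.two_le _ hs _ (E.pow_wt_le (by decide +kernel)))
    (WExp.fits E.two_le _ hs _ (E.pow_wt_le (by decide +kernel)))
  refine ⟨_, _, Exec.seq _ _ _ _ _ _ _ hex hfin, ?_, ?_⟩
  · have hcost : (WExp.lit 0).cost + (WExp.add nE (.lit 1)).cost + 1 ≤ wtBound := by
      decide +kernel
    calc _ ≤ wtBound * (1 + (1 + (1 + (1 + (1 + (1 + (1 + (1 + (setupTime a b e ⌊c * a⌋₊ +
        I.passTime (b + 1) (e + 1)))))))))) + wtBound := Nat.add_le_add ht hcost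
      _ = _ := by ring
  · intro r hr j hj
    have hlt : I.n + 1 + r * I.q + j < I.zb := by
      have : (r + 1) * I.q ≤ 2 * I.k₁ * I.q := Nat.mul_le_mul_right _ hr
      rw [add_mul] at this
      rw [Inst.zb]; omega
    have hval : (WExp.add nE (.lit 1)).val (memOf E.ini reg cpx) = I.n + 1 := by
      simp [nE, WExp.val, hmem, hI.ini0]
    rw [hval]
    simp only [WExp.val, Function.update_self, memOf_cpx]
    rw [hpost.1 _ hlt, Pi.add_apply, hzero _ (by omega), zero_add, Finset.sum_apply]
    exact Finset.sum_congr rfl fun m _ => passCon_apply _ hr hj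

/-! ### What the common part computes -/

lemma sum_range_natCast {m : ℕ} [NeZero m] (g : ZMod m → ℂ) :
    ∑ i ∈ Finset.range m, g (i : ZMod m) = ∑ x, g x := by
  refine Finset.sum_bij' (fun i _ => (i : ZMod m)) (fun x _ => x.val) (fun _ _ => Finset.mem_univ _)
    (fun x _ => Finset.mem_range.2 x.val_lt) (fun i hi => ?_) (fun x _ => ?_) (fun _ _ => rfl)
  · exact ZMod.val_cast_of_lt (Finset.mem_range.1 hi)
  · exact ZMod.natCast_zmod_val x

lemma sum_range_mul (A B : ℕ) (h : ℕ → ℂ) :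
    ∑ b ∈ Finset.range A, ∑ l ∈ Finset.range B, h (b + A * l) =
      ∑ x ∈ Finset.range (A * B), h x := by
  rw [Finset.sum_comm]
  induction B with
  | zero => simp
  | succ B ih =>
    rw [Finset.sum_range_succ, ih, Nat.mul_succ, Finset.sum_range_add]
    congr 1
    exact Finset.sum_congr rfl fun x _ => by rw [add_comm]

/-- A window of `2 H + 1` residues around `q`, or all residues if there are fewer, contains every
residue within `H` of `q`. -/
lemma exists_mem_window {q f M H : ℕ} (hM : 0 < M) (hf : f < M) {u m : ℤ} (hu : |u| ≤ H)
    (h : (f : ℤ) = q + u + M * m) :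
    ∃ t < (2 * H + 1) - ((2 * H + 1) - M), (q + t + H * (M - 1)) % M = f := by
  have hM' : (0 : ℤ) < M := by exact_mod_cast hM
  obtain ⟨hu1, hu2⟩ := abs_le.1 hu
  have h0 := Int.emod_nonneg (u + H) hM'.ne'
  have h1 := Int.emod_lt_of_pos (u + H) hM'
  have h2 : (u + H) % M ≤ u + H := by
    have := Int.emod_add_mul_ediv (u + H) M
    have : 0 ≤ (M : ℤ) * ((u + H) / M) :=
      mul_nonneg hM'.le (Int.ediv_nonneg (by omega) hM'.le)
    omega
  refine ⟨((u + H) % M).toNat, by omega, ?_⟩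
  have hcast : (((M - 1 : ℕ) : ℤ)) = M - 1 := by omega
  have : ((q + ((u + H) % M).toNat + H * (M - 1) : ℕ) : ℤ) % M = f := by
    push_cast
    rw [Int.toNat_of_nonneg h0, hcast]
    have : ((q : ℤ) + (u + H) % M + H * (M - 1)) = f + M * (H - m - (u + H) / M) := by
      have := Int.emod_add_mul_ediv (u + H) M
      rw [h]; linear_combination this
    rw [this, Int.add_mul_emod_self_left]
    exact Int.emod_eq_of_lt (by omega) (by omega)
  exact_mod_cast this

lemma window_injOn {q M H : ℕ} :
    Set.InjOn (fun t => (q + t + H * (M - 1)) % M)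
      (Finset.range ((2 * H + 1) - ((2 * H + 1) - M)) : Set ℕ) := by
  intro s hs t ht hst
  simp only [Finset.coe_range, Set.mem_Iio] at hs ht
  have h1 : (q + s + H * (M - 1)) ≡ (q + t + H * (M - 1)) [MOD M] := hst
  have h2 : s ≡ t [MOD M] := (Nat.ModEq.add_left_cancel' q (Nat.ModEq.add_right_cancel' _ h1))
  exact Nat.ModEq.eq_of_lt_of_lt h2 (by omega) (by omega)

/-- A sum over a window that contains the support is the sum over all residues. -/
lemma sum_window {q M H : ℕ} (hM : 0 < M) (v : ℕ → ℂ)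
    (hv : ∀ f < M, v f ≠ 0 → ∃ t < (2 * H + 1) - ((2 * H + 1) - M),
      (q + t + H * (M - 1)) % M = f) :
    ∑ t ∈ Finset.range ((2 * H + 1) - ((2 * H + 1) - M)), v ((q + t + H * (M - 1)) % M) =
      ∑ f ∈ Finset.range M, v f := by
  rw [← Finset.sum_image (f := v) (window_injOn (q := q) (M := M) (H := H))]
  refine Finset.sum_subset (fun x hx => ?_) fun f hf hf' => ?_
  · obtain ⟨t, _, rfl⟩ := Finset.mem_image.1 hx
    exact Finset.mem_range.2 (Nat.mod_lt _ hM)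
  · by_contra h0
    obtain ⟨t, ht, h⟩ := hv f (Finset.mem_range.1 hf) h0
    exact hf' (Finset.mem_image.2 ⟨t, Finset.mem_range.2 ht, h⟩)

/-- The support of the filter, as a statement about integers. -/
lemma filtVal_support {N w lam x g : ℕ} (hN : 0 < N) (hg : g ≤ N)
    (h : filtVal N w lam ((x + N - g) % N) ≠ 0) :
    ∃ s m : ℤ, |s| ≤ 32 * (N / w : ℕ) * lam ∧ (x : ℤ) = g + s + N * m := by
  set y := (x + N - g) % N with hy
  have hyN : y < N := Nat.mod_lt _ hN
  have hd : y - (y - (N - y)) ≤ 32 * (N / w) * lam := by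
    by_contra hlt
    apply h
    have : 1 - (y - (y - (N - y)) - 32 * (N / w) * lam) = 0 := by omega
    simp [filtVal, this]
  have hdiv : ((x + N - g : ℕ) : ℤ) = y + N * ((x + N - g) / N : ℕ) := by
    rw [hy]; exact_mod_cast (Nat.mod_add_div _ _).symm
  have hx : (x : ℤ) = g + y + N * (((x + N - g) / N : ℕ) - 1) := by
    have : ((x + N - g : ℕ) : ℤ) = x + N - g := by omega
    rw [this] at hdiv; linear_combination hdiv
  have hcast : ((32 * (N / w) * lam : ℕ) : ℤ) = 32 * (N / w : ℕ) * lam := by push_cast; ring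
  rcases le_total y (N - y) with hle | hle
  · refine ⟨y, _, ?_, hx⟩
    rw [← hcast, abs_of_nonneg (by positivity)]
    exact_mod_cast (by omega)
  · refine ⟨y - N, ((x + N - g) / N : ℕ), ?_, by rw [hx]; ring⟩
    rw [← hcast, abs_of_nonpos (by omega)]
    omega

namespace Inst
variable (I : Inst)

lemma term_eq_zero_of_red {Δ' J f r i : ℕ} (h : I.red J f r = 0) : I.term Δ' J f r i = 0 := by
  simp [term, h]

end Inst

section
variable {I : Inst} {c : ℝ} {a b e B : ℕ} (hp : I.Params c a b e B)
include hp

lemma Inst.Params.two_k_mul_D : 2 * I.k * I.D = I.N := by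
  rw [Inst.D, Nat.mul_div_cancel' _]
  have := hp.e_le
  have := hp.b_lt
  rw [hp.N_pow, hp.k_eq, ← pow_succ']
  exact Nat.pow_dvd_pow _ (by omega)

lemma Inst.Params.half_mul_N : I.k₁ / 2 * I.N = I.n := by
  have := hp.b_pos
  have := hp.b_lt
  have h1 : I.k₁ / 2 = 2 ^ (b - 1) := by
    rw [hp.k₁_eq, show b = b - 1 + 1 by omega, pow_succ, Nat.mul_div_cancel _ (by norm_num)]
    simp
  rw [h1, hp.N_pow, hp.n_eq, ← pow_add]
  congr 1; omega

lemma Inst.Params.two_half : 2 * (I.k₁ / 2) = I.k₁ := by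
  have := hp.b_pos
  refine Nat.mul_div_cancel' ?_
  rw [hp.k₁_eq]
  exact dvd_pow_self _ (by omega)

lemma Inst.Params.N_pos : 0 < I.N := by rw [hp.N_pow]; positivity

lemma Inst.Params.D_pos : 0 < I.D :=
  Nat.pos_of_ne_zero fun h => by
    have := hp.two_k_mul_D; rw [h, mul_zero] at this; have := hp.N_pos; omega

/-- Every index to which a frequency contributes occurs exactly once in its window. -/
lemma sum_idx {g i : ℕ} (hg : g < I.N) {v : ℂ} (hi : i < 2 * I.k)
    (hv : filtVal I.N I.k I.lam₂ ((I.D * i + I.N - g) % I.N) = 0 → v = 0) :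
    (∑ t ∈ Finset.range I.len₂, if I.idx g t = i then v else 0) = v := by
  have h := sum_window (q := g / I.D) (M := 2 * I.k) (H := I.H₂) (by omega)
    (fun f => if f = i then v else 0) ?_
  · rw [Finset.sum_ite_eq' _ i, if_pos (Finset.mem_range.2 hi)] at h
    exact h
  intro f hf hne
  have hfi : f = i := by by_contra h'; simp [h'] at hne
  subst hfi
  have hv0 : filtVal I.N I.k I.lam₂ ((I.D * f + I.N - g) % I.N) ≠ 0 := fun h' => by
    simp [hv h'] at hne
  obtain ⟨s, m, hs, hx⟩ := filtVal_support hp.N_pos hg.le hv0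
  have hD := hp.D_pos
  have hD' : (0 : ℤ) < I.D := by exact_mod_cast hD
  have hNk : I.N / I.k = 2 * I.D := by
    rw [← hp.two_k_mul_D, show 2 * I.k * I.D = I.k * (2 * I.D) by ring,
      Nat.mul_div_cancel_left _ hp.k_pos]
  have hN : (I.N : ℤ) = 2 * I.k * I.D := by exact_mod_cast hp.two_k_mul_D.symm
  have hgD : (g : ℤ) = g % I.D + I.D * (g / I.D : ℕ) := by
    exact_mod_cast (Nat.mod_add_div g I.D).symm
  have hρ : (g : ℤ) % I.D < I.D := Int.emod_lt_of_pos _ hD'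
  have hρ0 : 0 ≤ (g : ℤ) % I.D := Int.emod_nonneg _ hD'.ne'
  set u : ℤ := f - (g / I.D : ℕ) - 2 * I.k * m with hu
  have hmul : (I.D : ℤ) * u = s + g % I.D := by
    push_cast at hx
    rw [hN] at hx
    rw [hu]; linear_combination hx + hgD
  refine exists_mem_window (by omega) hf (u := u) (m := m) ?_ (by rw [hu]; push_cast; ring)
  rw [hNk] at hs
  push_cast at hs
  obtain ⟨hs1, hs2⟩ := abs_le.1 hs
  have h64 : (I.H₂ : ℤ) = 64 * I.lam₂ + 2 := by rw [Inst.H₂]; push_cast; ring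
  rw [abs_le, h64]
  constructor
  · by_contra hlt
    have : u ≤ -(64 * I.lam₂ + 3) := by omega
    have := mul_le_mul_of_nonneg_left this hD'.le
    nlinarith
  · by_contra hlt
    have : 64 * (I.lam₂ : ℤ) + 3 ≤ u := by omega
    have := mul_le_mul_of_nonneg_left this hD'.le
    nlinarith

/-- Every frequency at which a block contributes to a reduced spectrum occurs in its window. -/
lemma exists_freq {J f r : ℕ} (hf : f < I.N) (h : I.red J f r ≠ 0) :
    ∃ t < I.len₁, I.freq J t = f := by
  obtain ⟨b, _, hb⟩ := Finset.exists_ne_zero_of_sum_ne_zero h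
  have hali : I.ali J f b ≠ 0 := fun h' => by simp [h'] at hb
  have hn := hp.n_pos
  have hk₁ := hp.k₁_pos
  have hxi : I.xi J b < I.n := Nat.mod_lt _ hn
  have hfil : filtVal I.n (I.n / I.k₁) I.lam₁ ((I.k₁ / 2 * f + I.n - I.xi J b) % I.n) ≠ 0 :=
    fun h' => by simp [Inst.ali, h'] at hali
  have hpos : I.pos J b + 1 ≤ I.k₁ := by
    by_contra hlt
    have : 1 - (I.pos J b + 1 - I.k₁) = 0 := by omega
    simp [Inst.ali, this] at hali
  obtain ⟨s, m, hs, hx⟩ := filtVal_support hn hxi.le hfil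
  have hdiv : I.n / (I.n / I.k₁) = I.k₁ := Nat.div_div_self hp.k₁_dvd hn.ne'
  have hhalf := hp.two_half
  set D := I.k₁ / 2 with hDdef
  have hD : 0 < D := by omega
  have hD' : (0 : ℤ) < D := by exact_mod_cast hD
  have hN : (I.n : ℤ) = D * I.N := by exact_mod_cast hp.half_mul_N.symm
  have hxi' : (I.xi J b : ℤ) + I.n * ((J * I.k₁ + I.n - D + 1 + I.pos J b) / I.n : ℕ) =
      J * (2 * D) + I.n - D + 1 + I.pos J b := by
    have h1 := Nat.mod_add_div (J * I.k₁ + I.n - D + 1 + I.pos J b) I.n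
    have h2 : D ≤ I.n := by have := hp.two_k₁_le; omega
    have h3 : ((J * I.k₁ + I.n - D + 1 + I.pos J b : ℕ) : ℤ) =
        J * (2 * D) + I.n - D + 1 + I.pos J b := by
      rw [show J * I.k₁ = J * (2 * D) by rw [hhalf]]
      push_cast [Nat.cast_sub (show D ≤ J * (2 * D) + I.n by omega)]
      ring
    rw [← h3]
    exact_mod_cast h1
  set w : ℤ := (((J * I.k₁ + I.n - D + 1 + I.pos J b) / I.n : ℕ) : ℤ)
  -- the distance from the center `2 J` of the window, which `k₁ / 2` scales to frequencies of `X`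
  set u : ℤ := f - 2 * J - I.N * (m + 1 - w) with hu
  have hmul : (D : ℤ) * u = s + (1 + I.pos J b - D) := by
    push_cast at hx
    rw [hN] at hx hxi'
    rw [hu]; linear_combination hx + hxi'
  refine exists_mem_window (q := 2 * J) hp.N_pos hf (u := u) (m := m + 1 - w) ?_
    (by rw [hu]; push_cast; ring)
  rw [hdiv] at hs
  obtain ⟨hs1, hs2⟩ := abs_le.1 hs
  have hk : (I.k₁ : ℤ) = 2 * D := by exact_mod_cast hhalf.symm
  rw [hk] at hs1 hs2
  have h64 : (I.H₁ : ℤ) = 64 * I.lam₁ + 2 := by rw [Inst.H₁]; push_cast; ring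
  have hpos' : (I.pos J b : ℤ) + 1 ≤ 2 * D := by rw [← hk]; exact_mod_cast hpos
  have hpos0 : (0 : ℤ) ≤ I.pos J b := by positivity
  rw [abs_le, h64]
  constructor
  · by_contra hlt
    have : u ≤ -(64 * I.lam₁ + 3) := by omega
    have := mul_le_mul_of_nonneg_left this hD'.le
    nlinarith
  · by_contra hlt
    have : 64 * (I.lam₁ : ℤ) + 3 ≤ u := by omega
    have := mul_le_mul_of_nonneg_left this hD'.le
    nlinarith

/-- The output as a full sum over frequencies and blocks: the restriction to windows loses
nothing. -/
lemma outVal_eq (Δ' j : ℕ) {r : ℕ} (hr : r < 2 * I.k₁) :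
    I.outVal Δ' r j = ∑ i ∈ Finset.range (2 * I.k), (I.D : ℂ) *
      (∑ f ∈ Finset.range I.N, ((∑ J ∈ Finset.range I.len, I.red (I.blk J) f r) *
        rootPow I.N ((f * Δ' : ℕ) : ℤ)) *
        filtVal I.N I.k I.lam₂ ((I.D * i + I.N - I.perm f) % I.N)) *
      rootPow (2 * I.k) (((j + 2 * I.k - I.k₀ / 2) % (2 * I.k) : ℕ) * i) := by
  rw [Inst.outVal]
  refine Finset.sum_congr rfl fun i hi => ?_
  have hi' := Finset.mem_range.1 hi
  congr 1
  have hk := hp.k_pos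
  have hperm : ∀ f, I.perm f < I.N := fun f => Nat.mod_lt _ hp.N_pos
  have hcon : ∀ J f, I.freqCon Δ' J f (I.zb + r * (2 * I.k) + i) = I.term Δ' J f r i := by
    intro J f
    rw [Inst.freqCon, sum_sum_single I.zb (2 * I.k) (2 * I.k₁) I.len₂
      (fun r t => I.term Δ' J f r (I.idx (I.perm f) t)) (I.idx (I.perm f))
      (fun t _ => Nat.mod_lt _ (by omega)) hr hi',
      ← sum_idx hp (hperm f) hi' (v := I.term Δ' J f r i)
        (fun h => by rw [Inst.term, h, mul_zero])]
    refine Finset.sum_congr rfl fun t _ => ?_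
    split_ifs with h
    · rw [h]
    · rfl
  have hwin : ∀ J, ∑ t ∈ Finset.range I.len₁, I.term Δ' J (I.freq J t) r i =
      ∑ f ∈ Finset.range I.N, I.term Δ' J f r i := fun J =>
    sum_window (q := 2 * J) (H := I.H₁) hp.N_pos (fun f => I.term Δ' J f r i) fun f hf hne =>
      exists_freq hp hf fun h => hne (I.term_eq_zero_of_red h)
  simp only [Inst.tableCon, Finset.sum_apply, hcon, hwin]
  rw [Finset.sum_comm, Finset.mul_sum]
  refine Finset.sum_congr rfl fun f _ => ?_
  simp only [Inst.term]
  rw [← Finset.sum_mul, ← Finset.mul_sum, ← Finset.sum_mul, mul_assoc]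

end

/-! ### The reduced spectra as sums over blocks -/

lemma sum_range_eq_sum_map {α : Type*} (L : List α) (F : ℕ → ℂ) (G : α → ℂ)
    (h : ∀ j (hj : j < L.length), F j = G L[j]) :
    ∑ j ∈ Finset.range L.length, F j = (L.map G).sum := by
  induction L generalizing F with
  | nil => simp
  | cons x L ih =>
    rw [List.length_cons, Finset.sum_range_succ', List.map_cons, List.sum_cons, add_comm,
      ih (fun j => F (j + 1)) fun j hj => h (j + 1) (by simpa using hj), h 0 (by simp)]
    rfl

lemma rootPow_natCast_val {n m : ℕ} [NeZero n] (hm : m ∣ n) (r x : ℕ) :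
    rootPow m (r * (x : ZMod n).val) = rootPow m (r * x) := by
  apply rootPow_congr
  apply Int.ModEq.mul_left
  rw [ZMod.val_natCast, Int.natCast_mod]
  exact (Int.mod_modEq _ _).of_dvd (by exact_mod_cast hm)

/-- The reduced spectrum is a sub-sampled convolution. -/
lemma reducedSpectrum_eq {n k₁ : ℕ} [NeZero n] (hk : 2 * k₁ ∣ n) (Xh Gh : ZMod n → ℂ) (r : ℕ)
    (f : ZMod (2 * n / k₁)) :
    reducedSpectrum k₁ Xh Gh r f = ((k₁ / 2 : ℕ) : ℂ) * ∑ ξ : ZMod n,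
      Xh ξ * Gh (((k₁ / 2 * f.val : ℕ) : ZMod n) - ξ) * rootPow (2 * k₁) (r * ξ.val) := by
  obtain ⟨q, hq⟩ := hk
  have hpos : 0 < 2 * k₁ := Nat.pos_of_ne_zero fun h => NeZero.ne n (by rw [hq, h, zero_mul])
  have hdiv : n / (2 * k₁) = q := by rw [hq, Nat.mul_div_cancel_left _ hpos]
  have h := sum_range_mul (2 * k₁) q (fun x => Xh (x : ZMod n) *
    Gh (((k₁ / 2 * f.val : ℕ) : ZMod n) - (x : ZMod n)) *
      rootPow (2 * k₁) (r * (x : ZMod n).val))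
  rw [← hq, sum_range_natCast (fun ξ : ZMod n => Xh ξ *
    Gh (((k₁ / 2 * f.val : ℕ) : ZMod n) - ξ) * rootPow (2 * k₁) (r * ξ.val))] at h
  rw [← h, reducedSpectrum, Finset.mul_sum]
  refine Finset.sum_congr rfl fun b _ => ?_
  rw [aliased, hdiv, mul_assoc, Finset.sum_mul]
  congr 1
  refine Finset.sum_congr rfl fun l _ => ?_
  congr 1
  rw [rootPow_natCast_val ⟨q, hq⟩]
  apply rootPow_congr
  refine (Int.modEq_iff_dvd).2 ⟨r * l, ?_⟩
  push_cast; ring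

section
variable {I : Inst} {c : ℝ} {a b e B : ℕ} (hp : I.Params c a b e B)
include hp

lemma Inst.Params.two_k₁_dvd : 2 * I.k₁ ∣ I.n := by
  rw [hp.n_eq, hp.k₁_eq, ← pow_succ']
  exact Nat.pow_dvd_pow _ hp.b_lt

variable [NeZero I.n]

/-- The contribution of a block is a sum over the frequencies of the block.  In the aliased vector,
each residue modulo `2 k₁` receives at most one frequency of a block of length `k₁`. -/
lemma red_eq {Xh : ZMod I.n → ℂ} (hX : ∀ x, I.X x = Xh (x : ZMod I.n)) (J f r : ℕ) :
    I.red J f r = ((I.k₁ / 2 : ℕ) : ℂ) * ∑ s ∈ Finset.range I.k₁,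
      (fun ξ : ZMod I.n => Xh ξ * filtVal I.n (I.n / I.k₁) I.lam₁
        (((I.k₁ / 2 * f : ℕ) : ZMod I.n) - ξ).val * rootPow (2 * I.k₁) (r * ξ.val))
        ((J * I.k₁ + I.n - I.k₁ / 2 + 1 + s : ℕ) : ZMod I.n) := by
  have hk₁ := hp.k₁_pos
  have hn := hp.n_pos
  set st := J * I.k₁ + I.n - I.k₁ / 2 + 1 with hst
  have hposlt : ∀ b, I.pos J b < 2 * I.k₁ := fun b => Nat.mod_lt _ (by omega)
  have hpos1 : ∀ b < 2 * I.k₁, (st + I.pos J b) % (2 * I.k₁) = b := by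
    intro b hb
    have h1 : st % (2 * I.k₁) < 2 * I.k₁ := Nat.mod_lt _ (by omega)
    rw [Inst.pos, ← hst, Nat.add_mod_mod]
    have h2 := Nat.mod_add_div st (2 * I.k₁)
    rw [show st + (b + (2 * I.k₁ - st % (2 * I.k₁))) = b + 2 * I.k₁ * (st / (2 * I.k₁) + 1) by
      rw [mul_add]; omega]
    rw [Nat.add_mul_mod_self_left, Nat.mod_eq_of_lt hb]
  have hpos2 : ∀ s < 2 * I.k₁, I.pos J ((st + s) % (2 * I.k₁)) = s := by
    intro s hs
    have h1 := hpos1 _ (Nat.mod_lt (st + s) (show 0 < 2 * I.k₁ by omega))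
    have h2 : I.pos J ((st + s) % (2 * I.k₁)) ≡ s [MOD 2 * I.k₁] :=
      Nat.ModEq.add_left_cancel' st h1
    exact Nat.ModEq.eq_of_lt_of_lt h2 (hposlt _) hs
  have hre : I.red J f r = ∑ s ∈ Finset.range (2 * I.k₁),
      ((1 - (s + 1 - I.k₁) : ℕ) : ℂ) * (((I.k₁ / 2 : ℕ) : ℂ) *
      (fun ξ : ZMod I.n => Xh ξ * filtVal I.n (I.n / I.k₁) I.lam₁
        (((I.k₁ / 2 * f : ℕ) : ZMod I.n) - ξ).val * rootPow (2 * I.k₁) (r * ξ.val))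
        ((st + s : ℕ) : ZMod I.n)) := by
    refine Finset.sum_bij' (fun b _ => I.pos J b) (fun s _ => (st + s) % (2 * I.k₁))
      (fun b _ => Finset.mem_range.2 (hposlt b))
      (fun s _ => Finset.mem_range.2 (Nat.mod_lt _ (by omega)))
      (fun b hb => hpos1 b (Finset.mem_range.1 hb)) (fun s hs => hpos2 s (Finset.mem_range.1 hs))
      fun b hb => ?_
    have hxi : I.xi J b = ((st + I.pos J b : ℕ) : ZMod I.n).val := by
      rw [ZMod.val_natCast, Inst.xi]
    have hxlt : I.xi J b < I.n := Nat.mod_lt _ hn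
    have hxc : ((I.xi J b : ℕ) : ZMod I.n) = ((st + I.pos J b : ℕ) : ZMod I.n) := by
      rw [hxi, ZMod.natCast_zmod_val]
    have hres : (I.k₁ / 2 * f + I.n - I.xi J b) % I.n =
        (((I.k₁ / 2 * f : ℕ) : ZMod I.n) - ((st + I.pos J b : ℕ) : ZMod I.n)).val := by
      rw [← ZMod.val_natCast, Nat.cast_sub (by omega), hxc]
      push_cast
      simp
    have hroot : rootPow (2 * I.k₁) (r * b) =
        rootPow (2 * I.k₁) (r * ((st + I.pos J b : ℕ) : ZMod I.n).val) := by
      rw [rootPow_natCast_val hp.two_k₁_dvd]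
      apply rootPow_congr
      apply Int.ModEq.mul_left
      have := hpos1 b (Finset.mem_range.1 hb)
      have h3 : (st + I.pos J b) % (2 * I.k₁) = b % (2 * I.k₁) := by
        rw [this, Nat.mod_eq_of_lt (Finset.mem_range.1 hb)]
      exact ((Int.natCast_modEq_iff).2 h3).symm
    simp only [Inst.ali, hX, hres, hroot, hxc]
    push_cast
    ring
  rw [hre, two_mul I.k₁, Finset.sum_range_add, Finset.sum_eq_zero (s := Finset.range I.k₁)
    (f := fun x => ((1 - (I.k₁ + x + 1 - I.k₁) : ℕ) : ℂ) * _), add_zero, Finset.mul_sum]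
  · refine Finset.sum_congr rfl fun s hs => ?_
    have : 1 - (s + 1 - I.k₁) = 1 := by have := Finset.mem_range.1 hs; omega
    rw [this, Nat.cast_one, one_mul]
  · intro x _
    have : 1 - (I.k₁ + x + 1 - I.k₁) = 0 := by omega
    rw [this, Nat.cast_zero, zero_mul]

/-- Summing over all frequencies is summing over the frequencies of the active blocks. -/
lemma sum_blocks (L : List (ZMod (I.n / I.k₁))) (hL : L.Nodup) (Xh : ZMod I.n → ℂ)
    (hmem : ∀ j, j ∈ L ↔ j ∈ activeBlocks I.k₁ Xh) (g : ZMod I.n → ℂ)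
    (hg : ∀ ξ, Xh ξ = 0 → g ξ = 0) :
    (L.map fun J => ∑ s ∈ Finset.range I.k₁,
      g ((J.val * I.k₁ + I.n - I.k₁ / 2 + 1 + s : ℕ) : ZMod I.n)).sum = ∑ ξ, g ξ := by
  have hk₁ := hp.k₁_pos
  have hn := hp.n_pos
  have h2 := hp.two_k₁_le
  have hhalf := hp.two_half
  have hm : 0 < I.n / I.k₁ := Nat.div_pos (by omega) hk₁
  have : NeZero (I.n / I.k₁) := ⟨hm.ne'⟩
  have hnm : I.k₁ * (I.n / I.k₁) = I.n := Nat.mul_div_cancel' hp.k₁_dvd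
  classical
  have hzero : ∀ J : ZMod (I.n / I.k₁), J ∉ L → ∑ s ∈ Finset.range I.k₁,
      g ((J.val * I.k₁ + I.n - I.k₁ / 2 + 1 + s : ℕ) : ZMod I.n) = 0 := by
    intro J hJ
    refine Finset.sum_eq_zero fun s hs => hg _ ?_
    have hs' := Finset.mem_range.1 hs
    by_contra hne
    refine hJ ((hmem J).2 ⟨_, ⟨J.valMinAbs * I.k₁ - (I.k₁ / 2 : ℕ) + 1 + s, ?_, ?_, ?_⟩, hne⟩)
    · have : (2 * ((I.k₁ / 2 : ℕ) : ℤ)) = I.k₁ := by exact_mod_cast hhalf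
      have h0 : (0 : ℤ) ≤ s := by positivity
      linear_combination this + 2 * h0
    · have h3 : (2 * ((I.k₁ / 2 : ℕ) : ℤ)) = I.k₁ := by exact_mod_cast hhalf
      have h4 : (s : ℤ) + 1 ≤ I.k₁ := by exact_mod_cast hs'
      linear_combination 2 * h4 - h3
    · have h5 : ((J.val : ℤ) : ZMod (I.n / I.k₁)) = ((J.valMinAbs : ℤ) : ZMod (I.n / I.k₁)) := by
        rw [ZMod.coe_valMinAbs]; simp
      obtain ⟨w, hw⟩ := (ZMod.intCast_eq_intCast_iff_dvd_sub _ _ _).1 h5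
      rw [Nat.cast_add, Nat.cast_add, Nat.cast_sub (by omega)]
      have h6 : (J.valMinAbs : ℤ) * I.k₁ = J.val * I.k₁ + I.n * w := by
        have : ((I.k₁ : ℤ)) * (I.n / I.k₁ : ℕ) = I.n := by exact_mod_cast hnm
        rw [← this]; linear_combination (I.k₁ : ℤ) * hw
      rw [h6]
      generalize I.k₁ / 2 = half
      push_cast
      simp
  rw [← List.sum_toFinset _ hL, Finset.sum_subset (Finset.subset_univ L.toFinset)
    (fun J _ hJ => hzero J (by simpa using hJ)), ← sum_range_natCast]
  calc _ = ∑ J ∈ Finset.range (I.n / I.k₁), ∑ s ∈ Finset.range I.k₁,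
        g ((s + I.k₁ * J : ℕ) + ((I.n - I.k₁ / 2 + 1 : ℕ) : ZMod I.n)) := by
        refine Finset.sum_congr rfl fun J hJ => Finset.sum_congr rfl fun s _ => ?_
        rw [ZMod.val_cast_of_lt (Finset.mem_range.1 hJ), ← Nat.cast_add]
        congr 2
        rw [mul_comm I.k₁ J]; omega
    _ = ∑ x ∈ Finset.range I.n, g ((x : ZMod I.n) + ((I.n - I.k₁ / 2 + 1 : ℕ) : ZMod I.n)) := by
        rw [Finset.sum_comm, sum_range_mul I.k₁ (I.n / I.k₁) (fun x => g ((x : ZMod I.n) +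
          ((I.n - I.k₁ / 2 + 1 : ℕ) : ZMod I.n))), hnm]
    _ = _ := by
        rw [sum_range_natCast (fun x => g (x + ((I.n - I.k₁ / 2 + 1 : ℕ) : ZMod I.n)))]
        exact Equiv.sum_comp (Equiv.addRight _) g

/-- Over all active blocks, the contributions add up to the reduced spectrum. -/
lemma sum_red {Xh : ZMod I.n → ℂ} (hX : ∀ x, I.X x = Xh (x : ZMod I.n))
    (L : List (ZMod (I.n / I.k₁))) (hL : L.Nodup)
    (hmem : ∀ j, j ∈ L ↔ j ∈ activeBlocks I.k₁ Xh) (hlen : I.len = L.length)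
    (hblk : ∀ j (h : j < L.length), I.blk j = (L[j]).val) {f : ℕ} (hf : f < I.N) (r : ℕ) :
    ∑ J ∈ Finset.range I.len, I.red (I.blk J) f r =
      reducedSpectrum I.k₁ Xh (fun x => filtVal I.n (I.n / I.k₁) I.lam₁ x.val) r
        (f : ZMod (2 * I.n / I.k₁)) := by
  rw [reducedSpectrum_eq hp.two_k₁_dvd, ZMod.val_cast_of_lt (by exact hf), hlen,
    ← sum_blocks hp L hL Xh hmem (fun ξ => Xh ξ * filtVal I.n (I.n / I.k₁) I.lam₁
      (((I.k₁ / 2 * f : ℕ) : ZMod I.n) - ξ).val * rootPow (2 * I.k₁) (r * ξ.val))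
      (fun ξ h => by rw [h]; ring), ← List.sum_map_mul_left]
  refine sum_range_eq_sum_map L _ _ fun j hj => ?_
  rw [hblk j hj, red_eq hp hX]

end

/-! ### Aliasing -/

/-- The signal of length `n` with a given spectrum. -/
def synth {n : ℕ} [NeZero n] (Yh : ZMod n → ℂ) (s : ZMod n) : ℂ :=
  ∑ f, Yh f * ZMod.stdAddChar (f * s)

lemma rootPow_eq_stdAddChar {n : ℕ} [NeZero n] (x : ℤ) :
    rootPow n x = ZMod.stdAddChar (x : ZMod n) := by
  rw [ZMod.stdAddChar_coe, rootPow]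

lemma rootPow_eq_one_iff {M : ℕ} (hM : 0 < M) (x : ℤ) : rootPow M x = 1 ↔ (M : ℤ) ∣ x := by
  have : NeZero M := ⟨hM.ne'⟩
  rw [rootPow_eq_stdAddChar, ← ZMod.intCast_zmod_eq_zero_iff_dvd,
    ← (ZMod.stdAddChar (N := M)).map_zero_eq_one, ZMod.injective_stdAddChar.eq_iff]

lemma rootPow_mul_natCast (M i : ℕ) (x : ℤ) : rootPow M (i * x) = rootPow M x ^ i := by
  rw [rootPow, rootPow, ← Complex.exp_nat_mul]
  congr 1; push_cast; ring

lemma sum_rootPow {M : ℕ} (hM : 0 < M) (x : ℤ) :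
    ∑ i ∈ Finset.range M, rootPow M (i * x) = if (M : ℤ) ∣ x then (M : ℂ) else 0 := by
  simp only [rootPow_mul_natCast]
  split_ifs with h
  · simp [(rootPow_eq_one_iff hM x).2 h]
  · have h1 : rootPow M x ≠ 1 := fun h' => h ((rootPow_eq_one_iff hM x).1 h')
    rw [geom_sum_eq h1, ← rootPow_mul_natCast, rootPow_self_mul, sub_self, zero_div]

lemma sum_stdAddChar {n : ℕ} [NeZero n] (x : ZMod n) :
    ∑ f : ZMod n, ZMod.stdAddChar (f * x) = if x = 0 then (n : ℂ) else 0 := by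
  have h := sum_rootPow (NeZero.pos n) (x.val : ℤ)
  rw [← sum_range_natCast]
  convert h using 2
  · rw [rootPow_eq_stdAddChar]; push_cast; simp
  · rw [← ZMod.intCast_zmod_eq_zero_iff_dvd]; simp

lemma normDFT_apply {n : ℕ} [NeZero n] (X : ZMod n → ℂ) (f : ZMod n) :
    normDFT X f = (n : ℂ)⁻¹ * ∑ s, ZMod.stdAddChar (-(s * f)) * X s := by
  rw [normDFT, ZMod.dft_apply]; simp

lemma synth_normDFT {n : ℕ} [NeZero n] (X : ZMod n → ℂ) : synth (normDFT X) = X := by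
  have hn : (n : ℂ) ≠ 0 := by exact_mod_cast NeZero.ne n
  funext t
  simp only [synth, normDFT_apply, Finset.mul_sum, Finset.sum_mul]
  rw [Finset.sum_comm]
  have : ∀ s, ∑ f : ZMod n, (n : ℂ)⁻¹ * (ZMod.stdAddChar (-(s * f)) * X s) *
      ZMod.stdAddChar (f * t) = if s = t then X s else 0 := by
    intro s
    have h := sum_stdAddChar (t - s)
    calc _ = (n : ℂ)⁻¹ * X s * ∑ f : ZMod n, ZMod.stdAddChar (f * (t - s)) := by
          rw [Finset.mul_sum]
          refine Finset.sum_congr rfl fun f _ => ?_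
          rw [show f * (t - s) = -(s * f) + f * t by ring, AddChar.map_add_eq_mul]
          ring
      _ = _ := by
          rw [h]
          by_cases hst : s = t
          · subst hst; simp; field_simp
          · rw [if_neg (sub_ne_zero.2 (Ne.symm hst)), if_neg hst, mul_zero]
  simp [this]

lemma normDFT_synth {n : ℕ} [NeZero n] (Y : ZMod n → ℂ) : normDFT (synth Y) = Y := by
  have hn : (n : ℂ) ≠ 0 := by exact_mod_cast NeZero.ne n
  funext f
  simp only [synth, normDFT_apply, Finset.mul_sum]
  rw [Finset.sum_comm]
  have : ∀ g, ∑ s : ZMod n, (n : ℂ)⁻¹ * (ZMod.stdAddChar (-(s * f)) *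
      (Y g * ZMod.stdAddChar (g * s))) = if g = f then Y g else 0 := by
    intro g
    have h := sum_stdAddChar (g - f)
    calc _ = (n : ℂ)⁻¹ * Y g * ∑ s : ZMod n, ZMod.stdAddChar (s * (g - f)) := by
          rw [Finset.mul_sum]
          refine Finset.sum_congr rfl fun s _ => ?_
          rw [show s * (g - f) = -(s * f) + g * s by ring, AddChar.map_add_eq_mul]
          ring
      _ = _ := by
          rw [h]
          by_cases hst : g = f
          · subst hst; simp; field_simp
          · rw [if_neg (sub_ne_zero.2 hst), if_neg hst, mul_zero]
  simp [this]

/-- Sub-sampling a convolution in frequency amounts to multiplication by the filter and aliasing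
in time. -/
lemma alias_sum {n M D : ℕ} [NeZero n] (h : M * D = n) (Yh G : ZMod n → ℂ) (j : ℤ) :
    ∑ i ∈ Finset.range M, (D : ℂ) * (∑ f : ZMod n, Yh f *
      normDFT G (((D * i : ℕ) : ZMod n) - f)) * rootPow M (i * j) =
    ∑ s : ZMod n, if (M : ℤ) ∣ j - s.val then synth Yh s * G s else 0 := by
  have hn : (n : ℂ) ≠ 0 := by exact_mod_cast NeZero.ne n
  have hM : 0 < M := Nat.pos_of_ne_zero fun h0 => NeZero.ne n (by rw [← h, h0, zero_mul])
  have hD : D ≠ 0 := fun h0 => NeZero.ne n (by rw [← h, h0, mul_zero])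
  have hconv : ∀ i : ℕ, ∑ f : ZMod n, Yh f * normDFT G (((D * i : ℕ) : ZMod n) - f) =
      (n : ℂ)⁻¹ * ∑ s : ZMod n, synth Yh s * G s * rootPow M (-(i * s.val)) := by
    intro i
    simp only [normDFT_apply, synth, Finset.mul_sum, Finset.sum_mul]
    rw [Finset.sum_comm]
    refine Finset.sum_congr rfl fun s _ => Finset.sum_congr rfl fun f _ => ?_
    have h1 : ZMod.stdAddChar (-(s * (((D * i : ℕ) : ZMod n) - f))) =
        rootPow M (-(i * s.val)) * (ZMod.stdAddChar (f * s) : ℂ) := by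
      rw [show -(s * (((D * i : ℕ) : ZMod n) - f)) = -(s * ((D * i : ℕ) : ZMod n)) + f * s by ring,
        AddChar.map_add_eq_mul]
      congr 1
      rw [← rootPow_mul_mul hD, mul_comm D M, h, rootPow_eq_stdAddChar]
      congr 1
      push_cast
      simp
      ring
    rw [h1]; ring
  simp only [hconv]
  calc _ = ∑ s : ZMod n, synth Yh s * G s * ((D : ℂ) * (n : ℂ)⁻¹ *
        ∑ i ∈ Finset.range M, rootPow M (i * (j - s.val))) := by
        simp only [Finset.mul_sum, Finset.sum_mul]
        rw [Finset.sum_comm]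
        refine Finset.sum_congr rfl fun s _ => Finset.sum_congr rfl fun i _ => ?_
        rw [show (i : ℤ) * (j - s.val) = -(i * s.val) + i * j by ring, rootPow_add]
        ring
    _ = _ := by
        refine Finset.sum_congr rfl fun s _ => ?_
        rw [sum_rootPow hM]
        have hDn : (D : ℂ) * (n : ℂ)⁻¹ * M = 1 := by
          rw [mul_right_comm, ← Nat.cast_mul, mul_comm D M, h, mul_inv_cancel₀ hn]
        split_ifs
        · rw [hDn, mul_one]
        · simp

/-- The time domain part of `IsSemiEquiFilter`. -/
def IsTimeFilter {n : ℕ} [NeZero n] (w : ℕ) (ζ : ℝ) (G : ZMod n → ℝ) : Prop :=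
  ∃ G₀ : ZMod n → ℝ, (∀ t, 0 ≤ G₀ t ∧ G₀ t ≤ 1) ∧
    (∀ t : ZMod n, 2 * |t.valMinAbs| ≤ (w : ℤ) → G₀ t = 1) ∧
    (∀ t : ZMod n, (w : ℤ) ≤ |t.valMinAbs| → G₀ t = 0) ∧
    l2Norm (fun t => ((G t - G₀ t : ℝ) : ℂ)) ≤ ζ

lemma norm_sum_mul_le {n : ℕ} [NeZero n] (x y : ZMod n → ℂ) (s : Finset (ZMod n)) :
    ‖∑ t ∈ s, x t * y t‖ ≤ l2Norm x * l2Norm y := by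
  calc _ ≤ ∑ t ∈ s, ‖x t‖ * ‖y t‖ := by
        refine (norm_sum_le _ _).trans (le_of_eq ?_); simp
    _ ≤ ∑ t, ‖x t‖ * ‖y t‖ :=
        Finset.sum_le_sum_of_subset_of_nonneg (Finset.subset_univ s) fun _ _ _ => by positivity
    _ ≤ _ := Real.sum_mul_le_sqrt_mul_sqrt _ _ _

lemma valMinAbs_intCast {n : ℕ} [NeZero n] {j : ℤ} (h : 2 * |j| < n) :
    ((j : ZMod n)).valMinAbs = j := by
  rw [ZMod.valMinAbs_spec]
  obtain ⟨h1, h2⟩ := abs_lt.1 (show |j * 2| < n by rw [abs_mul]; simpa [mul_comm] using h)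
  exact ⟨rfl, h1, h2.le⟩

/-- Aliasing with period `2 w` does no harm for `|j| ≤ w / 2`: the other time indices congruent to
`j` have absolute value at least `w`, where the ideal filter vanishes. -/
lemma filter_error {n w D : ℕ} [NeZero n] (h : 2 * w * D = n) {ζ : ℝ} {G : ZMod n → ℝ}
    (hG : IsTimeFilter w ζ G) (y : ZMod n → ℂ) {j : ℤ} (hj : 2 * |j| ≤ (w : ℤ)) :
    ‖(∑ s : ZMod n, if ((2 * w : ℕ) : ℤ) ∣ j - s.val then y s * (G s : ℂ) else 0) -
      y (j : ZMod n)‖ ≤ l2Norm y * ζ := by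
  obtain ⟨G₀, -, h1, h0, hζ⟩ := hG
  have hw : 0 < w := Nat.pos_of_ne_zero fun h' => NeZero.ne n (by rw [← h, h']; simp)
  have hD : 0 < D := Nat.pos_of_ne_zero fun h' => NeZero.ne n (by rw [← h, h']; simp)
  have hwn : 2 * w ≤ n := by rw [← h]; exact Nat.le_mul_of_pos_right _ hD
  have hdvdn : ((2 * w : ℕ) : ℤ) ∣ n := by rw [← h]; push_cast; exact Dvd.intro _ rfl
  have hvj : ((j : ZMod n)).valMinAbs = j := valMinAbs_intCast (by omega)
  have hjG : G₀ (j : ZMod n) = 1 := h1 _ (by rw [hvj]; exact hj)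
  have hother : ∀ s : ZMod n, ((2 * w : ℕ) : ℤ) ∣ j - s.val → s ≠ j → G₀ s = 0 := by
    intro s hs hne
    apply h0
    by_contra hlt
    apply hne
    have h2 : ((2 * w : ℕ) : ℤ) ∣ s.val - s.valMinAbs := by
      refine hdvdn.trans ?_
      rw [← ZMod.intCast_zmod_eq_zero_iff_dvd]
      push_cast; simp
    obtain ⟨q, hq⟩ := dvd_add hs h2
    have h3 : j - s.valMinAbs = (2 * w : ℕ) * q := by rw [← hq]; ring
    obtain ⟨a1, a2⟩ := abs_lt.1 (not_le.1 hlt)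
    have hjw : |j| < w := by have := abs_nonneg j; omega
    obtain ⟨b1, b2⟩ := abs_lt.1 hjw
    have hq0 : q = 0 := by
      push_cast at h3
      have hw' : (0 : ℤ) < 2 * w := by omega
      rcases lt_trichotomy q 0 with hq' | hq' | hq'
      · have : 2 * (w : ℤ) * q ≤ 2 * w * (-1) := mul_le_mul_of_nonneg_left (by omega) hw'.le
        omega
      · exact hq'
      · have : 2 * (w : ℤ) * 1 ≤ 2 * w * q := mul_le_mul_of_nonneg_left (by omega) hw'.le
        omega
    rw [hq0, mul_zero] at h3
    rw [← s.coe_valMinAbs]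
    congr 1; omega
  have hself : ((2 * w : ℕ) : ℤ) ∣ j - ((j : ZMod n)).val := by
    refine hdvdn.trans ?_
    rw [← ZMod.intCast_zmod_eq_zero_iff_dvd]
    push_cast; simp
  have hideal : (∑ s : ZMod n, if ((2 * w : ℕ) : ℤ) ∣ j - s.val then y s * (G₀ s : ℂ) else 0) =
      y (j : ZMod n) := by
    rw [Finset.sum_eq_single (j : ZMod n)]
    · rw [if_pos hself, hjG]; simp
    · intro s _ hs
      split_ifs with hd
      · rw [hother s hd hs]; simp
      · rfl
    · intro hh; exact absurd (Finset.mem_univ _) hh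
  rw [← hideal, ← Finset.sum_sub_distrib]
  have : ∀ s : ZMod n, ((if ((2 * w : ℕ) : ℤ) ∣ j - s.val then y s * (G s : ℂ) else 0) -
      if ((2 * w : ℕ) : ℤ) ∣ j - s.val then y s * (G₀ s : ℂ) else 0) =
      if ((2 * w : ℕ) : ℤ) ∣ j - s.val then y s * ((G s - G₀ s : ℝ) : ℂ) else 0 := by
    intro s
    split_ifs
    · push_cast; ring
    · simp
  simp only [this]
  rw [← Finset.sum_filter]
  refine (norm_sum_mul_le y (fun s => ((G s - G₀ s : ℝ) : ℂ)) _).trans ?_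
  exact mul_le_mul_of_nonneg_left hζ (Real.sqrt_nonneg _)

/-- Filters are bounded, as the Euclidean norm dominates each coordinate. -/
lemma IsTimeFilter.abs_le {n w : ℕ} [NeZero n] {ζ : ℝ} {G : ZMod n → ℝ} (hG : IsTimeFilter w ζ G)
    (t : ZMod n) : |G t| ≤ 1 + ζ := by
  obtain ⟨G₀, hb, -, -, hζ⟩ := hG
  have h1 : |G t - G₀ t| ≤ ζ := by
    refine le_trans ?_ hζ
    refine Real.le_sqrt_of_sq_le ?_
    have := Finset.single_le_sum (f := fun t => ‖((G t - G₀ t : ℝ) : ℂ)‖ ^ 2)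
      (fun i _ => by positivity) (Finset.mem_univ t)
    refine le_trans (le_of_eq ?_) this
    simp only [Complex.norm_real, Real.norm_eq_abs]
  have h2 : |G₀ t| ≤ 1 := by rw [abs_of_nonneg (hb t).1]; exact (hb t).2
  calc |G t| = |(G t - G₀ t) + G₀ t| := by ring_nf
    _ ≤ |G t - G₀ t| + |G₀ t| := abs_add_le _ _
    _ ≤ _ := by linarith

/-- Filtering and aliasing increase the norm at most by the factor `n`.  The accuracy of the second
level, with exponent `c + 1` instead of `c`, compensates this. -/
lemma l2Norm_alias_le {n M : ℕ} [NeZero n] [NeZero M] (hn : 4 ≤ n)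
    (x : ZMod n → ℂ) {G : ZMod n → ℝ} (hG : ∀ t, |G t| ≤ 2) (y : ZMod M → ℂ)
    (hy : ∀ t, y t = ∑ s : ZMod n, if (M : ℤ) ∣ (t.val : ℤ) - s.val then x s * (G s : ℂ) else 0) :
    l2Norm y ≤ n * l2Norm x := by
  have hyt : ∀ t, ‖y t‖ ^ 2 ≤
      n * ∑ s : ZMod n, if ((s.val : ℕ) : ZMod M) = t then 4 * ‖x s‖ ^ 2 else 0 := by
    intro t
    have hiff : ∀ s : ZMod n, (M : ℤ) ∣ (t.val : ℤ) - s.val ↔ ((s.val : ℕ) : ZMod M) = t := by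
      intro s
      rw [← ZMod.intCast_zmod_eq_zero_iff_dvd]
      push_cast
      simp only [ZMod.natCast_val, ZMod.cast_id', id_eq, sub_eq_zero]
      exact eq_comm
    rw [hy]
    simp only [hiff]
    rw [← Finset.sum_filter, ← Finset.sum_filter]
    set S := Finset.univ.filter fun s : ZMod n => ((s.val : ℕ) : ZMod M) = t
    calc ‖∑ s ∈ S, x s * (G s : ℂ)‖ ^ 2 ≤ (∑ s ∈ S, ‖x s * (G s : ℂ)‖) ^ 2 := by
          gcongr; exact norm_sum_le _ _
      _ ≤ S.card * ∑ s ∈ S, ‖x s * (G s : ℂ)‖ ^ 2 := sq_sum_le_card_mul_sum_sq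
      _ ≤ n * ∑ s ∈ S, 4 * ‖x s‖ ^ 2 := by
          gcongr with s
          · exact (Finset.card_le_univ S).trans (by rw [ZMod.card])
          · rw [norm_mul, mul_pow, mul_comm]
            have := hG s
            gcongr
            rw [Complex.norm_real, Real.norm_eq_abs]
            nlinarith [abs_nonneg (G s)]
  have hsum : ∑ t, ‖y t‖ ^ 2 ≤ (n : ℝ) ^ 2 * ∑ s, ‖x s‖ ^ 2 := by
    calc ∑ t, ‖y t‖ ^ 2 ≤ ∑ t : ZMod M, ((n : ℝ) * ∑ s : ZMod n,
          if ((s.val : ℕ) : ZMod M) = t then 4 * ‖x s‖ ^ 2 else (0 : ℝ)) :=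
          Finset.sum_le_sum fun t _ => hyt t
      _ = (n : ℝ) * (4 * ∑ s, ‖x s‖ ^ 2) := by
          rw [← Finset.mul_sum, Finset.sum_comm, Finset.mul_sum]
          simp [Finset.mul_sum]
      _ ≤ _ := by
          have h4 : (4 : ℝ) ≤ n := by exact_mod_cast hn
          have hS : 0 ≤ ∑ s, ‖x s‖ ^ 2 := by positivity
          nlinarith [mul_nonneg (show (0 : ℝ) ≤ n by positivity) hS]
  rw [l2Norm, l2Norm, ← Real.sqrt_sq (show (0 : ℝ) ≤ n by positivity),
    ← Real.sqrt_mul (by positivity)]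
  exact Real.sqrt_le_sqrt hsum

/-! ### Accuracy of the two-level scheme -/

lemma l2Norm_comp_equiv {n : ℕ} [NeZero n] (e : ZMod n ≃ ZMod n) (y : ZMod n → ℂ) :
    l2Norm (fun t => y (e t)) = l2Norm y := by
  rw [l2Norm, l2Norm, Equiv.sum_comp e fun t => ‖y t‖ ^ 2]

/-- In time domain, the reduced spectra are the aliased filtered shifted signals. -/
lemma synth_reducedSpectrum {n k₁ : ℕ} [NeZero n] [NeZero (2 * n / k₁)] (hk : 2 * k₁ ∣ n)
    (h2 : 2 ∣ k₁) (X G : ZMod n → ℂ) (r : ℕ) (t : ZMod (2 * n / k₁)) :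
    synth (reducedSpectrum k₁ (normDFT X) (normDFT G) r) t =
      ∑ s : ZMod n, if ((2 * n / k₁ : ℕ) : ℤ) ∣ (t.val : ℤ) - s.val then
        shifted k₁ X r (s.val : ℤ) * G s else 0 := by
  obtain ⟨p, hp⟩ := hk
  obtain ⟨h, rfl⟩ := h2
  have hpos : 0 < 2 * (2 * h) := Nat.pos_of_ne_zero fun h' => NeZero.ne n (by rw [hp, h', zero_mul])
  have hp0 : p ≠ 0 := fun h' => NeZero.ne n (by rw [hp, h', mul_zero])
  have hN : 2 * n / (2 * h) * (2 * h / 2) = n := by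
    have h1 : 2 * n / (2 * h) = 4 * p := by
      rw [hp, show 2 * (2 * (2 * h) * p) = (2 * h) * (4 * p) by ring,
        Nat.mul_div_cancel_left _ (by omega)]
    rw [h1, Nat.mul_div_cancel_left _ (by norm_num), hp]; ring
  have hdiv : n / (2 * (2 * h)) = p := by rw [hp, Nat.mul_div_cancel_left _ hpos]
  have hshift : ∀ ξ : ZMod n, rootPow (2 * (2 * h)) (r * ξ.val) =
      ZMod.stdAddChar (ξ * ((n / (2 * (2 * h)) * r : ℕ) : ZMod n)) := by
    intro ξ
    rw [← rootPow_mul_mul hp0, mul_comm p, ← hp, rootPow_eq_stdAddChar, hdiv]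
    congr 1
    push_cast
    simp
    ring
  have hsynth : ∀ s : ZMod n, synth (fun ξ => normDFT X ξ *
      rootPow (2 * (2 * h)) (r * ξ.val)) s = shifted (2 * h) X r (s.val : ℤ) := by
    intro s
    have h1 := congrFun (synth_normDFT X) (s + ((n / (2 * (2 * h)) * r : ℕ) : ZMod n))
    rw [shifted, Int.cast_natCast, ZMod.natCast_val, ZMod.cast_id', id_eq, ← h1, synth, synth]
    refine Finset.sum_congr rfl fun ξ _ => ?_
    rw [hshift, mul_assoc, ← AddChar.map_add_eq_mul, add_comm, mul_add]
  have := alias_sum hN (fun ξ => normDFT X ξ * rootPow (2 * (2 * h)) (r * ξ.val)) G (t.val : ℤ)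
  simp only [hsynth] at this
  rw [← this, synth, ← sum_range_natCast]
  refine Finset.sum_congr rfl fun i hi => ?_
  have hi' := Finset.mem_range.1 hi
  rw [reducedSpectrum_eq (Dvd.intro _ hp.symm), ZMod.val_cast_of_lt hi', rootPow_eq_stdAddChar]
  congr 1
  · congr 1
    refine Finset.sum_congr rfl fun ξ _ => ?_
    ring
  · congr 1
    push_cast
    simp

/-- Accuracy of the semi-equispaced transform of a signal with permuted and modulated spectrum: the
permutation of the frequencies by `σ` and the modulation by `Δ` amount to the substitution
`j ↦ σ j + Δ` in time. -/
lemma permuted_error {N k D : ℕ} [NeZero N] (h : 2 * k * D = N) {ζ : ℝ} {G : ZMod N → ℝ}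
    (hG : IsTimeFilter k ζ G) (Yh : ZMod N → ℂ) {σ : ℕ} (hσ : σ.Coprime N) (Δ : ZMod N) {j : ℤ}
    (hj : 2 * |j| ≤ (k : ℤ)) :
    ‖(∑ i ∈ Finset.range (2 * k), (D : ℂ) * (∑ f : ZMod N, Yh f * ZMod.stdAddChar (f * Δ) *
        normDFT (fun t => (G t : ℂ)) (((D * i : ℕ) : ZMod N) - σ * f)) * rootPow (2 * k) (i * j)) -
      synth Yh (σ * j + Δ)‖ ≤ l2Norm (synth Yh) * ζ := by
  set u : (ZMod N)ˣ := ZMod.unitOfCoprime σ hσ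
  have hu : (u : ZMod N) = σ := ZMod.coe_unitOfCoprime σ hσ
  set Zh : ZMod N → ℂ := fun g => Yh ((u⁻¹ : (ZMod N)ˣ) * g) *
    ZMod.stdAddChar (((u⁻¹ : (ZMod N)ˣ) : ZMod N) * g * Δ)
  have hsum : ∀ i : ℕ, ∑ f : ZMod N, Yh f * ZMod.stdAddChar (f * Δ) *
        normDFT (fun t => (G t : ℂ)) (((D * i : ℕ) : ZMod N) - σ * f) =
      ∑ g : ZMod N, Zh g * normDFT (fun t => (G t : ℂ)) (((D * i : ℕ) : ZMod N) - g) := by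
    intro i
    rw [← Equiv.sum_comp u.mulLeft (fun g => Zh g * _)]
    refine Finset.sum_congr rfl fun f _ => ?_
    simp only [Zh, Units.mulLeft_apply, Units.inv_mul_cancel_left, ← hu]
  have hsynth : ∀ s, synth Zh s = synth Yh (σ * s + Δ) := by
    intro s
    rw [synth, synth, ← Equiv.sum_comp u.mulLeft (fun g => Zh g * _)]
    refine Finset.sum_congr rfl fun f _ => ?_
    simp only [Zh, Units.mulLeft_apply, Units.inv_mul_cancel_left]
    rw [mul_assoc, ← AddChar.map_add_eq_mul, hu]
    congr 2
    ring
  have hnorm : l2Norm (synth Zh) = l2Norm (synth Yh) := by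
    have := l2Norm_comp_equiv (u.mulLeft.trans (Equiv.addRight Δ)) (synth Yh)
    rw [← this]
    congr 1
    funext s
    rw [hsynth]
    simp [hu]
  simp only [hsum]
  rw [alias_sum h, ← hsynth, ← hnorm]
  exact filter_error h hG (synth Zh) hj

/-- The error bound of the two-level scheme.  The first level contributes `n ^ (-c) ‖X‖`, the second
one at most `n ^ (-(c + 1)) (n ‖X‖)`. -/
lemma two_level_error {n k₁ k D r : ℕ} [NeZero n] [NeZero (2 * n / k₁)] {c : ℝ} (hc : 1 ≤ c)
    (hn : 4 ≤ n) (hk : 2 * k₁ ∣ n) (h2 : 2 ∣ k₁) (hD : 2 * k * D = 2 * n / k₁)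
    {G : ZMod n → ℝ} (hG : IsTimeFilter (n / k₁) ((n : ℝ) ^ (-c)) G)
    {G₂ : ZMod (2 * n / k₁) → ℝ} (hG₂ : IsTimeFilter k ((n : ℝ) ^ (-(c + 1))) G₂)
    (X : ZMod n → ℂ) {σ : ℕ} (hσ : σ.Coprime (2 * n / k₁)) (Δ : ZMod (2 * n / k₁)) {j t : ℤ}
    (hj : 2 * |j| ≤ (k : ℤ)) (ht : 2 * |t| ≤ ((n / k₁ : ℕ) : ℤ))
    (hjt : (t : ZMod (2 * n / k₁)) = σ * j + Δ) :
    ‖(∑ i ∈ Finset.range (2 * k), (D : ℂ) * (∑ f : ZMod (2 * n / k₁),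
          reducedSpectrum k₁ (normDFT X) (normDFT fun t => (G t : ℂ)) r f *
          ZMod.stdAddChar (f * Δ) *
        normDFT (fun t => (G₂ t : ℂ)) (((D * i : ℕ) : ZMod (2 * n / k₁)) - σ * f)) *
          rootPow (2 * k) (i * j)) - shifted k₁ X r t‖ ≤ 2 * (n : ℝ) ^ (-c) * l2Norm X := by
  have e2 := permuted_error hD hG₂
    (reducedSpectrum k₁ (normDFT X) (normDFT fun t => (G t : ℂ)) r) hσ Δ hj
  have hsyn := synth_reducedSpectrum hk h2 X (fun t => (G t : ℂ)) r
  set y := synth (reducedSpectrum k₁ (normDFT X) (normDFT fun t => (G t : ℂ)) r)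
  have hn0 : 0 < n := by omega
  obtain ⟨p, hp⟩ := hk
  have hk₁ : 0 < k₁ := Nat.pos_of_ne_zero fun h' => by rw [h'] at hp; omega
  have hnk : n / k₁ = 2 * p := by
    rw [hp, show 2 * k₁ * p = k₁ * (2 * p) by ring, Nat.mul_div_cancel_left _ hk₁]
  have hNn : 2 * n / k₁ = 2 * (n / k₁) := by
    rw [hnk, hp, show 2 * (2 * k₁ * p) = k₁ * (2 * (2 * p)) by ring,
      Nat.mul_div_cancel_left _ hk₁]
  set x : ZMod n → ℂ := fun s => X (s + ((n / (2 * k₁) * r : ℕ) : ZMod n))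
  have hxs : ∀ s : ZMod n, shifted k₁ X r (s.val : ℤ) = x s := fun s => by
    simp [shifted, x]
  simp only [hxs] at hsyn
  have hxn : l2Norm x = l2Norm X :=
    l2Norm_comp_equiv (Equiv.addRight ((n / (2 * k₁) * r : ℕ) : ZMod n)) X
  have hMD : 2 * n / k₁ * (k₁ / 2) = n := by
    obtain ⟨h, rfl⟩ := h2
    rw [hNn, hnk, Nat.mul_div_cancel_left _ (by norm_num), hp]; ring
  have hζ : (n : ℝ) ^ (-c) ≤ 1 :=
    Real.rpow_le_one_of_one_le_of_nonpos (by exact_mod_cast hn0) (by linarith)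
  have hynorm : l2Norm y ≤ n * l2Norm X := by
    rw [← hxn]
    exact l2Norm_alias_le hn x (fun t => (hG.abs_le t).trans (by linarith)) y hsyn
  have e1 : ‖y (σ * j + Δ) - shifted k₁ X r t‖ ≤ l2Norm X * (n : ℝ) ^ (-c) := by
    have := filter_error (D := k₁ / 2) (w := n / k₁) (by rw [← hNn, hMD]) hG x (j := t) ht
    rw [hxn] at this
    refine le_trans (le_of_eq ?_) this
    rw [hsyn, ← hNn]
    congr 2
    refine Finset.sum_congr rfl fun s _ => ?_
    have hiff : ((2 * n / k₁ : ℕ) : ℤ) ∣ ((σ * j + Δ : ZMod (2 * n / k₁)).val : ℤ) - s.val ↔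
        ((2 * n / k₁ : ℕ) : ℤ) ∣ t - s.val := by
      rw [← ZMod.intCast_zmod_eq_zero_iff_dvd, ← ZMod.intCast_zmod_eq_zero_iff_dvd]
      push_cast
      rw [ZMod.natCast_val, ZMod.cast_id', id_eq, ← hjt]
    simp only [hiff]
  have hpow : (n : ℝ) * (n : ℝ) ^ (-(c + 1)) = (n : ℝ) ^ (-c) := by
    rw [show -(c + 1) = -c - 1 by ring, Real.rpow_sub_one (by positivity)]
    field_simp
  refine (norm_sub_le_norm_sub_add_norm_sub _ (y (σ * j + Δ)) _).trans ?_
  have h3 : l2Norm y * (n : ℝ) ^ (-(c + 1)) ≤ l2Norm X * (n : ℝ) ^ (-c) := by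
    rw [← hpow]
    calc _ ≤ (n * l2Norm X) * (n : ℝ) ^ (-(c + 1)) := by gcongr
      _ = _ := by ring
  linarith

/-! ### Smoothed boxes -/

/-- The box `|s| ≤ B`, as a signal of length `N`. -/
def box (N B : ℕ) (s : ZMod N) : ℝ := if s.valMinAbs.natAbs ≤ B then 1 else 0

/-- A sum over the residues with small absolute value is a sum over an interval of integers. -/
lemma sum_centered {N F : ℕ} [NeZero N] (hF : 2 * F < N) (h : ZMod N → ℂ) :
    ∑ x : ZMod N, (if x.valMinAbs.natAbs ≤ F then h x else 0) =
      ∑ f ∈ Finset.Icc (-(F : ℤ)) F, h (f : ZMod N) := by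
  rw [← Finset.sum_filter]
  refine Finset.sum_bij' (fun x _ => x.valMinAbs) (fun f _ => (f : ZMod N)) ?_ ?_ ?_ ?_ ?_
  · intro x hx
    have := (Finset.mem_filter.1 hx).2
    rw [Finset.mem_Icc]; omega
  · intro f hf
    obtain ⟨h1, h2⟩ := Finset.mem_Icc.1 hf
    have : |f| ≤ F := abs_le.2 ⟨h1, h2⟩
    rw [Finset.mem_filter, valMinAbs_intCast (by omega)]
    exact ⟨Finset.mem_univ _, by omega⟩
  · intro x _; simp
  · intro f hf
    obtain ⟨h1, h2⟩ := Finset.mem_Icc.1 hf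
    have : |f| ≤ F := abs_le.2 ⟨h1, h2⟩
    exact valMinAbs_intCast (by omega)
  · intro x _; simp

lemma dirichlet_sum (N B : ℕ) (x : ℤ) (hx : rootPow N x ≠ 1) :
    ∑ v ∈ Finset.Icc (-(B : ℤ)) B, rootPow N (-(v * x)) =
      (rootPow N (x * (2 * B + 1)) - 1) / ((rootPow N x - 1) * rootPow N (x * B)) := by
  have h1 : ∑ v ∈ Finset.Icc (-(B : ℤ)) B, rootPow N (-(v * x)) =
      ∑ i ∈ Finset.range (2 * B + 1), rootPow N x ^ i / rootPow N (x * B) := by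
    refine Finset.sum_bij' (fun v _ => (B - v).toNat) (fun i _ => (B : ℤ) - i) ?_ ?_ ?_ ?_ ?_
    · intro v hv; rw [Finset.mem_Icc] at hv; rw [Finset.mem_range]; omega
    · intro i hi; rw [Finset.mem_range] at hi; rw [Finset.mem_Icc]; omega
    · intro v hv; rw [Finset.mem_Icc] at hv; omega
    · intro i hi; omega
    · intro v hv
      rw [Finset.mem_Icc] at hv
      have h0 : rootPow N (x * B) ≠ 0 := Complex.exp_ne_zero _
      rw [eq_div_iff h0, ← rootPow_add, ← rootPow_mul_natCast]
      congr 1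
      rw [Int.toNat_of_nonneg (by omega)]; ring
  rw [h1, ← Finset.sum_div, geom_sum_eq hx, ← rootPow_mul_natCast, div_div]
  congr 2
  push_cast
  rw [mul_comm]

lemma normDFT_box {N B : ℕ} [NeZero N] (hB : 2 * B < N) (x : ZMod N) :
    normDFT (fun s => (box N B s : ℂ)) x = (N : ℂ)⁻¹ *
      ((((1 - x.val) * (2 * B + 1) : ℕ) : ℂ) + (rootPow N ((x.val * (2 * B + 1) : ℕ) : ℤ) - 1) /
        ((rootPow N (x.val : ℤ) - 1) * rootPow N ((x.val * B : ℕ) : ℤ))) := by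
  have h : ∀ s : ZMod N, ZMod.stdAddChar (-(s * x)) * (box N B s : ℂ) =
      if s.valMinAbs.natAbs ≤ B then (ZMod.stdAddChar (-(s * x)) : ℂ) else 0 := by
    intro s; rw [box]; split_ifs <;> simp
  have h2 : ∀ v : ℤ, (ZMod.stdAddChar (-((v : ZMod N) * x)) : ℂ) = rootPow N (-(v * x.val)) := by
    intro v
    rw [rootPow_eq_stdAddChar]
    congr 1
    push_cast
    simp
  rw [normDFT_apply]
  simp only [h]
  rw [sum_centered hB]
  simp only [h2]
  congr 1
  -- at `x = 0` the quotient is `0 / 0 = 0`, and the other summand supplies the value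
  by_cases hx : rootPow N (x.val : ℤ) = 1
  · have h0 : x.val = 0 := by
      rw [rootPow_eq_one_iff (NeZero.pos N)] at hx
      exact Nat.eq_zero_of_dvd_of_lt (Int.natCast_dvd_natCast.1 hx) x.val_lt
    have hz : ∀ v : ℤ, rootPow N (-(v * x.val)) = 1 := fun v => by simp [h0, rootPow_zero]
    rw [Finset.sum_congr rfl fun v _ => hz v, Finset.sum_const, Int.card_Icc,
      show ((B : ℤ) + 1 - -(B : ℤ)).toNat = 2 * B + 1 by omega]
    simp [h0, rootPow_zero]
  · have h0 : 1 - x.val = 0 := by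
      have : x.val ≠ 0 := fun h => hx (by rw [h]; simp [rootPow_zero])
      omega
    rw [dirichlet_sum N B _ hx, h0]
    push_cast
    simp

/-- A box `|s| ≤ 3 w / 4`, smoothed by a kernel of total mass one which is almost non-negative and
concentrated on `|u| < w / 4`, is a filter: up to `N ε` it takes values in `[0, 1]`, is one for
`|t| ≤ w / 2`, and is zero for `|t| ≥ w`. -/
lemma isTimeFilter_smooth {N w : ℕ} [NeZero N] {ε ζ : ℝ} {g : ZMod N → ℝ} (hw : 0 < w)
    (hε : 0 ≤ ε) (hεζ : (N : ℝ) ^ 2 * ε ≤ ζ) (h1 : ∑ u, g u = 1) (hneg : ∀ u, -ε ≤ g u)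
    (hfar : ∀ u : ZMod N, w ≤ 4 * u.valMinAbs.natAbs → |g u| ≤ ε) :
    IsTimeFilter w ζ (fun t => ∑ s, box N (3 * w / 4) s * g (t - s)) := by
  set B := 3 * w / 4 with hB
  set G : ZMod N → ℝ := fun t => ∑ s, box N B s * g (t - s) with hG
  have htri : ∀ s t : ZMod N, (s.valMinAbs.natAbs ≤ t.valMinAbs.natAbs + (t - s).valMinAbs.natAbs) ∧
      (t.valMinAbs.natAbs ≤ s.valMinAbs.natAbs + (t - s).valMinAbs.natAbs) := by
    intro s t
    constructor
    · have := ZMod.natAbs_valMinAbs_add_le t (-(t - s))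
      rw [show t + -(t - s) = s by ring] at this
      refine this.trans ((Int.natAbs_add_le _ _).trans ?_)
      rw [ZMod.natAbs_valMinAbs_neg]
    · have := ZMod.natAbs_valMinAbs_add_le s (t - s)
      rw [show s + (t - s) = t by ring] at this
      exact this.trans (Int.natAbs_add_le _ _)
  have hcomp : ∀ t, ∑ s, (1 - box N B s) * g (t - s) = 1 - G t := by
    intro t
    have h3 : ∑ s, g (t - s) = 1 := (Equiv.sum_comp (Equiv.subLeft t) g).trans h1
    simp only [hG, sub_mul, one_mul, Finset.sum_sub_distrib, h3]
  have hN : ∀ f : ZMod N → ℝ, (∀ s, |f s| ≤ ε) → |∑ s, f s| ≤ N * ε := by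
    intro f hf
    refine (Finset.abs_sum_le_sum_abs _ _).trans ?_
    refine (Finset.sum_le_card_nsmul _ _ ε fun s _ => hf s).trans ?_
    simp [ZMod.card]
  have hN' : ∀ f : ZMod N → ℝ, (∀ s, -ε ≤ f s) → -(N * ε) ≤ ∑ s, f s := by
    intro f hf
    have := Finset.card_nsmul_le_sum Finset.univ f (-ε) fun s _ => hf s
    simpa [ZMod.card] using this
  have hlo : ∀ t, -(N * ε) ≤ G t := by
    refine fun t => hN' _ fun s => ?_
    rw [box]; split_ifs
    · simpa using hneg (t - s)
    · simpa using hε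
  have hhi : ∀ t, G t ≤ 1 + N * ε := by
    intro t
    have : -(N * ε) ≤ ∑ s, (1 - box N B s) * g (t - s) := by
      refine hN' _ fun s => ?_
      rw [box]; split_ifs
      · simpa using hε
      · simpa using hneg (t - s)
    rw [hcomp] at this
    linarith
  have hinner : ∀ t : ZMod N, 2 * t.valMinAbs.natAbs ≤ w → |1 - G t| ≤ N * ε := by
    intro t ht
    rw [← hcomp]
    refine hN _ fun s => ?_
    rw [box]; split_ifs with hs
    · simpa using hε
    · rw [sub_zero, one_mul]
      apply hfar
      have := (htri s t).1
      omega
  have houter : ∀ t : ZMod N, w ≤ t.valMinAbs.natAbs → |G t| ≤ N * ε := by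
    intro t ht
    refine hN _ fun s => ?_
    rw [box]; split_ifs with hs
    · rw [one_mul]
      apply hfar
      have := (htri s t).2
      omega
    · simpa using hε
  have hNε : 0 ≤ N * ε := by positivity
  refine ⟨fun t => if 2 * t.valMinAbs.natAbs ≤ w then 1 else if w ≤ t.valMinAbs.natAbs then 0 else
    max 0 (min 1 (G t)), ?_, ?_, ?_, ?_⟩
  · intro t
    dsimp only
    split_ifs
    · norm_num
    · norm_num
    · exact ⟨le_max_left _ _, max_le (by norm_num) (min_le_left _ _)⟩
  · intro t ht
    rw [Int.abs_eq_natAbs] at ht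
    exact if_pos (by omega)
  · intro t ht
    rw [Int.abs_eq_natAbs] at ht
    exact (if_neg (by omega)).trans (if_pos (by omega))
  · have hdiff : ∀ t, ‖((G t - (if 2 * t.valMinAbs.natAbs ≤ w then 1 else
        if w ≤ t.valMinAbs.natAbs then 0 else max 0 (min 1 (G t))) : ℝ) : ℂ)‖ ^ 2 ≤
        (N * ε) ^ 2 := by
      intro t
      refine pow_le_pow_left₀ (norm_nonneg _) ?_ 2
      rw [Complex.norm_real, Real.norm_eq_abs]
      split_ifs with h h'
      · rw [abs_sub_comm]; exact hinner t h
      · rw [sub_zero]; exact houter t h'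
      · have a := hlo t
        have b := hhi t
        rw [abs_le]
        constructor
        · rcases max_cases 0 (min 1 (G t)) with c | c <;> rcases min_cases 1 (G t) with d | d <;>
            linarith
        · rcases max_cases 0 (min 1 (G t)) with c | c <;> rcases min_cases 1 (G t) with d | d <;>
            linarith
    refine le_trans ?_ hεζ
    rw [l2Norm]
    refine Real.sqrt_le_iff.2 ⟨by positivity, ?_⟩
    refine (Finset.sum_le_card_nsmul _ _ _ fun t _ => hdiff t).trans ?_
    rw [Finset.card_univ, ZMod.card, nsmul_eq_mul]
    have hN1 : (1 : ℝ) ≤ N := by exact_mod_cast NeZero.pos N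
    calc (N : ℝ) * (N * ε) ^ 2 ≤ (N * N) * (N * ε) ^ 2 := by
          gcongr; nlinarith
      _ = _ := by ring

/-! ### Truncated Gaussians -/

lemma summable_pow_natAbs_and_tsum_le {r : ℝ} (h0 : 0 ≤ r) (h1 : r < 1) :
    Summable (fun m : ℤ => r ^ m.natAbs) ∧ ∑' m : ℤ, r ^ m.natAbs ≤ 2 / (1 - r) := by
  have ha : HasSum (fun n : ℕ => r ^ ((n : ℤ)).natAbs) (1 - r)⁻¹ := by
    simpa only [Int.natAbs_natCast] using hasSum_geometric_of_lt_one h0 h1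
  have hb : HasSum (fun n : ℕ => r ^ (-((n : ℤ) + 1)).natAbs) (r * (1 - r)⁻¹) := by
    have e : (fun n : ℕ => r ^ (-((n : ℤ) + 1)).natAbs) = fun n => r * r ^ n := by
      funext n
      rw [show (-((n : ℤ) + 1)).natAbs = n + 1 by omega, pow_succ']
    rw [e]
    exact (hasSum_geometric_of_lt_one h0 h1).mul_left r
  have h := HasSum.of_nat_of_neg_add_one (f := fun m : ℤ => r ^ m.natAbs) ha hb
  refine ⟨h.summable, ?_⟩
  rw [h.tsum_eq, div_eq_mul_inv]
  have : 0 < (1 - r)⁻¹ := inv_pos.2 (by linarith)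
  nlinarith

/-- The Poisson summation formula for a Gaussian, in the form needed here. -/
lemma theta_eq {K : ℝ} (hK : 0 < K) (x : ℝ) :
    ∑' f : ℤ, Complex.exp (-(Real.pi * f ^ 2 / K)) * Complex.exp (2 * Real.pi * Complex.I * x * f) =
      ((Real.sqrt K * ∑' m : ℤ, Real.exp (-(Real.pi * K * (m - x) ^ 2)) : ℝ) : ℂ) := by
  have ha : 0 < ((K⁻¹ : ℝ) : ℂ).re := by rw [Complex.ofReal_re]; positivity
  have hK' : (K : ℂ) ≠ 0 := by exact_mod_cast hK.ne'
  have h := Complex.tsum_exp_neg_quadratic ha (Complex.I * x)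
  have hpow : 1 / ((K⁻¹ : ℝ) : ℂ) ^ (1 / 2 : ℂ) = (Real.sqrt K : ℂ) := by
    rw [show (1 / 2 : ℂ) = ((1 / 2 : ℝ) : ℂ) by push_cast; rfl,
      ← Complex.ofReal_cpow (by positivity), ← Real.sqrt_eq_rpow, Real.sqrt_inv]
    push_cast
    simp
  rw [hpow] at h
  calc _ = ∑' n : ℤ, Complex.exp (-Real.pi * ((K⁻¹ : ℝ) : ℂ) * n ^ 2 +
        2 * Real.pi * (Complex.I * x) * n) := by
        refine tsum_congr fun f => ?_
        rw [← Complex.exp_add]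
        congr 1
        push_cast
        field_simp
    _ = _ := by
        rw [h]
        push_cast
        congr 1
        refine tsum_congr fun m => ?_
        congr 1
        have hI : Complex.I * (Complex.I * (x : ℂ)) = -x := by
          rw [← mul_assoc, Complex.I_mul_I]; ring
        rw [hI, div_inv_eq_mul]
        ring

/-- The part of a Gaussian sum beyond the cut-off `F`, compared with a geometric series of ratio
`exp (-ρ)`. -/
lemma gauss_tail {K ρ : ℝ} {F : ℕ} (hK : 0 < K) (hρ : 2 * K * ρ ≤ Real.pi * F) (hρ0 : 0 < ρ)
    (x : ℝ) :
    ‖(∑' f : ℤ, Complex.exp (-(Real.pi * f ^ 2 / K)) *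
        Complex.exp (2 * Real.pi * Complex.I * x * f)) -
      ∑ f ∈ Finset.Icc (-(F : ℤ)) F, Complex.exp (-(Real.pi * f ^ 2 / K)) *
        Complex.exp (2 * Real.pi * Complex.I * x * f)‖ ≤
      Real.exp (-(ρ * F)) * (2 / (1 - Real.exp (-ρ))) := by
  set a : ℤ → ℂ := fun f => Complex.exp (-(Real.pi * f ^ 2 / K)) *
        Complex.exp (2 * Real.pi * Complex.I * x * f)
  have hr1 : Real.exp (-ρ) < 1 := by rw [Real.exp_lt_one_iff]; linarith
  obtain ⟨hs, hle⟩ := summable_pow_natAbs_and_tsum_le (Real.exp_pos (-ρ)).le hr1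
  have hnorm : ∀ f : ℤ, ‖a f‖ = Real.exp (-(Real.pi * f ^ 2 / K)) := by
    intro f
    rw [norm_mul, Complex.norm_exp, Complex.norm_exp]
    have h1 : (-((Real.pi : ℂ) * f ^ 2 / K)).re = -(Real.pi * f ^ 2 / K) := by
      have : -((Real.pi : ℂ) * f ^ 2 / K) = ((-(Real.pi * f ^ 2 / K) : ℝ) : ℂ) := by push_cast; rfl
      rw [this, Complex.ofReal_re]
    have h2 : (2 * (Real.pi : ℂ) * Complex.I * x * f).re = 0 := by
      have : 2 * (Real.pi : ℂ) * Complex.I * x * f =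
          ((2 * Real.pi * x * f : ℝ) : ℂ) * Complex.I := by
        push_cast; ring
      rw [this]; simp
    rw [h1, h2, Real.exp_zero, mul_one]
  have habs : ∀ f : ℤ, ((f.natAbs : ℕ) : ℝ) ^ 2 = (f : ℝ) ^ 2 := fun f => by
    rw [Nat.cast_natAbs, Int.cast_abs, sq_abs]
  have hbound : ∀ f : ℤ, F ≤ f.natAbs →
      ‖a f‖ ≤ Real.exp (-(ρ * F)) * Real.exp (-ρ) ^ f.natAbs := by
    intro f hf
    rw [hnorm, ← Real.exp_nat_mul, ← Real.exp_add, Real.exp_le_exp, ← habs]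
    have hf' : (F : ℝ) ≤ f.natAbs := by exact_mod_cast hf
    have : ρ * F + f.natAbs * ρ ≤ Real.pi * (f.natAbs : ℝ) ^ 2 / K := by
      rw [le_div_iff₀ hK]
      calc (ρ * F + f.natAbs * ρ) * K ≤ (ρ * f.natAbs + f.natAbs * ρ) * K := by gcongr
        _ = (2 * K * ρ) * f.natAbs := by ring
        _ ≤ (Real.pi * F) * f.natAbs := by gcongr
        _ ≤ (Real.pi * f.natAbs) * f.natAbs := by gcongr
        _ = _ := by ring
    linarith
  have hsum : Summable a := by
    refine Summable.of_norm_bounded_eventually (hs.mul_left (Real.exp (-(ρ * F)))) ?_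
    rw [Filter.eventually_cofinite]
    refine (Finset.Icc (-(F : ℤ)) F).finite_toSet.subset fun f hf => ?_
    by_contra h
    refine hf (hbound f ?_)
    rw [Finset.mem_coe, Finset.mem_Icc] at h
    omega
  rw [← hsum.sum_add_tsum_subtype_compl (Finset.Icc (-(F : ℤ)) F), add_sub_cancel_left]
  have hs2 := (hs.mul_left (Real.exp (-(ρ * F)))).subtype {f | f ∉ Finset.Icc (-(F : ℤ)) F}
  refine (tsum_of_norm_bounded hs2.hasSum fun f => ?_).trans ?_
  · refine hbound f.1 ?_
    have : f.1 ∉ Finset.Icc (-(F : ℤ)) F := f.2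
    rw [Finset.mem_Icc] at this
    omega
  · refine (Summable.tsum_subtype_le _ _ (fun f => by positivity)
      (hs.mul_left (Real.exp (-(ρ * F))))).trans ?_
    rw [tsum_mul_left]
    gcongr

/-- The dual Gaussian sum is small away from the integers. -/
lemma dual_gauss_le {K δ x : ℝ} (hK : 8 ≤ Real.pi * K) (hx : |x| ≤ 1 / 2) (hδ : 0 ≤ δ)
    (hδx : δ ≤ |x|) (hδ1 : δ ^ 2 ≤ 1 / 8) :
    ∑' m : ℤ, Real.exp (-(Real.pi * K * (m - x) ^ 2)) ≤ 4 * Real.exp (-(Real.pi * K * δ ^ 2)) := by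
  have hr : Real.exp (-1) ≤ 1 / 2 := by
    rw [Real.exp_neg, one_div]
    exact inv_anti₀ (by norm_num) (by linarith [Real.add_one_le_exp 1])
  obtain ⟨hs, hle⟩ := summable_pow_natAbs_and_tsum_le (Real.exp_pos (-1)).le (by linarith)
  have hb : ∀ m : ℤ, Real.exp (-(Real.pi * K * (m - x) ^ 2)) ≤
      Real.exp (-(Real.pi * K * δ ^ 2)) * Real.exp (-1) ^ m.natAbs := by
    intro m
    rw [← Real.exp_nat_mul, ← Real.exp_add, Real.exp_le_exp]
    have habs : ((m.natAbs : ℕ) : ℝ) = |(m : ℝ)| := by rw [Nat.cast_natAbs, Int.cast_abs]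
    rw [habs]
    have key : δ ^ 2 + |(m : ℝ)| / 8 ≤ (m - x) ^ 2 := by
      by_cases hm : m = 0
      · subst hm
        have : δ ^ 2 ≤ |x| ^ 2 := pow_le_pow_left₀ hδ hδx 2
        rw [sq_abs] at this
        simpa using this
      · have h1 : (1 : ℝ) ≤ |(m : ℝ)| := by
          rw [← Int.cast_abs]; exact_mod_cast Int.one_le_abs hm
        have h2 : |(m : ℝ)| / 2 ≤ |(m : ℝ) - x| := by
          have := abs_sub_abs_le_abs_sub (m : ℝ) x
          linarith
        have h3 : (|(m : ℝ)| / 2) ^ 2 ≤ |(m : ℝ) - x| ^ 2 := pow_le_pow_left₀ (by positivity) h2 2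
        rw [sq_abs] at h3
        nlinarith
    have h4 : |(m : ℝ)| ≤ Real.pi * K * (|(m : ℝ)| / 8) := by
      nlinarith [abs_nonneg (m : ℝ)]
    have h5 : Real.pi * K * (δ ^ 2 + |(m : ℝ)| / 8) ≤ Real.pi * K * (m - x) ^ 2 := by
      gcongr
    linarith
  have hs' := hs.mul_left (Real.exp (-(Real.pi * K * δ ^ 2)))
  calc _ ≤ ∑' m : ℤ, Real.exp (-(Real.pi * K * δ ^ 2)) * Real.exp (-1) ^ m.natAbs :=
        (hs'.of_nonneg_of_le (fun m => by positivity) hb).tsum_le_tsum hb hs'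
    _ = Real.exp (-(Real.pi * K * δ ^ 2)) * ∑' m : ℤ, Real.exp (-1) ^ m.natAbs := tsum_mul_left
    _ ≤ Real.exp (-(Real.pi * K * δ ^ 2)) * 4 := by
        gcongr
        refine hle.trans ?_
        rw [div_le_iff₀ (by linarith)]
        linarith
    _ = _ := mul_comm _ _

lemma exp_neg_le_inv_pow {y : ℝ} {m : ℕ} (h : 6 * (m : ℝ) ≤ y) :
    Real.exp (-y) ≤ ((64 : ℝ) ^ m)⁻¹ := by
  rw [Real.exp_neg]
  refine inv_anti₀ (by positivity) ?_
  calc (64 : ℝ) ^ m = ((2 : ℝ) ^ 6) ^ m := by norm_num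
    _ ≤ (Real.exp 1 ^ 6) ^ m := by
        gcongr
        linarith [Real.add_one_le_exp 1]
    _ = Real.exp (6 * m) := by
        rw [← Real.exp_nat_mul, ← Real.exp_nat_mul]; congr 1; push_cast; ring
    _ ≤ _ := Real.exp_le_exp.2 h

/-- The inverse transform of the Gaussian `exp (-π f² / (32 R² lam))`, with `R = N / w`, truncated
at `32 R lam`, is almost non-negative, and it is negligible outside of `|u| < w / 4`.  By
`theta_eq` the inverse transform without truncation is a sum of positive Gaussians centered at the
multiples of `N`. -/
lemma gauss_sum_bound {N w R lam : ℕ} (hN : N = R * w) (hR : 2 ≤ R) (hlam : 1 ≤ lam)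
    (hw : 64 * lam < w) (u : ℤ) (hu : 2 * |u| ≤ N) :
    -((N : ℝ) * (4 ^ lam : ℝ)⁻¹) ≤ (∑ f ∈ Finset.Icc (-((32 * R * lam : ℕ) : ℤ)) (32 * R * lam : ℕ),
        Complex.exp (-(Real.pi * f ^ 2 / (32 * R * R * lam : ℕ))) * rootPow N (f * u)).re ∧
    ((w : ℤ) ≤ 4 * |u| → ‖∑ f ∈ Finset.Icc (-((32 * R * lam : ℕ) : ℤ)) (32 * R * lam : ℕ),
        Complex.exp (-(Real.pi * f ^ 2 / (32 * R * R * lam : ℕ))) * rootPow N (f * u)‖ ≤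
      (N : ℝ) * (4 ^ lam : ℝ)⁻¹) := by
  have hR' : (2 : ℝ) ≤ R := by exact_mod_cast hR
  have hl' : (1 : ℝ) ≤ lam := by exact_mod_cast hlam
  have hw' : 64 * (lam : ℝ) ≤ w := by exact_mod_cast hw.le
  have hN' : (N : ℝ) = R * w := by exact_mod_cast hN
  have hN0 : (0 : ℝ) < N := by rw [hN']; nlinarith
  have hpi := Real.pi_gt_three
  have hK8 : (8 : ℝ) ≤ ((32 * R * R * lam : ℕ) : ℝ) := by
    have : 1 ≤ R * R * lam := Nat.mul_pos (Nat.mul_pos (by omega) (by omega)) hlam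
    exact_mod_cast (show 8 ≤ 32 * R * R * lam by
      rw [show 32 * R * R * lam = 32 * (R * R * lam) by ring]; omega)
  set K : ℝ := ((32 * R * R * lam : ℕ) : ℝ) with hK
  have hK' : K = 32 * R * R * lam := by rw [hK]; push_cast; ring
  have hK0 : 0 < K := by rw [hK']; positivity
  set F : ℕ := 32 * R * lam with hF
  have hF' : (F : ℝ) = 32 * R * lam := by rw [hF]; push_cast; ring
  set x : ℝ := u / N with hx
  set S := ∑ f ∈ Finset.Icc (-(F : ℤ)) F,
    Complex.exp (-(Real.pi * f ^ 2 / (32 * R * R * lam : ℕ))) *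
    rootPow N (f * u) with hS
  have hSx : S = ∑ f ∈ Finset.Icc (-(F : ℤ)) F, Complex.exp (-(Real.pi * f ^ 2 / K)) *
        Complex.exp (2 * Real.pi * Complex.I * x * f) := by
    rw [hS]
    refine Finset.sum_congr rfl fun f _ => ?_
    rw [rootPow, hx, hK]
    congr 2
    push_cast
    ring
  set Θ : ℝ := Real.sqrt K * ∑' m : ℤ, Real.exp (-(Real.pi * K * (m - x) ^ 2)) with hΘ
  have hρ : (0 : ℝ) < Real.pi / (2 * R) := by positivity
  have htail := gauss_tail (F := F) (ρ := Real.pi / (2 * R)) hK0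
    (by rw [hK', hF']; apply le_of_eq; field_simp) hρ x
  rw [theta_eq hK0, ← hSx, ← hΘ] at htail
  have hΘ0 : 0 ≤ Θ := mul_nonneg (Real.sqrt_nonneg _) (tsum_nonneg fun m => by positivity)
  have hpil : 3 * (lam : ℝ) ≤ Real.pi * lam := by gcongr
  have hbase : ∀ m : ℕ, 1 ≤ m → 6 * ((64 : ℝ) ^ m)⁻¹ ≤ (4 ^ m : ℝ)⁻¹ := by
    intro m hm
    have h16 : (16 : ℝ) ≤ 16 ^ m := le_self_pow₀ (by norm_num) (by omega)
    have : (64 : ℝ) ^ m = 16 ^ m * 4 ^ m := by rw [← mul_pow]; norm_num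
    rw [this, mul_inv, ← mul_assoc]
    refine mul_le_of_le_one_left (by positivity) ?_
    rw [← div_eq_mul_inv, div_le_one (by positivity)]
    linarith
  have htail2 : ‖(Θ : ℂ) - S‖ ≤ N * (2 * (64 ^ lam : ℝ)⁻¹) := by
    refine htail.trans ?_
    have e1 : Real.exp (-(Real.pi / (2 * R) * F)) ≤ (64 ^ lam : ℝ)⁻¹ := by
      apply exp_neg_le_inv_pow
      have : Real.pi / (2 * R) * F = 16 * Real.pi * lam := by rw [hF']; field_simp; ring
      rw [this]; linarith
    have e2 : 2 / (1 - Real.exp (-(Real.pi / (2 * R)))) ≤ 2 * N := by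
      have h1 : 1 / (R : ℝ) ≤ Real.pi / (2 * R) := by
        rw [div_le_div_iff₀ (by positivity) (by positivity)]; nlinarith
      have h2 : Real.exp (-(Real.pi / (2 * R))) ≤ R / (R + 1) := by
        rw [Real.exp_neg, ← inv_div ((R : ℝ) + 1) R]
        refine inv_anti₀ (by positivity) ?_
        calc ((R : ℝ) + 1) / R = 1 / R + 1 := by
              rw [add_div, div_self (show (R : ℝ) ≠ 0 by positivity), add_comm]
          _ ≤ Real.pi / (2 * R) + 1 := by linarith
          _ ≤ _ := Real.add_one_le_exp _
      have h3 : 1 / ((R : ℝ) + 1) ≤ 1 - Real.exp (-(Real.pi / (2 * R))) := by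
        have : (R : ℝ) / (R + 1) = 1 - 1 / (R + 1) := by field_simp; ring
        linarith
      have h4 : (R : ℝ) + 1 ≤ N := by rw [hN']; nlinarith
      calc 2 / (1 - Real.exp (-(Real.pi / (2 * R)))) ≤ 2 / (1 / ((R : ℝ) + 1)) := by gcongr
        _ = 2 * (R + 1) := by field_simp
        _ ≤ _ := by linarith
    have h1r : 0 ≤ 2 / (1 - Real.exp (-(Real.pi / (2 * R)))) := by
      have : Real.exp (-(Real.pi / (2 * R))) < 1 := by rw [Real.exp_lt_one_iff]; linarith
      have : 0 < 1 - Real.exp (-(Real.pi / (2 * R))) := by linarith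
      positivity
    calc _ ≤ (64 ^ lam : ℝ)⁻¹ * (2 * N) := by gcongr
      _ = _ := by ring
  have hb := hbase lam hlam
  have hp64 : 0 < (64 ^ lam : ℝ)⁻¹ := by positivity
  constructor
  · have h1 : |((Θ : ℂ) - S).re| ≤ _ := (Complex.abs_re_le_norm _).trans htail2
    rw [Complex.sub_re, Complex.ofReal_re] at h1
    have h2 := (abs_le.1 h1).2
    have h3 : (N : ℝ) * (2 * (64 ^ lam : ℝ)⁻¹) ≤ N * (4 ^ lam : ℝ)⁻¹ := by
      gcongr; linarith
    linarith
  · intro hwu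
    have hu' : 2 * |(u : ℝ)| ≤ N := by exact_mod_cast hu
    have hwu' : (w : ℝ) ≤ 4 * |(u : ℝ)| := by exact_mod_cast hwu
    have hxabs : |x| = |(u : ℝ)| / N := by rw [hx, abs_div, abs_of_pos hN0]
    have hd := dual_gauss_le (K := K) (δ := 1 / (4 * R)) (x := x)
      (by nlinarith)
      (by rw [hxabs, div_le_iff₀ hN0]; linarith) (by positivity)
      (by
        rw [hxabs, div_le_div_iff₀ (by positivity) hN0, one_mul, hN']
        nlinarith)
      (by
        rw [div_pow, one_pow]
        apply one_div_le_one_div_of_le (by norm_num)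
        nlinarith)
    have e1 : Real.exp (-(Real.pi * K * (1 / (4 * R)) ^ 2)) ≤ (64 ^ lam : ℝ)⁻¹ := by
      apply exp_neg_le_inv_pow
      have : Real.pi * K * (1 / (4 * (R : ℝ))) ^ 2 = 2 * Real.pi * lam := by
        rw [hK']; field_simp; ring
      rw [this]; linarith
    have e2 : Real.sqrt K ≤ N := by
      rw [Real.sqrt_le_iff]
      refine ⟨hN0.le, ?_⟩
      rw [hK', hN', mul_pow]
      have : 32 * (lam : ℝ) ≤ w ^ 2 :=
        (by linarith : 32 * (lam : ℝ) ≤ w).trans (le_self_pow₀ (by linarith) (by norm_num))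
      calc 32 * (R : ℝ) * R * lam = R ^ 2 * (32 * lam) := by ring
        _ ≤ _ := by gcongr
    have hΘle : Θ ≤ N * (4 * (64 ^ lam : ℝ)⁻¹) := by
      rw [hΘ]
      exact mul_le_mul e2 (hd.trans (by gcongr)) (tsum_nonneg fun m => by positivity) hN0.le
    calc ‖S‖ = ‖(Θ : ℂ) - ((Θ : ℂ) - S)‖ := by rw [sub_sub_cancel]
      _ ≤ ‖(Θ : ℂ)‖ + ‖(Θ : ℂ) - S‖ := norm_sub_le _ _
      _ ≤ N * (4 * (64 ^ lam : ℝ)⁻¹) + N * (2 * (64 ^ lam : ℝ)⁻¹) := by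
          rw [Complex.norm_real, Real.norm_eq_abs, abs_of_nonneg hΘ0]
          exact add_le_add hΘle htail2
      _ = N * (6 * (64 ^ lam : ℝ)⁻¹) := by ring
      _ ≤ _ := by gcongr

/-! ### The filters -/

/-- The Gaussian factor of `filtVal`, cut off at `32 (N / w) lam`. -/
def gaussFactor (N w lam : ℕ) (x : ZMod N) : ℝ :=
  if x.valMinAbs.natAbs ≤ 32 * (N / w) * lam then
    Real.exp (-(Real.pi * ((1 - (1 - (N - 2 * (32 * (N / w) * lam)))) * x.valMinAbs.natAbs *
      x.valMinAbs.natAbs : ℕ) / (32 * (N / w) * (N / w) * lam : ℕ)))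
  else 0

/-- The kernel whose spectrum is the Gaussian factor of `filtVal`. -/
def kernel (N w lam : ℕ) [NeZero N] (u : ZMod N) : ℝ :=
  ((N : ℂ)⁻¹ * synth (fun x => (gaussFactor N w lam x : ℂ)) u).re

section
variable {N w lam : ℕ} [NeZero N]

/-- In frequency domain, the filter is the product of the Gaussian factor and the spectrum of a
box. -/
lemma filtVal_val (hw : 2 * (3 * w / 4) < N) (x : ZMod N) :
    filtVal N w lam x.val =
      gaussFactor N w lam x * normDFT (fun s => (box N (3 * w / 4) s : ℂ)) x := by
  have hd : x.val - (x.val - (N - x.val)) = x.valMinAbs.natAbs := by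
    rw [ZMod.valMinAbs_natAbs_eq_min]; have := x.val_lt; omega
  rw [normDFT_box hw, filtVal]
  simp only [hd]
  rw [gaussFactor]
  split_ifs with h
  · rw [show 1 - (x.valMinAbs.natAbs - 32 * (N / w) * lam) = 1 by omega, Complex.ofReal_exp]
    rw [Complex.ofReal_neg, Complex.exp_neg]
    push_cast
    rw [one_mul, div_eq_mul_inv, mul_inv]
    ring
  · rw [show 1 - (x.valMinAbs.natAbs - 32 * (N / w) * lam) = 0 by omega]
    simp

lemma kernel_eq (u : ZMod N) :
    (kernel N w lam u : ℂ) = (N : ℂ)⁻¹ * synth (fun x => (gaussFactor N w lam x : ℂ)) u := by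
  rw [kernel, ← Complex.conj_eq_iff_re, map_mul, map_inv₀, Complex.conj_natCast]
  congr 1
  rw [synth, map_sum, ← Equiv.sum_comp (Equiv.neg _)]
  refine Finset.sum_congr rfl fun x _ => ?_
  rw [map_mul, Complex.conj_ofReal, Equiv.neg_apply]
  congr 1
  · simp only [gaussFactor, ZMod.natAbs_valMinAbs_neg]
  · rw [neg_mul, AddChar.map_neg_eq_conj, Complex.conj_conj]

/-- The mass of the kernel is the value `1` of the Gaussian factor at zero. -/
lemma sum_kernel : ∑ u, kernel N w lam u = 1 := by
  have hN : (N : ℂ) ≠ 0 := by exact_mod_cast NeZero.ne N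
  rw [← Complex.ofReal_inj, Complex.ofReal_sum]
  simp only [kernel_eq, synth]
  rw [← Finset.mul_sum, Finset.sum_comm]
  have : ∀ x : ZMod N, ∑ u : ZMod N, (gaussFactor N w lam x : ℂ) * ZMod.stdAddChar (x * u) =
      if x = 0 then (N : ℂ) else 0 := by
    intro x
    rw [← Finset.mul_sum]
    simp only [mul_comm x]
    rw [sum_stdAddChar]
    split_ifs with h
    · simp [h, gaussFactor]
    · simp
  simp [this, hN]

/-- In time domain, the filter is the convolution of a box with the kernel. -/
lemma synth_filter (B : ℕ) (t : ZMod N) :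
    synth (fun x => gaussFactor N w lam x * normDFT (fun s => (box N B s : ℂ)) x) t =
      ((∑ s, box N B s * kernel N w lam (t - s) : ℝ) : ℂ) := by
  rw [Complex.ofReal_sum]
  simp only [Complex.ofReal_mul, kernel_eq, synth, normDFT_apply, Finset.mul_sum, Finset.sum_mul]
  rw [Finset.sum_comm]
  refine Finset.sum_congr rfl fun s _ => Finset.sum_congr rfl fun x _ => ?_
  rw [show x * (t - s) = -(s * x) + x * t by ring, AddChar.map_add_eq_mul]
  ring

/-- The kernel is almost non-negative and concentrated on `|u| < w / 4`.  If the Gaussian factor is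
dropped, it is the unit impulse. -/
lemma kernel_bound {R : ℕ} (hN : N = R * w) (hR : 2 ≤ R) (hw : 0 < w) (hlam : 1 ≤ lam)
    (u : ZMod N) : -(4 ^ lam : ℝ)⁻¹ ≤ kernel N w lam u ∧
      (w ≤ 4 * u.valMinAbs.natAbs → |kernel N w lam u| ≤ (4 ^ lam : ℝ)⁻¹) := by
  have hN0 : (N : ℂ) ≠ 0 := by exact_mod_cast NeZero.ne N
  have hNpos : (0 : ℝ) < N := by exact_mod_cast NeZero.pos N
  have hdiv : N / w = R := by rw [hN, Nat.mul_div_cancel _ hw]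
  have hub : u.valMinAbs.natAbs ≤ N / 2 := ZMod.natAbs_valMinAbs_le u
  have hε : (0 : ℝ) < (4 ^ lam : ℝ)⁻¹ := by positivity
  rcases Nat.lt_or_ge (2 * (32 * R * lam)) N with hF | hF
  · have hwl : 64 * lam < w := by
      by_contra h
      have : R * w ≤ R * (64 * lam) := Nat.mul_le_mul_left _ (by omega)
      rw [← hN, show R * (64 * lam) = 2 * (32 * R * lam) by ring] at this
      omega
    obtain ⟨h1, h2⟩ := gauss_sum_bound hN hR hlam hwl u.valMinAbs
      (by rw [Int.abs_eq_natAbs]; omega)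
    have hS : synth (fun x => (gaussFactor N w lam x : ℂ)) u =
        ∑ f ∈ Finset.Icc (-((32 * R * lam : ℕ) : ℤ)) (32 * R * lam : ℕ),
          Complex.exp (-(Real.pi * f ^ 2 / (32 * R * R * lam : ℕ))) *
            rootPow N (f * u.valMinAbs) := by
      have h3 := sum_centered hF fun x : ZMod N =>
        Complex.exp (-(Real.pi * (x.valMinAbs : ℂ) ^ 2 / (32 * R * R * lam : ℕ))) *
          ZMod.stdAddChar (x * u)
      calc _ = _ := by
            rw [synth]
            refine Finset.sum_congr rfl fun x _ => ?_
            rw [gaussFactor, hdiv]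
            split_ifs with h
            · rw [show 1 - (1 - (N - 2 * (32 * R * lam))) = 1 by omega, Complex.ofReal_exp]
              congr 2
              have hsq : ((x.valMinAbs.natAbs : ℕ) : ℂ) * (x.valMinAbs.natAbs : ℕ) =
                  (x.valMinAbs : ℂ) ^ 2 := by
                rw [← sq, Nat.cast_natAbs, ← Int.cast_pow, sq_abs, Int.cast_pow]
              push_cast
              rw [one_mul, hsq]
            · simp
        _ = _ := h3
        _ = _ := by
            refine Finset.sum_congr rfl fun f hf => ?_
            rw [Finset.mem_Icc] at hf
            have : |f| ≤ (32 * R * lam : ℕ) := abs_le.2 ⟨hf.1, hf.2⟩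
            rw [valMinAbs_intCast (by omega), rootPow_eq_stdAddChar]
            congr 2
            push_cast
            simp
    rw [← hS] at h1 h2
    constructor
    · rw [kernel, ← Complex.ofReal_natCast, ← Complex.ofReal_inv, Complex.re_ofReal_mul]
      calc -(4 ^ lam : ℝ)⁻¹ = (N : ℝ)⁻¹ * -(N * (4 ^ lam : ℝ)⁻¹) := by field_simp
        _ ≤ _ := by gcongr
    · intro hu
      have h3 := h2 (by rw [Int.abs_eq_natAbs]; omega)
      rw [← Real.norm_eq_abs, ← Complex.norm_real, kernel_eq, norm_mul, norm_inv,
        Complex.norm_natCast]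
      calc _ ≤ (N : ℝ)⁻¹ * (N * (4 ^ lam : ℝ)⁻¹) := by gcongr
        _ = _ := by field_simp
  · have hg : ∀ x : ZMod N, gaussFactor N w lam x = 1 := by
      intro x
      have hx : x.valMinAbs.natAbs ≤ N / 2 := ZMod.natAbs_valMinAbs_le x
      rw [gaussFactor, hdiv, if_pos (by omega),
        show 1 - (1 - (N - 2 * (32 * R * lam))) = 0 by omega]
      simp
    have hk : kernel N w lam u = if u = 0 then 1 else 0 := by
      rw [← Complex.ofReal_inj, kernel_eq, synth]
      simp only [hg, Complex.ofReal_one, one_mul, sum_stdAddChar]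
      split_ifs
      · simp [hN0]
      · simp
    rw [hk]
    constructor
    · split_ifs <;> linarith
    · intro hu
      rw [if_neg (by rintro rfl; simp at hu; omega), abs_zero]
      exact hε.le

/-- The smoothed boxes are filters.  The Gaussian is chosen such that its error is `4 ^ (-lam)`,
which is at most `(ζ / N) ^ 2`. -/
lemma filtVal_eq_normDFT {R : ℕ} {ζ : ℝ} (hN : N = R * w) (hR : 2 ≤ R) (hw : 0 < w)
    (hlam : 1 ≤ lam) (hζ0 : 0 < ζ) (hζ1 : ζ < 1) (hζ : (N : ℝ) / ζ ≤ 2 ^ lam) :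
    ∃ G : ZMod N → ℝ, IsTimeFilter w ζ G ∧
      (fun f : ZMod N => filtVal N w lam f.val) = normDFT fun t => (G t : ℂ) := by
  have hNpos : (0 : ℝ) < N := by exact_mod_cast NeZero.pos N
  have hb := kernel_bound hN hR hw hlam
  refine ⟨_, isTimeFilter_smooth hw (ε := (4 ^ lam : ℝ)⁻¹) (by positivity) ?_ sum_kernel
    (fun u => (hb u).1) (fun u => (hb u).2), ?_⟩
  · have h4 : (4 : ℝ) ^ lam = 2 ^ lam * 2 ^ lam := by rw [← mul_pow]; norm_num
    have h1 : (N : ℝ) ^ 2 / ζ ≤ 4 ^ lam := by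
      calc (N : ℝ) ^ 2 / ζ ≤ (N : ℝ) ^ 2 / ζ / ζ := by
            rw [le_div_iff₀ hζ0]
            exact mul_le_of_le_one_right (by positivity) hζ1.le
        _ = (N / ζ) * (N / ζ) := by field_simp
        _ ≤ 2 ^ lam * 2 ^ lam := by gcongr
        _ = _ := h4.symm
    rw [div_le_iff₀ hζ0] at h1
    rw [← div_eq_mul_inv, div_le_iff₀ (by positivity)]
    linarith
  · have hB : 2 * (3 * w / 4) < N := by
      have : 2 * w ≤ R * w := Nat.mul_le_mul_right _ hR
      omega
    simp only [← synth_filter, filtVal_val hB]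
    exact (normDFT_synth _).symm

end

/-- The parameter of the filter of length `N` and accuracy `ζ`. -/
def filtParam (N : ℕ) (ζ : ℝ) : ℕ := ⌊Real.logb 2 (N / ζ)⌋₊ + 1

/-- The filters used by the programs. -/
def filters : FilterFamily := fun N w ζ f => filtVal N w (filtParam N ζ) f.val

lemma exists_timeFilter {N w : ℕ} [NeZero N] {ζ : ℝ} (hN : ∃ a : ℕ, N = 2 ^ a)
    (hw : ∃ e : ℕ, w = 2 ^ e) (h : 2 * w ≤ N) (hζ0 : 0 < ζ) (hζ1 : ζ < 1) :
    ∃ G : ZMod N → ℝ, IsTimeFilter w ζ G ∧ filters N w ζ = normDFT fun t => (G t : ℂ) := by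
  obtain ⟨a, ha⟩ := hN
  obtain ⟨e, he⟩ := hw
  have hw0 : 0 < w := by rw [he]; positivity
  have hdvd : w ∣ N := by
    rw [ha, he]
    refine Nat.pow_dvd_pow 2 ?_
    have : w ≤ N := by omega
    rw [ha, he] at this
    exact (Nat.pow_le_pow_iff_right (by norm_num)).1 this
  obtain ⟨R, hR⟩ := hdvd
  have hNpos : (0 : ℝ) < N := by exact_mod_cast NeZero.pos N
  refine filtVal_eq_normDFT (R := R) (by rw [hR, mul_comm]) ?_ hw0 (Nat.succ_pos _) hζ0 hζ1 ?_
  · rw [hR, mul_comm 2] at h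
    exact Nat.le_of_mul_le_mul_left h hw0
  · rw [← Real.rpow_natCast, ← Real.logb_le_iff_le_rpow (by norm_num) (by positivity), filtParam]
    push_cast
    exact (Nat.lt_floor_add_one _).le

/-- The support is bounded by `32 (N / w) lam`, where `lam ≤ log₂ (N / ζ) + 1 ≤ 4 log (N / ζ)`. -/
lemma isSemiEquiFilter_filters {C : ℝ} (hC : 128 ≤ C) {N w : ℕ} [NeZero N] {ζ : ℝ}
    (hN : ∃ a : ℕ, N = 2 ^ a) (hw : ∃ e : ℕ, w = 2 ^ e) (h : 2 * w ≤ N) (hζ0 : 0 < ζ)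
    (hζ1 : ζ < 1) : IsSemiEquiFilter C N w ζ (filters N w ζ) := by
  obtain ⟨G, ⟨G₀, hb, h1, h0, hd⟩, hG⟩ := exists_timeFilter hN hw h hζ0 hζ1
  have hw0 : 0 < w := by obtain ⟨e, rfl⟩ := hw; positivity
  have hNpos : (0 : ℝ) < N := by exact_mod_cast NeZero.pos N
  refine ⟨⟨G, G₀, hG, hb, h1, h0, hd⟩, fun f hf => ?_⟩
  rw [filters, filtVal_val (by omega)] at hf
  have hle : f.valMinAbs.natAbs ≤ 32 * (N / w) * filtParam N ζ := by
    by_contra hlt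
    exact hf (by rw [gaussFactor, if_neg hlt]; simp)
  have hx2 : (2 : ℝ) ≤ N / ζ := by
    have : (2 : ℝ) ≤ N := by exact_mod_cast (by omega : 2 ≤ N)
    rw [le_div_iff₀ hζ0]; nlinarith
  have hlog2 : 1 / 2 ≤ Real.log 2 := by linarith [Real.log_two_gt_d9]
  have hlog : Real.log 2 ≤ Real.log (N / ζ) := Real.log_le_log (by norm_num) hx2
  have hlog0 : 0 ≤ Real.log (N / ζ) := by linarith
  have hparam : (filtParam N ζ : ℝ) ≤ 4 * Real.log (N / ζ) := by
    rw [filtParam]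
    push_cast
    have h2 : 1 ≤ Real.logb 2 (N / ζ) := by
      rw [Real.le_logb_iff_rpow_le (by norm_num) (by positivity)]; simpa using hx2
    have h3 := Nat.floor_le (zero_le_one.trans h2)
    have h4 : Real.logb 2 (N / ζ) ≤ 2 * Real.log (N / ζ) := by
      rw [← Real.log_div_log, div_le_iff₀ (by linarith)]
      nlinarith
    linarith
  have hR : ((N / w : ℕ) : ℝ) ≤ (N : ℝ) / w := Nat.cast_div_le
  have hcast : ((|f.valMinAbs| : ℤ) : ℝ) = f.valMinAbs.natAbs := by
    rw [Nat.cast_natAbs]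
  rw [hcast]
  calc ((f.valMinAbs.natAbs : ℕ) : ℝ) ≤ ((32 * (N / w) * filtParam N ζ : ℕ) : ℝ) := by
        exact_mod_cast hle
    _ = 32 * ((N / w : ℕ) : ℝ) * filtParam N ζ := by push_cast; ring
    _ ≤ 32 * ((N : ℝ) / w) * (4 * Real.log (N / ζ)) := by gcongr
    _ = 128 * ((N : ℝ) / w) * Real.log (N / ζ) := by ring
    _ ≤ _ := by gcongr

/-! ### Running time -/

section
variable {I : Inst} {c : ℝ} {a b e B : ℕ}

/-- All windows have length `O(y)`, where `y = a + ⌊c a⌋ + 1` is of the order of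
`c log n`.  The dominant part is the table: there are at most `k₀` blocks with `O(y)` frequencies
each, and the work for a frequency is a transform of length `2 k₁` and `O(k₁ y)` accumulations. -/
lemma Inst.Params.time_le (h : I.Params c a b e B) (hlen : I.len ≤ I.k₀) (hpass : I.npass ≤ 2) :
    setupTime a b e ⌊c * a⌋₊ + I.passTime (b + 1) (e + 1) + 9 ≤
      427000 * (I.k₀ * I.k₁ * (a + ⌊c * a⌋₊ + 1) ^ 2) := by
  set m := ⌊c * a⌋₊ with hm
  set y := a + m + 1 with hy
  have hb := h.b_lt
  have he := h.e_le
  have hk₁ : 1 ≤ I.k₁ := h.k₁_pos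
  have hk₀ := h.k₀_pos
  have hk := h.k_le
  have hb1 := h.b_pos
  have hy1 : 1 ≤ y := by omega
  have hlam₁ : I.lam₁ = y := by rw [h.lam₁_eq]; omega
  have hlam₂ : I.lam₂ ≤ 2 * y := by rw [h.lam₂_eq]; omega
  have hlen₁ : I.len₁ ≤ 133 * y := by rw [Inst.len₁, Inst.H₁, hlam₁]; omega
  have hlen₂ : I.len₂ ≤ 261 * y := by rw [Inst.len₂, Inst.H₂]; omega
  have hq : I.q ≤ I.k₀ + 1 := by rw [Inst.q]; omega
  have hu1 : I.k₁ ≤ I.k₁ * y := Nat.le_mul_of_pos_right _ hy1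
  have hv1 : I.k₀ ≤ I.k₀ * y := Nat.le_mul_of_pos_right _ hy1
  have hv2 : y ≤ I.k₀ * y := Nat.le_mul_of_pos_left _ hk₀
  have hfreq : I.freqTime (b + 1) ≤ 1600 * (I.k₁ * y) := by
    have h2 : (2 : ℕ) ^ (b + 1) = 2 * I.k₁ := by rw [pow_succ', h.k₁_eq]
    rw [Inst.freqTime, fftTime, h2]
    have h3 : (b + 1) * (2 * I.k₁ * 3 + 4) ≤ y * (10 * I.k₁) :=
      Nat.mul_le_mul (by omega) (by omega)
    have h4 : 2 * I.k₁ * ((I.len₂ * 3 + 2) + 2) ≤ 2 * I.k₁ * (787 * y) :=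
      Nat.mul_le_mul_left _ (by omega)
    have h5 : y * (10 * I.k₁) = 10 * (I.k₁ * y) := by ring
    have h6 : 2 * I.k₁ * (787 * y) = 1574 * (I.k₁ * y) := by ring
    omega
  have hw : I.k₀ * (y * (I.k₁ * y)) = I.k₀ * I.k₁ * y ^ 2 := by ring
  have hyu : 1 ≤ y * (I.k₁ * y) := Nat.mul_pos hy1 (by omega)
  have htable : I.tableTime (b + 1) ≤ 213339 * (I.k₀ * I.k₁ * y ^ 2) := by
    rw [Inst.tableTime]
    have h3 : I.len₁ * ((1 + (1 + I.freqTime (b + 1))) + 2) ≤ 133 * y * (1604 * (I.k₁ * y)) :=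
      Nat.mul_le_mul hlen₁ (by omega)
    have h4 : 133 * y * (1604 * (I.k₁ * y)) = 213332 * (y * (I.k₁ * y)) := by ring
    have h5 : I.len * ((1 + (I.len₁ * ((1 + (1 + I.freqTime (b + 1))) + 2) + 2)) + 2) ≤
        I.k₀ * (213337 * (y * (I.k₁ * y))) := Nat.mul_le_mul hlen (by omega)
    have h6 : I.k₀ * (213337 * (y * (I.k₁ * y))) = 213337 * (I.k₀ * I.k₁ * y ^ 2) := by ring
    have h7 : 1 ≤ I.k₀ * (y * (I.k₁ * y)) := Nat.mul_pos hk₀ hyu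
    omega
  have hrow : I.rowTime (e + 1) ≤ 40 * (I.k₀ * y) := by
    have h2 : (2 : ℕ) ^ (e + 1) = 2 * I.k := by rw [pow_succ', h.k_eq]
    rw [Inst.rowTime, fftTime, h2]
    have h3 : (e + 1) * (2 * I.k * 3 + 4) ≤ y * (16 * I.k₀) :=
      Nat.mul_le_mul (by omega) (by omega)
    have h4 : y * (16 * I.k₀) = 16 * (I.k₀ * y) := by ring
    omega
  have hkk : I.k₀ * I.k₁ ≤ I.k₀ * I.k₁ * y ^ 2 := Nat.le_mul_of_pos_right _ (by positivity)
  have hkk1 : 1 ≤ I.k₀ * I.k₁ := Nat.mul_pos hk₀ hk₁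
  have hyw : y ≤ I.k₀ * I.k₁ * y ^ 2 :=
    (Nat.le_self_pow (by norm_num) y).trans (Nat.le_mul_of_pos_left _ hkk1)
  have hpassT : I.passTime (b + 1) (e + 1) ≤ 426910 * (I.k₀ * I.k₁ * y ^ 2) := by
    rw [Inst.passTime]
    have h3 : 4 * I.k₁ * I.k ≤ 4 * I.k₁ * (2 * I.k₀) := Nat.mul_le_mul_left _ hk
    have h4 : 4 * I.k₁ * (2 * I.k₀) = 8 * (I.k₀ * I.k₁) := by ring
    have h5 : 2 * I.k₁ * (I.rowTime (e + 1) + 2) ≤ 2 * I.k₁ * (42 * (I.k₀ * y)) :=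
      Nat.mul_le_mul_left _ (by omega)
    have h6 : 2 * I.k₁ * (42 * (I.k₀ * y)) = 84 * (I.k₀ * I.k₁ * y) := by ring
    have h7 : I.k₀ * I.k₁ * y ≤ I.k₀ * I.k₁ * y ^ 2 :=
      Nat.mul_le_mul_left _ (Nat.le_self_pow (by norm_num) y)
    have h8 : I.npass * ((1 + ((4 * I.k₁ * I.k * 3 + 2) + (I.tableTime (b + 1) +
        (2 * I.k₁ * (I.rowTime (e + 1) + 2) + 2)))) + 2) ≤
        2 * (213454 * (I.k₀ * I.k₁ * y ^ 2)) := Nat.mul_le_mul hpass (by omega)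
    omega
  rw [setupTime]
  omega

/-- The constant in the running time. -/
def timeConst : ℝ := wtBound * (427000 * 36)

lemma Inst.Params.time_le_real (h : I.Params c a b e B) (hlen : I.len ≤ I.k₀) (hpass : I.npass ≤ 2)
    {t : ℕ} (ht : t ≤ wtBound * (setupTime a b e ⌊c * a⌋₊ + I.passTime (b + 1) (e + 1) + 9)) :
    (t : ℝ) ≤ timeConst * (c ^ 2 * I.k₀ * I.k₁ * Real.log I.n ^ 2) := by
  have h1 := ht.trans (Nat.mul_le_mul_left wtBound (h.time_le hlen hpass))
  have hc := h.c_ge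
  have ha : (1 : ℝ) ≤ a := by exact_mod_cast (by have := h.b_lt; omega : 1 ≤ a)
  have hfl : (⌊c * a⌋₊ : ℝ) ≤ c * a := Nat.floor_le (by positivity)
  have hca : (a : ℝ) ≤ c * a := le_mul_of_one_le_left (by positivity) hc
  have hlog : (a : ℝ) ≤ 2 * Real.log I.n := by
    rw [h.n_eq]
    push_cast
    rw [Real.log_pow]
    nlinarith [Real.log_two_gt_d9]
  have hy : (a : ℝ) + ⌊c * a⌋₊ + 1 ≤ 6 * (c * Real.log I.n) := by
    have : c * a ≤ c * (2 * Real.log I.n) := by gcongr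
    linarith
  calc (t : ℝ) ≤ ((wtBound * (427000 * (I.k₀ * I.k₁ * (a + ⌊c * a⌋₊ + 1) ^ 2)) : ℕ) : ℝ) := by
        exact_mod_cast h1
    _ = wtBound * (427000 * (I.k₀ * I.k₁ * ((a : ℝ) + ⌊c * a⌋₊ + 1) ^ 2)) := by push_cast; ring
    _ ≤ wtBound * (427000 * (I.k₀ * I.k₁ * (6 * (c * Real.log I.n)) ^ 2)) := by gcongr
    _ = _ := by rw [timeConst]; ring

end

/-! ### The computed values -/

lemma filters_apply (N w : ℕ) (ζ : ℝ) :
    filters N w ζ = fun f => filtVal N w (filtParam N ζ) f.val := rfl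

lemma filtParam_pow (p a : ℕ) {s : ℝ} : filtParam (2 ^ p) (((2 ^ a : ℕ) : ℝ) ^ (-s)) =
    ⌊(p : ℝ) + s * a⌋₊ + 1 := by
  rw [filtParam]
  congr 2
  have h : ((2 ^ p : ℕ) : ℝ) / ((2 ^ a : ℕ) : ℝ) ^ (-s) = (2 : ℝ) ^ ((p : ℝ) + s * a) := by
    push_cast
    rw [← Real.rpow_natCast 2 a, ← Real.rpow_mul (by norm_num), ← Real.rpow_natCast 2 p,
      ← Real.rpow_sub (by norm_num)]
    congr 1; ring
  rw [h, Real.logb_rpow (by norm_num) (by norm_num)]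

section
variable {I : Inst} {c : ℝ} {a b e B : ℕ} (hp : I.Params c a b e B)
include hp

lemma Inst.Params.lam₁_eq_filtParam : I.lam₁ = filtParam I.n ((I.n : ℝ) ^ (-c)) := by
  have hc := hp.c_ge
  rw [hp.n_eq, filtParam_pow, hp.lam₁_eq, add_comm (a : ℝ), Nat.floor_add_natCast (by positivity)]
  ring

lemma Inst.Params.lam₂_eq_filtParam : I.lam₂ = filtParam I.N ((I.n : ℝ) ^ (-(c + 1))) := by
  have hc := hp.c_ge
  have hb := hp.b_lt
  rw [hp.n_eq, hp.N_pow, filtParam_pow, hp.lam₂_eq,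
    show ((a + 1 - b : ℕ) : ℝ) + (c + 1) * a = c * a + ((a + 1 - b + a : ℕ) : ℝ) by
      push_cast; ring,
    Nat.floor_add_natCast (by positivity)]
  omega

variable [NeZero I.n] [NeZero (2 * I.n / I.k₁)]

/-- The output is a semi-equispaced transform of the reduced spectra, with frequencies permuted by
`σ` and modulated by `Δ'`. -/
lemma outVal_eq_sum {Xh : ZMod I.n → ℂ} (hX : ∀ x, I.X x = Xh (x : ZMod I.n))
    (L : List (ZMod (I.n / I.k₁))) (hL : L.Nodup)
    (hmem : ∀ j, j ∈ L ↔ j ∈ activeBlocks I.k₁ Xh) (hlen : I.len = L.length)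
    (hblk : ∀ j (h : j < L.length), I.blk j = (L[j]).val) (Δ' : ℕ) {r : ℕ}
    (hr : r < 2 * I.k₁) {jj : ℕ} {j : ℤ} (hj : j = jj - (I.k₀ / 2 : ℕ)) :
    I.outVal Δ' r jj = ∑ i ∈ Finset.range (2 * I.k), (I.D : ℂ) * (∑ f : ZMod (2 * I.n / I.k₁),
      reducedSpectrum I.k₁ Xh (filters I.n (I.n / I.k₁) ((I.n : ℝ) ^ (-c))) r f *
        ZMod.stdAddChar (f * (Δ' : ZMod (2 * I.n / I.k₁))) *
        filters (2 * I.n / I.k₁) I.k ((I.n : ℝ) ^ (-(c + 1)))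
          (((I.D * i : ℕ) : ZMod (2 * I.n / I.k₁)) - I.σ * f)) * rootPow (2 * I.k) (i * j) := by
  rw [outVal_eq hp Δ' jj hr]
  refine Finset.sum_congr rfl fun i _ => ?_
  have hk := hp.k_pos
  have hk₀ := hp.k₀_le_k
  congr 1
  · congr 1
    rw [← sum_range_natCast]
    refine Finset.sum_congr rfl fun f hf => ?_
    rw [sum_red hp hX L hL hmem hlen hblk (Finset.mem_range.1 hf),
      show rootPow I.N = rootPow (2 * I.n / I.k₁) from rfl, rootPow_eq_stdAddChar]
    have hperm : I.perm f < I.N := Nat.mod_lt _ hp.N_pos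
    have hval : (I.D * i + I.N - I.perm f) % I.N =
        (((I.D * i : ℕ) : ZMod (2 * I.n / I.k₁)) - I.σ * (f : ZMod (2 * I.n / I.k₁))).val := by
      have h1 : (((I.D * i + I.N - I.perm f : ℕ)) : ZMod (2 * I.n / I.k₁)) =
          ((I.D * i : ℕ) : ZMod (2 * I.n / I.k₁)) - I.σ * (f : ZMod (2 * I.n / I.k₁)) := by
        have h2 : ((I.N : ℕ) : ZMod (2 * I.n / I.k₁)) = 0 := ZMod.natCast_self _
        have h3 : ((I.perm f : ℕ) : ZMod (2 * I.n / I.k₁)) = I.σ * f := by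
          have := ZMod.natCast_mod (I.σ * f) (2 * I.n / I.k₁)
          rw [Nat.cast_mul] at this
          exact this
        rw [Nat.cast_sub (by omega), Nat.cast_add, h2, h3, add_zero]
      rw [← h1, ZMod.val_natCast]
      rfl
    rw [hval, filters_apply, filters_apply, ← hp.lam₁_eq_filtParam]
    have h4 := hp.lam₂_eq_filtParam
    rw [Inst.N] at h4 ⊢
    rw [← h4]
    push_cast
    rfl
  · rw [hj]
    refine rootPow_congr ?_
    have h1 : (((jj + 2 * I.k - I.k₀ / 2) % (2 * I.k) : ℕ) : ℤ) ≡
        jj - (I.k₀ / 2 : ℕ) [ZMOD (2 * I.k : ℕ)] := by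
      rw [Int.natCast_mod]
      refine (Int.mod_modEq _ _).trans ?_
      refine (Int.modEq_iff_dvd.2 ⟨-1, ?_⟩)
      omega
    rw [mul_comm (i : ℤ)]
    exact h1.mul_right _

/-- Without permutation and modulation, the output is that of the procedure. -/
lemma outVal_eq_procedure {Xh : ZMod I.n → ℂ} (hX : ∀ x, I.X x = Xh (x : ZMod I.n))
    (L : List (ZMod (I.n / I.k₁))) (hL : L.Nodup)
    (hmem : ∀ j, j ∈ L ↔ j ∈ activeBlocks I.k₁ Xh) (hlen : I.len = L.length)
    (hblk : ∀ j (h : j < L.length), I.blk j = (L[j]).val) {r : ℕ}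
    (hr : r < 2 * I.k₁) {jj : ℕ} {j : ℤ} (hj : j = jj - (I.k₀ / 2 : ℕ)) (hσ : I.σ = 1) :
    I.outVal 0 r jj = semiEquiInverseBlockFFT filters Xh I.k₀ I.k₁ c r j := by
  rw [outVal_eq_sum hp hX L hL hmem hlen hblk 0 hr hj, semiEquiInverseBlockFFT,
    semiEquiInverseFFT, ← hp.e_eq, ← hp.k_eq]
  refine Finset.sum_congr rfl fun i _ => ?_
  congr 1
  rw [conv, ← sum_range_natCast]
  congr 1
  refine Finset.sum_congr rfl fun f _ => ?_
  rw [hσ, Nat.cast_zero, mul_zero, AddChar.map_zero_eq_one, mul_one, Nat.cast_one, one_mul]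
  rfl

/-- The output for the lift `Δ'` is accurate if the residue of `σ j + Δ'` modulo `2 n / k₁` is in
the pass band of the first filter. -/
lemma outVal_error {X : ZMod I.n → ℂ} (hX : ∀ x, I.X x = normDFT X (x : ZMod I.n))
    (L : List (ZMod (I.n / I.k₁))) (hL : L.Nodup)
    (hmem : ∀ j, j ∈ L ↔ j ∈ activeBlocks I.k₁ (normDFT X)) (hlen : I.len = L.length)
    (hblk : ∀ j (h : j < L.length), I.blk j = (L[j]).val) {Δ' r jj : ℕ}
    (hr : r < 2 * I.k₁) {j t : ℤ} (hj : j = jj - (I.k₀ / 2 : ℕ)) (hjk : 2 * |j| ≤ (I.k₀ : ℤ))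
    (hσ : Odd I.σ) (ht : 2 * |t| ≤ ((I.n / I.k₁ : ℕ) : ℤ))
    (hjt : (t : ZMod (2 * I.n / I.k₁)) = I.σ * j + Δ') :
    ‖I.outVal Δ' r jj - shifted I.k₁ X r t‖ ≤ 2 * (I.n : ℝ) ^ (-c) * l2Norm X := by
  have hn2 : (2 : ℝ) ≤ I.n := by
    have h1 := hp.two_k₁_le
    have h2 := hp.k₁_pos
    exact_mod_cast (by omega : 2 ≤ I.n)
  have hpow : ∀ s : ℝ, 0 < s → 0 < (I.n : ℝ) ^ (-s) ∧ (I.n : ℝ) ^ (-s) < 1 := fun s hs =>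
    ⟨by positivity, Real.rpow_lt_one_of_one_lt_of_neg (by linarith) (by linarith)⟩
  have hc := hp.c_ge
  have hb := hp.b_lt
  have hN := hp.N_pow
  have h2N := hp.N_eq
  have h2k := hp.two_k_le
  have hkk := hp.k₀_le_k
  rw [Inst.N] at hN h2N h2k
  have hw : I.n / I.k₁ = 2 ^ (a - b) := by
    rw [hp.n_eq, hp.k₁_eq, Nat.pow_div hb.le (by norm_num)]
  obtain ⟨G, hG, hG'⟩ := exists_timeFilter (N := I.n) (w := I.n / I.k₁) ⟨a, hp.n_eq⟩ ⟨_, hw⟩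
    (by rw [← h2N]; exact hp.N_le) (hpow c (by linarith)).1 (hpow c (by linarith)).2
  obtain ⟨G₂, hG₂, hG₂'⟩ := exists_timeFilter (N := 2 * I.n / I.k₁) (w := I.k) ⟨_, hN⟩
    ⟨e, hp.k_eq⟩ h2k (hpow (c + 1) (by linarith)).1 (hpow (c + 1) (by linarith)).2
  rw [outVal_eq_sum hp hX L hL hmem hlen hblk Δ' hr hj, hG', hG₂']
  refine two_level_error hc ?_ hp.two_k₁_dvd ?_ hp.two_k_mul_D hG hG₂ X ?_ _ (by omega) ht hjt
  · have h1 := hp.two_k₁_le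
    have h2 := hp.two_half
    have h3 := hp.k₁_pos
    omega
  · exact Dvd.intro _ hp.two_half
  · rw [hN]
    exact Nat.Coprime.pow_right _ (Nat.coprime_two_right.2 hσ)

end

/-! ### The two programs on their inputs -/

/-- The data of a run on the input `Xhat`, with the list `L` of active blocks; `n = 2 ^ a` and
`k₁ = 2 ^ b`. -/
def runData (n k₀ k₁ a b : ℕ) (c : ℝ) (Xh : ZMod n → ℂ) (L : List (ZMod (n / k₁)))
    (σ Δ flag npass : ℕ) : Inst where
  n := n
  k₀ := k₀
  k₁ := k₁
  len := L.length
  σ := σ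
  Δ := Δ
  flag := flag
  npass := npass
  k := 2 ^ Nat.clog 2 k₀
  lam₁ := a + (⌊c * a⌋₊ + 1)
  lam₂ := 2 * a + 1 - b + (⌊c * a⌋₊ + 1)
  blk j := (L.map ZMod.val).getD j 0
  X x := Xh x

section
variable {n k₀ k₁ a b : ℕ} {c : ℝ} {Xh : ZMod n → ℂ} {L : List (ZMod (n / k₁))}
  {σ Δ flag npass : ℕ}

lemma runData_params (ha : n = 2 ^ a) (hb1 : 1 ≤ b) (hb : k₁ = 2 ^ b) (h2 : 2 * k₁ ≤ n)
    (hk₀ : 1 ≤ k₀) (hk₀' : k₀ ≤ n / k₁) (hc : 1 ≤ c) :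
    (runData n k₀ k₁ a b c Xh L σ Δ flag npass).Params c a b (Nat.clog 2 k₀) (n * ⌈c⌉₊) := by
  have hc1 : 1 ≤ ⌈c⌉₊ := Nat.one_le_ceil_iff.2 (by linarith)
  have hn : n ≤ n * ⌈c⌉₊ := Nat.le_mul_of_pos_right _ hc1
  have hk : 2 ≤ k₁ := by rw [hb]; exact Nat.le_self_pow (by omega) 2
  refine ⟨ha, hb, rfl, rfl, hb1, h2, hk₀, hk₀', hc, rfl, rfl, hn, ?_, by omega⟩
  refine Nat.floor_le_of_le ?_
  have h1 : (a : ℝ) ≤ n := by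
    rw [ha]; exact_mod_cast Nat.lt_two_pow_self.le
  push_cast
  rw [mul_comm]
  exact mul_le_mul h1 (Nat.le_ceil c) (by linarith) (by positivity)

lemma getD_le {l : List ℕ} {U : ℕ} (h : ∀ x ∈ l, x ≤ U) (i : ℕ) : l.getD i 0 ≤ U := by
  by_cases hi : i < l.length
  · rw [List.getD_eq_getElem _ _ hi]; exact h _ (List.getElem_mem hi)
  · rw [List.getD_eq_default _ _ (by omega)]; exact Nat.zero_le _

/-- Correctness and running time of both programs; `rest` are the inputs between `k₁` and the list
of active blocks. -/
lemma mainProg_returns [NeZero n] (ha : n = 2 ^ a) (hb1 : 1 ≤ b) (hb : k₁ = 2 ^ b)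
    (h2 : 2 * k₁ ≤ n) (hk₀ : 1 ≤ k₀) (hk₀' : k₀ ≤ n / k₁) (hc : 1 ≤ c) (hlen : L.length ≤ k₀)
    {rest : List ℕ} (hrest : rest.length ≤ 3) (hrestU : ∀ x ∈ rest, x ≤ n) (hσ : σ ≤ n)
    (hΔ : Δ < n / k₁) (hflag : flag ≤ 1) (hnp : npass ≤ 2) {lenE lbE σE ΔE flagE npassE : WExp}
    (hw : lenE.wt ≤ 100 ∧ lbE.wt ≤ 100 ∧ σE.wt ≤ 100 ∧ ΔE.wt ≤ 100 ∧ flagE.wt ≤ 100 ∧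
      npassE.wt ≤ 100)
    (hv : ∀ s : Mem, (∀ i < 10, s.word i = ((n :: k₀ :: k₁ :: rest) ++ L.map ZMod.val).getD i 0) →
      lenE.val s = L.length ∧ lbE.val s = 3 + rest.length ∧ σE.val s = σ ∧ ΔE.val s = Δ ∧
      flagE.val s = flag ∧ npassE.val s = npass) :
    Returns ((n * ⌈c⌉₊) ^ (10 * wtBound)) (mainProg lenE lbE σE ΔE flagE npassE)
      (inputMem ((n :: k₀ :: k₁ :: rest) ++ L.map ZMod.val) c Xh)
      (timeConst * (c ^ 2 * k₀ * k₁ * Real.log n ^ 2)) k₀ k₁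
      (fun r j => ∑ m ∈ Finset.range npass,
        ((runData n k₀ k₁ a b c Xh L σ Δ flag npass).sel (Δ + m * (n / k₁))
          (j + (k₀ / 2 : ℕ)).toNat : ℂ) *
        (runData n k₀ k₁ a b c Xh L σ Δ flag npass).outVal (Δ + m * (n / k₁)) r
          (j + (k₀ / 2 : ℕ)).toNat) := by
  set args := (n :: k₀ :: k₁ :: rest) ++ L.map ZMod.val with hargs
  set I := runData n k₀ k₁ a b c Xh L σ Δ flag npass with hI
  have hp : I.Params c a b (Nat.clog 2 k₀) (n * ⌈c⌉₊) :=
    runData_params ha hb1 hb h2 hk₀ hk₀' hc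
  set B := n * ⌈c⌉₊ with hB
  have hB4 : 4 ≤ B := hp.four_le
  have hnB : n ≤ B := hp.n_le
  have hk₁ : 0 < k₁ := hp.k₁_pos
  have hhn : n / k₁ ≤ n := Nat.div_le_self _ _
  have hh0 : 0 < n / k₁ := by omega
  have : NeZero (n / k₁) := ⟨hh0.ne'⟩
  have hU : 1000 * B ^ 2 ≤ B ^ 10 := by
    rw [show B ^ 10 = B ^ 8 * B ^ 2 by ring]
    exact Nat.mul_le_mul_right _ ((by norm_num : 1000 ≤ 4 ^ 8).trans (Nat.pow_le_pow_left hB4 8))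
  have hBU : 1000 * B ≤ B ^ 10 :=
    (Nat.mul_le_mul_left _ (Nat.le_self_pow (by norm_num) B)).trans hU
  have hargsU : ∀ x ∈ args, x ≤ B ^ 10 := by
    intro x hx
    suffices x ≤ n by omega
    rw [hargs, List.mem_append, List.mem_cons, List.mem_cons, List.mem_cons, List.mem_map] at hx
    rcases hx with (rfl | rfl | rfl | hx) | ⟨y, -, rfl⟩
    · exact le_rfl
    · omega
    · omega
    · exact hrestU x hx
    · exact y.val_lt.le.trans hhn
  -- `B = n ⌈c⌉` is at least `4`, so that `B ^ 10` exceeds the bound `1000 B ^ 2` for stored words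
  let E : Env := ⟨fun i => args.getD i 0, B ^ 10, B ^ (10 * wtBound), by omega,
    by rw [pow_mul], getD_le hargsU⟩
  have hargslen : args.length = 3 + rest.length + L.length := by
    rw [hargs, List.length_append, List.length_map]
    simp only [List.length_cons]
    omega
  have hini0 : E.ini 0 = n := rfl
  have hN2 : 2 * (n / k₁) ≤ n := (hp.N_eq (I := I)).symm.trans_le hp.N_le
  have hgood : I.Good (3 + rest.length) E := by
    refine ⟨rfl, fun j _ => ?_, ?_, hp.n_pos, hp.N_pos, ⟨b, hb⟩, ⟨_, rfl⟩, ?_, ?_, ?_, ?_, ?_, ?_⟩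
    · change args.getD (3 + rest.length + j) 0 = (L.map ZMod.val).getD j 0
      rw [hargs, List.getD_append_right _ _ _ _ (by simp only [List.length_cons]; omega)]
      congr 1
      simp only [List.length_cons]
      omega
    · change 3 + rest.length + L.length ≤ n + 10
      omega
    · change L.length ≤ B ^ 10
      omega
    · change I.fb ≤ B ^ 10
      have := hp.fb_le
      omega
    · change n ≤ B ^ 10
      omega
    · have := hp.N_le
      change I.N ≤ n at this
      change I.N ≤ B ^ 10
      omega
    · change npass ≤ B ^ 10
      omega
    · intro m hm
      change m < npass at hm
      change Δ + m * (n / k₁) ≤ B ^ 10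
      have : m * (n / k₁) ≤ 1 * (n / k₁) := Nat.mul_le_mul_right _ (by omega)
      omega
  have hval := fun reg cpx => hv (memOf E.ini reg cpx) fun i hi =>
    memOf_word_lt _ _ (by omega)
  obtain ⟨s, t, hex, ht, hout⟩ := mainProg_spec hp hgood hU hw rfl rfl
    (fun reg cpx => (hval reg cpx).1)
    (fun reg cpx => (hval reg cpx).2.1) (fun reg cpx => (hval reg cpx).2.2.1)
    (fun reg cpx => (hval reg cpx).2.2.2.1) (fun reg cpx => (hval reg cpx).2.2.2.2.1)
    (fun reg cpx => (hval reg cpx).2.2.2.2.2)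
    (show 3 + rest.length ≤ B ^ 10 by omega) (show σ ≤ B ^ 10 by omega)
    (show Δ ≤ B ^ 10 by omega) (show flag ≤ B ^ 10 by omega)
    (c₀ := (inputMem args c Xh).cpx) (by simp [inputMem])
    (fun x hx => by
      change x < n at hx
      change (if 1 + x = 0 then (c : ℂ) else if 1 + x ≤ n then
        Xh ((1 + x - 1 : ℕ) : ZMod n) else 0) =
        Xh x
      rw [if_neg (by omega), if_pos (by omega), Nat.add_sub_cancel_left])
    (fun x hx => by
      change n < x at hx
      change (if x = 0 then (c : ℂ) else if x ≤ n then Xh ((x - 1 : ℕ) : ZMod n) else 0) = 0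
      rw [if_neg (by omega), if_neg (by omega)])
  have hmem : memOf E.ini (fun _ => 0) (inputMem args c Xh).cpx = inputMem args c Xh := by
    rw [memOf, inputMem]
    congr 1
    funext i
    rw [hini0]
    split_ifs with hi
    · rfl
    · exact (List.getD_eq_default _ _ (by omega)).symm
  rw [hmem] at hex
  refine ⟨s, t, hex, hp.time_le_real hlen hnp ht, fun r hr j hj => ?_⟩
  have hjj : (j + (k₀ / 2 : ℕ)).toNat < I.q := by
    obtain ⟨h1, h2⟩ := abs_le.1 (show |j| ≤ (k₀ / 2 : ℕ) by omega)
    rw [Inst.q, show I.k₀ = k₀ from rfl]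
    omega
  exact hout r hr _ hjj

lemma length_le_of_isBlockSparse {k₀ k₁ : ℕ} {Xh : ZMod n → ℂ} (h : IsBlockSparse k₀ k₁ Xh)
    {L : List (ZMod (n / k₁))} (hL : L.Nodup) (hmem : ∀ j, j ∈ L ↔ j ∈ activeBlocks k₁ Xh) :
    L.length ≤ k₀ := by
  have : activeBlocks k₁ Xh = (L.toFinset : Set (ZMod (n / k₁))) := by
    ext j; rw [← hmem]; simp
  rwa [IsBlockSparse, this, Set.ncard_coe_finset, List.toFinset_card_of_nodup hL] at h

lemma runData_blk (j : ℕ) (h : j < L.length) :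
    (runData n k₀ k₁ a b c Xh L σ Δ flag npass).blk j = (L[j]).val := by
  change (L.map ZMod.val).getD j 0 = _
  rw [List.getD_eq_getElem _ _ (by rwa [List.length_map]), List.getElem_map]

/-- Exactly one of the two lifts of `σ j + Δ` from residues modulo `h` to residues modulo `2 h` has
a representative in `(-h / 2, h / 2]`; it is the one that is selected. -/
lemma exists_lift {h u : ℕ} (hh : 0 < h) (h2 : 2 ∣ h) :
    ∃ m₀ : ℕ, m₀ < 2 ∧ ∃ t : ℤ, 2 * t ≤ h ∧ -(h : ℤ) < 2 * t ∧
      ((2 * h : ℕ) : ℤ) ∣ t - ((u : ℤ) + m₀ * h) ∧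
      ∀ m : ℕ, m < 2 → 1 - (1 - (0 + (1 - (1 - (h - (u + m * h + (h / 2 - 1)) % (2 * h)))))) =
        if m = m₀ then 1 else 0 := by
  obtain ⟨p, rfl⟩ := h2
  rw [Nat.mul_div_cancel_left _ (by norm_num : 0 < 2)]
  set x := (u + (p - 1)) % (2 * (2 * p)) with hx
  have hxlt : x < 2 * (2 * p) := Nat.mod_lt _ (by omega)
  have hdiv : 2 * (2 * p) * ((u + (p - 1)) / (2 * (2 * p))) + x = u + (p - 1) := Nat.div_add_mod _ _
  set q := (u + (p - 1)) / (2 * (2 * p))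
  have h0 : (u + 0 * (2 * p) + (p - 1)) % (2 * (2 * p)) = x := by rw [zero_mul, add_zero]
  have hdiv' : (2 * (2 * p) : ℤ) * q + x = u + (p - 1) := by
    have : ((2 * (2 * p) * q + x : ℕ) : ℤ) = ((u + (p - 1) : ℕ) : ℤ) := by rw [hdiv]
    push_cast [Nat.cast_sub (show 1 ≤ p by omega)] at this
    linarith
  rcases Nat.lt_or_ge x (2 * p) with hlt | hge
  · have h1 : (u + 1 * (2 * p) + (p - 1)) % (2 * (2 * p)) = x + 2 * p := by
      rw [show u + 1 * (2 * p) + (p - 1) = 2 * (2 * p) * q + (x + 2 * p) by omega,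
        Nat.mul_add_mod, Nat.mod_eq_of_lt (by omega)]
    refine ⟨0, by norm_num, x - (p - 1), by omega, by omega, ⟨-q, ?_⟩, fun m hm => ?_⟩
    · push_cast
      linear_combination hdiv'
    · interval_cases m
      · rw [h0, if_pos rfl]; omega
      · rw [h1, if_neg (by norm_num)]; omega
  · have h1 : (u + 1 * (2 * p) + (p - 1)) % (2 * (2 * p)) = x - 2 * p := by
      rw [show u + 1 * (2 * p) + (p - 1) = 2 * (2 * p) * (q + 1) + (x - 2 * p) by
        rw [Nat.mul_add_one]; omega, Nat.mul_add_mod, Nat.mod_eq_of_lt (by omega)]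
    refine ⟨1, by norm_num, x - 2 * p - (p - 1), by omega, by omega, ⟨-(q + 1), ?_⟩,
      fun m hm => ?_⟩
    · push_cast
      linear_combination hdiv'
    · interval_cases m
      · rw [h0, if_neg (by norm_num)]; omega
      · rw [h1, if_pos rfl]; omega

end

/-- The program for the block transform itself: one pass without permutation, in which all time
indices are selected. -/
def blockProg : Prog :=
  mainProg (.get (.lit 3)) (.lit 4) (.lit 1) (.lit 0) (.lit 1) (.lit 1)

/-- The program for the permuted signal: one pass for each lift of `Δ`. -/
def permutedBlockProg : Prog :=
  mainProg (.get (.lit 5)) (.lit 6) (.get (.lit 3)) (.get (.lit 4)) (.lit 0) (.lit 2)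

section
variable {n k₀ k₁ a b : ℕ} {c : ℝ} [NeZero n] {X : ZMod n → ℂ} {L : List (ZMod (n / k₁))}

lemma blockProg_returns (ha : n = 2 ^ a) (hb1 : 1 ≤ b) (hb : k₁ = 2 ^ b)
    (h2 : 2 * k₁ ≤ n) (hk₀ : 1 ≤ k₀) (hk₀' : k₀ ≤ n / k₁) (hc : 1 ≤ c)
    (hX : IsBlockSparse k₀ k₁ (normDFT X)) (hL : L.Nodup)
    (hmem : ∀ j, j ∈ L ↔ j ∈ activeBlocks k₁ (normDFT X)) :
    Returns ((n * ⌈c⌉₊) ^ (10 * wtBound)) blockProg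
        (inputMem ([n, k₀, k₁, L.length] ++ L.map ZMod.val) c (normDFT X))
        (timeConst * (c ^ 2 * k₀ * k₁ * Real.log n ^ 2)) k₀ k₁
        (semiEquiInverseBlockFFT filters (normDFT X) k₀ k₁ c) ∧
      ∀ r < 2 * k₁, ∀ j : ℤ, 2 * |j| ≤ (k₀ : ℤ) →
        ‖semiEquiInverseBlockFFT filters (normDFT X) k₀ k₁ c r j - shifted k₁ X r j‖ ≤
          2 * (n : ℝ) ^ (-c) * l2Norm X := by
  have hlen := length_le_of_isBlockSparse hX hL hmem
  have hlenn : L.length ≤ n := hlen.trans (hk₀'.trans (Nat.div_le_self _ _))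
  set I := runData n k₀ k₁ a b c (normDFT X) L 1 0 1 1 with hI
  have hp : I.Params c a b (Nat.clog 2 k₀) (n * ⌈c⌉₊) := runData_params ha hb1 hb h2 hk₀ hk₀' hc
  have hN := hp.N_pos
  have : NeZero (2 * n / k₁) := ⟨hN.ne'⟩
  have : NeZero I.n := ‹NeZero n›
  have : NeZero (2 * I.n / I.k₁) := ‹NeZero (2 * n / k₁)›
  have hj' : ∀ j : ℤ, 2 * |j| ≤ (k₀ : ℤ) → j = ((j + (k₀ / 2 : ℕ)).toNat : ℤ) - (k₀ / 2 : ℕ) := by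
    intro j hj
    obtain ⟨h1, h2⟩ := abs_le.1 (show |j| ≤ (k₀ / 2 : ℕ) by omega)
    omega
  have heq : ∀ r < 2 * k₁, ∀ j : ℤ, 2 * |j| ≤ (k₀ : ℤ) →
      I.outVal 0 r (j + (k₀ / 2 : ℕ)).toNat =
        semiEquiInverseBlockFFT filters (normDFT X) k₀ k₁ c r j := fun r hr j hj =>
    outVal_eq_procedure hp (Xh := normDFT X) (fun x => rfl) L hL hmem rfl runData_blk hr
      (hj' j hj) rfl
  constructor
  · obtain ⟨s, t, hex, ht, hout⟩ := mainProg_returns (Xh := normDFT X) (L := L) (σ := 1) (Δ := 0)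
      (flag := 1) (npass := 1)
      (lenE := .get (.lit 3)) (lbE := .lit 4) (σE := .lit 1) (ΔE := .lit 0) (flagE := .lit 1)
      (npassE := .lit 1) ha hb1 hb h2 hk₀ hk₀' hc hlen
      (rest := [L.length]) (by simp) (by simpa using hlenn) (NeZero.one_le) (by omega) le_rfl
      (by norm_num) (by decide)
      (fun s hs => ⟨(hs 3 (by norm_num)).trans rfl, rfl, rfl, rfl, rfl, rfl⟩)
    refine ⟨s, t, hex, ht, fun r hr j hj => ?_⟩
    refine (hout r hr j hj).trans ?_
    rw [← heq r hr j hj]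
    have hsel : I.sel 0 (j + (k₀ / 2 : ℕ)).toNat = 1 := by
      rw [Inst.sel, show I.flag = 1 from rfl]; omega
    simp only [Finset.sum_range_one, zero_mul, add_zero, ← hI, hsel, Nat.cast_one, one_mul]
  · intro r hr j hj
    rw [← heq r hr j hj]
    refine outVal_error hp (X := X) (fun x => rfl) L hL hmem rfl runData_blk hr (hj' j hj) hj
      odd_one (hj.trans (by exact_mod_cast hk₀')) ?_
    rw [show I.σ = 1 from rfl]
    simp

lemma permutedBlockProg_returns (ha : n = 2 ^ a) (hb1 : 1 ≤ b) (hb : k₁ = 2 ^ b)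
    (h2 : 2 * k₁ ≤ n) (hk₀ : 1 ≤ k₀) (hk₀' : k₀ ≤ n / k₁) (hc : 1 ≤ c)
    (hX : IsBlockSparse k₀ k₁ (normDFT X)) (hL : L.Nodup)
    (hmem : ∀ j, j ∈ L ↔ j ∈ activeBlocks k₁ (normDFT X)) (σ Δ : ZMod (n / k₁))
    (hσ : Odd σ.val) :
    ∃ Y : ℕ → ℤ → ℂ,
      Returns ((n * ⌈c⌉₊) ^ (10 * wtBound)) permutedBlockProg
        (inputMem ([n, k₀, k₁, σ.val, Δ.val, L.length] ++ L.map ZMod.val) c (normDFT X))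
        (timeConst * (c ^ 2 * k₀ * k₁ * Real.log n ^ 2)) k₀ k₁ Y ∧
      ∀ r < 2 * k₁, ∀ j : ℤ, 2 * |j| ≤ (k₀ : ℤ) →
        ‖Y r j - shifted k₁ X r (σ * (j : ZMod (n / k₁)) + Δ).valMinAbs‖ ≤
          2 * (n : ℝ) ^ (-c) * l2Norm X := by
  have hlen := length_le_of_isBlockSparse hX hL hmem
  have hhn : n / k₁ ≤ n := Nat.div_le_self _ _
  have : NeZero (n / k₁) := ⟨by omega⟩
  have hσn := σ.val_lt
  have hΔn := Δ.val_lt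
  set I := runData n k₀ k₁ a b c (normDFT X) L σ.val Δ.val 0 2 with hI
  have hp : I.Params c a b (Nat.clog 2 k₀) (n * ⌈c⌉₊) := runData_params ha hb1 hb h2 hk₀ hk₀' hc
  have hN := hp.N_pos
  have : NeZero (2 * n / k₁) := ⟨hN.ne'⟩
  have : NeZero I.n := ‹NeZero n›
  have : NeZero (2 * I.n / I.k₁) := ‹NeZero (2 * n / k₁)›
  refine ⟨_, mainProg_returns (Xh := normDFT X) (L := L) (σ := σ.val) (Δ := Δ.val)
      (flag := 0) (npass := 2) ha hb1 hb h2 hk₀ hk₀' hc hlen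
      (rest := [σ.val, Δ.val, L.length]) (by simp) ?_ (by omega) hΔn (by norm_num)
      le_rfl (by decide) (fun s hs => ⟨(hs 5 (by norm_num)).trans rfl, rfl,
        (hs 3 (by norm_num)).trans rfl, (hs 4 (by norm_num)).trans rfl, rfl, rfl⟩), ?_⟩
  · intro x hx
    simp only [List.mem_cons, List.not_mem_nil, or_false] at hx
    rcases hx with rfl | rfl | rfl <;> omega
  intro r hr j hj
  set jj := (j + (k₀ / 2 : ℕ)).toNat with hjj
  have hj' : j = (jj : ℤ) - (k₀ / 2 : ℕ) := by
    obtain ⟨h1, h2⟩ := abs_le.1 (show |j| ≤ (k₀ / 2 : ℕ) by omega)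
    omega
  have hNeq : I.N = 2 * (n / k₁) := hp.N_eq
  have hh2 : 2 ∣ n / k₁ := by
    have := hp.b_lt
    rw [ha, hb, Nat.pow_div this.le (by norm_num)]
    exact dvd_pow_self _ (by omega)
  have hkN : k₀ / 2 ≤ jj + I.N := by omega
  obtain ⟨m₀, hm₀, t, ht1, ht2, ht3, hsel⟩ := exists_lift
    (u := σ.val * (jj + I.N - k₀ / 2) + Δ.val) (by omega : 0 < n / k₁) hh2
  have hselI : ∀ m < 2, I.sel (Δ.val + m * (n / k₁)) jj = if m = m₀ then 1 else 0 := by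
    intro m hm
    rw [← hsel m hm, Inst.sel, ← hNeq, ← add_assoc]
    rfl
  have hsum : ∑ m ∈ Finset.range 2, (I.sel (Δ.val + m * (n / k₁)) jj : ℂ) *
      I.outVal (Δ.val + m * (n / k₁)) r jj = I.outVal (Δ.val + m₀ * (n / k₁)) r jj := by
    rw [Finset.sum_eq_single m₀]
    · rw [hselI _ hm₀, if_pos rfl, Nat.cast_one, one_mul]
    · intro m hm hne
      rw [hselI _ (Finset.mem_range.1 hm), if_neg hne, Nat.cast_zero, zero_mul]
    · intro h; exact absurd (Finset.mem_range.2 hm₀) h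
  have hucast : ((σ.val * (jj + I.N - k₀ / 2) + Δ.val : ℕ) : ℤ) =
      σ.val * j + Δ.val + σ.val * I.N := by
    rw [hj']
    push_cast [Nat.cast_sub hkN]
    ring
  rw [← hNeq, hucast] at ht3
  obtain ⟨z, hz⟩ := ht3
  have htv : (σ * (j : ZMod (n / k₁)) + Δ).valMinAbs = t := by
    rw [ZMod.valMinAbs_spec]
    refine ⟨?_, by omega, by omega⟩
    have h3 : t = σ.val * j + Δ.val + (n / k₁ : ℕ) * (2 * σ.val + m₀ + 2 * z) := by
      rw [hNeq] at hz
      push_cast at hz ⊢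
      linear_combination hz
    rw [h3]
    simp only [Int.cast_add, Int.cast_mul, Int.cast_natCast, ZMod.natCast_self,
      ZMod.natCast_zmod_val, zero_mul, add_zero]
  rw [htv]
  change ‖(∑ m ∈ Finset.range 2, (I.sel (Δ.val + m * (n / k₁)) jj : ℂ) *
      I.outVal (Δ.val + m * (n / k₁)) r jj) - _‖ ≤ _
  rw [hsum]
  refine outVal_error hp (X := X) (fun x => rfl) L hL hmem rfl runData_blk hr hj' hj hσ ?_ ?_
  · have : |2 * t| ≤ (n / k₁ : ℕ) := abs_le.2 ⟨by omega, by omega⟩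
    rwa [abs_mul, abs_two] at this
  · have h3 : t = σ.val * j + ((Δ.val + m₀ * (n / k₁) : ℕ) : ℤ) + (I.N : ℤ) * (σ.val + z) := by
      rw [Nat.cast_add, Nat.cast_mul]
      linear_combination hz
    have h4 : ((I.N : ℕ) : ZMod (2 * I.n / I.k₁)) = 0 := ZMod.natCast_self _
    rw [h3]
    simp only [Int.cast_add, Int.cast_mul, Int.cast_natCast, h4, zero_mul, add_zero]
    rfl

end

end

end BlockFFT

theorem mainTheorem8 :
    ∃ (filt : BlockFFT.FilterFamily) (C : ℝ) (A : ℕ) (P₁ P₂ : BlockFFT.Prog),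
      -- the filters used by the procedure
      (∀ (N w : ℕ) [NeZero N] (ζ : ℝ), (∃ a : ℕ, N = 2 ^ a) → (∃ e : ℕ, w = 2 ^ e) →
        2 * w ≤ N → 0 < ζ → ζ < 1 →
        BlockFFT.IsSemiEquiFilter C N w ζ (filt N w ζ)) ∧
      ∀ (n k₀ k₁ : ℕ) [NeZero n], (∃ a : ℕ, n = 2 ^ a) → (∃ b : ℕ, 1 ≤ b ∧ k₁ = 2 ^ b) →
        2 * k₁ ≤ n → 1 ≤ k₀ → k₀ ≤ n / k₁ →
        ∀ c : ℝ, 1 ≤ c →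
        ∀ X : ZMod n → ℂ, BlockFFT.IsBlockSparse k₀ k₁ (BlockFFT.normDFT X) →
        -- `L` lists the indices of the non-zero blocks
        ∀ L : List (ZMod (n / k₁)), L.Nodup →
          (∀ j, j ∈ L ↔ j ∈ BlockFFT.activeBlocks k₁ (BlockFFT.normDFT X)) →
        -- first part
        (BlockFFT.Returns ((n * ⌈c⌉₊) ^ A) P₁
            (BlockFFT.inputMem ([n, k₀, k₁, L.length] ++ L.map ZMod.val) c (BlockFFT.normDFT X))
            (C * (c ^ 2 * k₀ * k₁ * Real.log n ^ 2)) k₀ k₁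
            (BlockFFT.semiEquiInverseBlockFFT filt (BlockFFT.normDFT X) k₀ k₁ c) ∧
          ∀ r < 2 * k₁, ∀ j : ℤ, 2 * |j| ≤ (k₀ : ℤ) →
            ‖BlockFFT.semiEquiInverseBlockFFT filt (BlockFFT.normDFT X) k₀ k₁ c r j
                - BlockFFT.shifted k₁ X r j‖
              ≤ 2 * (n : ℝ) ^ (-c) * BlockFFT.l2Norm X) ∧
        -- second part
        ∀ σ Δ : ZMod (n / k₁), Odd σ.val →
          ∃ Y : ℕ → ℤ → ℂ,
            BlockFFT.Returns ((n * ⌈c⌉₊) ^ A) P₂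
              (BlockFFT.inputMem ([n, k₀, k₁, σ.val, Δ.val, L.length] ++ L.map ZMod.val) c
                (BlockFFT.normDFT X))
              (C * (c ^ 2 * k₀ * k₁ * Real.log n ^ 2)) k₀ k₁ Y ∧
            ∀ r < 2 * k₁, ∀ j : ℤ, 2 * |j| ≤ (k₀ : ℤ) →
              ‖Y r j - BlockFFT.shifted k₁ X r (σ * (j : ZMod (n / k₁)) + Δ).valMinAbs‖
                ≤ 2 * (n : ℝ) ^ (-c) * BlockFFT.l2Norm X := by
  refine ⟨BlockFFT.filters, BlockFFT.timeConst, 10 * BlockFFT.wtBound, BlockFFT.blockProg,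
    BlockFFT.permutedBlockProg, ?_, ?_⟩
  · intro N w _ ζ hN hw h h0 h1
    refine BlockFFT.isSemiEquiFilter_filters ?_ hN hw h h0 h1
    rw [BlockFFT.timeConst, BlockFFT.wtBound]
    norm_num
  · rintro n k₀ k₁ _ ⟨a, ha⟩ ⟨b, hb1, hb⟩ h2 hk₀ hk₀' c hc X hX L hL hmem
    exact ⟨BlockFFT.blockProg_returns ha hb1 hb h2 hk₀ hk₀' hc hX hL hmem, fun σ Δ hσ =>
      BlockFFT.permutedBlockProg_returns ha hb1 hb h2 hk₀ hk₀' hc hX hL hmem σ Δ hσ⟩
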